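/- Let $H$ be a separable complex Hilbert space, let $K$ be a separable real Hilbert space, and let $W$ be a cylindrical Wiener process on $K$ over a probability space $(\Omega,\mathbb{P})$; that is, $\iota\colon K\to K'$ is a dense injective Hilbert--Schmidt embedding into a larger Hilbert space and $W$ is a centred $K'$-valued Gaussian process indexed by $t\ge 0$ with $\mathbb{E}\langle h,W(s)\rangle\langle W(t),k\rangle=(s\wedge t)\langle\iota^*h,\iota^*k\rangle$ for all $h,k\in K'$. Let $L$ generate an analytic semigroup $(S(t))_{t\ge 0}$ on $H$ and fix $\lambda\in\mathbb{R}$ such that $\|S(t)\|\le Me^{at}$ for all $t\ge 0$, for some constants $M$ and $a<\lambda$ (if $\|S(t)\|$ decays exponentially one may take $\lambda=0$). For $a>0$ let $(\lambda-L)^{-a}=\frac1{\Gamma(a)}\int_0^\infty t^{a-1}e^{-\lambda t}S(t)\,dt$, and let $(\lambda-L)^{a}$ be the inverse of this injective bounded operator, defined on its range; put $(\lambda-L)^0=\mathrm{Id}$. For $a\ge 0$ let $H_a$ be the domain of $(\lambda-L)^a$ with norm $\|x\|_a=\|(\lambda-L)^ax\|$; for $a>0$ let $H_{-a}$ be the completion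 of $H$ under the norm $\|x\|_{-a}=\|(\lambda-L)^{-a}x\|$. Let $\alpha\ge 0$ be such that $Q\colon K\to H_\alpha$ is a bounded linear operator, let $\beta\in(0,\tfrac12+\alpha]$ be such that $(\lambda-L)^{-\beta}$ is Hilbert--Schmidt on $H$, let $x_0\in H$, and set $\gamma_0=\tfrac12+\alpha-\beta\ge 0$. Consider the linear stochastic equation $$dx=Lx\,dt+Q\,dW(t),\qquad x(0)=x_0 .$$ For $E=H$, or $E=H_\gamma\supset H$ with $\gamma<0$, a (mild) solution in $E$ is an $E$-valued process $x$ such that for every $t>0$, almost surely, $x(t)=S(t)x_0+\int_0^tS(t-s)Q\,dW(s)$, the It\^o integral being taken in $E$. Then: 1. If $\gamma_0>0$, the equation has a solution in $H$. For every $\gamma<\gamma_0$ with $\gamma<0$, it has a solution in $H_\gamma$. 2. For every $\gamma$ with $0\le\gamma<\gamma_0$ and every solution $x$ in $H$, one has $x(t)\in H_\gamma$ almost surely for every $t>0$. 3. For every $\gamma<\gamma_0$, every solution $x$ (in $H$ if $\gamma\ge 0$, in $H_\gamma$ if $\gamma<0$) has a modification $y$ on $(0,\infty)$ which takes values in $H_\gamma$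 and such that, almost surely, for every $\delta\in[0,\tfrac12\wedge(\gamma_0-\gamma))$, the path $t\mapsto y(t)\in H_\gamma$ is $\delta$-H\"older continuous on every interval $[t_0,T]$ with $0<t_0<T<\infty$. -/

import Mathlib

open MeasureTheory ProbabilityTheory Filter Topology Set
open scoped NNReal ENNReal InnerProductSpace

namespace LinSPDE

noncomputable section

/-! ### Hilbert–Schmidt norm -/

section HilbertSchmidt

variable {𝕜 : Type*} [RCLike 𝕜]
  {K : Type*} [NormedAddCommGroup K] [InnerProductSpace 𝕜 K] [CompleteSpace K]
  {E : Type*} [SeminormedAddCommGroup E] [NormedSpace 𝕜 E]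

/-- An orthonormal basis of the Hilbert space `K`, as a subset of `K`. -/
def onbSet (𝕜 : Type*) [RCLike 𝕜] (K : Type*) [NormedAddCommGroup K] [InnerProductSpace 𝕜 K]
    [CompleteSpace K] : Set K :=
  Classical.choose (exists_hilbertBasis 𝕜 K)

/-- The squared Hilbert–Schmidt norm `∑ ‖A eᵢ‖²` over an orthonormal basis of `K`, with values
in `[0,∞]`. By `hsNormSq_eq_tsum` it does not depend on the orthonormal basis. -/
def hsNormSq (A : K →L[𝕜] E) : ℝ≥0∞ :=
  ∑' e : onbSet 𝕜 K, ‖A (e : K)‖ₑ ^ 2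

end HilbertSchmidt

section HilbertSchmidtIndep

variable {𝕜 : Type*} [RCLike 𝕜]
  {K : Type*} [NormedAddCommGroup K] [InnerProductSpace 𝕜 K] [CompleteSpace K]
  {E : Type*} [NormedAddCommGroup E] [InnerProductSpace 𝕜 E] [CompleteSpace E]

theorem enorm_sq_eq_tsum {ι : Type*} (b : HilbertBasis ι 𝕜 K) (x : K) :
    ‖x‖ₑ ^ 2 = ∑' i, ‖⟪b i, x⟫_𝕜‖ₑ ^ 2 := by
  have h : HasSum (fun i => ‖⟪b i, x⟫_𝕜‖ ^ 2) (‖x‖ ^ 2) := by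
    have h2 := b.hasSum_inner_mul_inner x x
    have h3 := (RCLike.reCLM (K := 𝕜)).hasSum h2
    have e1 : RCLike.re ⟪x, x⟫_𝕜 = ‖x‖ ^ 2 := inner_self_eq_norm_sq x
    simp only [RCLike.reCLM_apply] at h3
    rw [e1] at h3
    refine h3.congr_fun ?_
    intro i
    rw [← inner_conj_symm x (b i), RCLike.conj_mul]
    norm_cast
  have h4 := ENNReal.ofReal_tsum_of_nonneg (fun i => sq_nonneg (‖⟪b i, x⟫_𝕜‖)) h.summable
  rw [h.tsum_eq] at h4
  simpa [ENNReal.ofReal_pow, ofReal_norm] using h4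

theorem tsum_enorm_sq_adjoint {ι κ : Type*} (b : HilbertBasis ι 𝕜 K) (c : HilbertBasis κ 𝕜 E)
    (A : K →L[𝕜] E) :
    ∑' i, ‖A (b i)‖ₑ ^ 2 = ∑' j, ‖ContinuousLinearMap.adjoint A (c j)‖ₑ ^ 2 := by
  simp_rw [enorm_sq_eq_tsum c, enorm_sq_eq_tsum b]
  rw [ENNReal.tsum_comm]
  refine tsum_congr fun j => tsum_congr fun i => ?_
  rw [ContinuousLinearMap.adjoint_inner_right, ← inner_conj_symm, RCLike.enorm_conj]

/-- The Hilbert–Schmidt norm does not depend on the orthonormal basis. -/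
theorem hsNormSq_eq_tsum {ι : Type*} (b : HilbertBasis ι 𝕜 K) (A : K →L[𝕜] E) :
    hsNormSq A = ∑' i, ‖A (b i)‖ₑ ^ 2 := by
  obtain ⟨_, c, _⟩ := exists_hilbertBasis 𝕜 E
  obtain ⟨b', hb'⟩ := Classical.choose_spec (exists_hilbertBasis 𝕜 K)
  rw [tsum_enorm_sq_adjoint b c, ← tsum_enorm_sq_adjoint b' c]
  unfold hsNormSq onbSet
  rw [hb']

end HilbertSchmidtIndep

/-! ### Semigroups -/

section Semigroup

variable {H : Type*} [NormedAddCommGroup H] [NormedSpace ℂ H]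

/-- A strongly continuous semigroup `(S t)_{t ≥ 0}` of bounded operators (the values of `S` at
negative times are irrelevant). -/
structure IsC0Semigroup (S : ℝ → H →L[ℂ] H) : Prop where
  zero : S 0 = ContinuousLinearMap.id ℂ H
  add : ∀ s t : ℝ, 0 ≤ s → 0 ≤ t → S (s + t) = (S s).comp (S t)
  cont : ContinuousOn (fun p : H × ℝ => S p.2 p.1) (univ ×ˢ Ici (0 : ℝ))

/-- The open sector `{z ≠ 0 : |arg z| < θ}`. -/
def sector (θ : ℝ) : Set ℂ := {z | z ≠ 0 ∧ |z.arg| < θ}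

/-- An analytic semigroup: the map `t ↦ S t` has an analytic extension `T` to a sector around the
positive half-line, `T` is multiplicative there, and it restricts to a strongly continuous
semigroup on each ray. -/
structure IsAnalyticSemigroup (S : ℝ → H →L[ℂ] H) : Prop where
  c0 : IsC0Semigroup S
  exists_extension : ∃ θ : ℝ, 0 < θ ∧ θ ≤ Real.pi / 2 ∧ ∃ T : ℂ → H →L[ℂ] H,
    (∀ t : ℝ, 0 ≤ t → T (t : ℂ) = S t) ∧
    AnalyticOnNhd ℂ T (sector θ) ∧
    (∀ z ∈ sector θ, ∀ w ∈ sector θ, T (z + w) = (T z).comp (T w)) ∧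
    ∀ φ : ℝ, |φ| < θ →
      IsC0Semigroup (fun t : ℝ => T ((t : ℂ) * Complex.exp ((φ : ℂ) * Complex.I)))

/-- `L` is the generator of `S`: its domain consists of all `x` for which the limit of
`t⁻¹ (S t x - x)` as `t ↓ 0` exists, and `L x` is that limit. -/
def IsGenerator (L : H →ₗ.[ℂ] H) (S : ℝ → H →L[ℂ] H) : Prop :=
  ∀ x y : H, (∃ h : x ∈ L.domain, L ⟨x, h⟩ = y) ↔
    Tendsto (fun t : ℝ => ((t⁻¹ : ℝ) : ℂ) • (S t x - x)) (𝓝[>] 0) (𝓝 y)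

/-- `lam` exceeds an exponential growth rate of `S`: the semigroup `e^{-lam t} S t`, generated by
`L - lam`, decays exponentially. -/
def IsAdmissibleShift (S : ℝ → H →L[ℂ] H) (lam : ℝ) : Prop :=
  ∃ M a : ℝ, a < lam ∧ ∀ t : ℝ, 0 ≤ t → ‖S t‖ ≤ M * Real.exp (a * t)

/-- The bounded operator `(lam - L)^{-a}` for `a ≥ 0`:
`Γ(a)⁻¹ ∫₀^∞ t^{a-1} e^{-lam t} S t dt` for `a > 0`, and the identity for `a = 0`. -/
def negPow (S : ℝ → H →L[ℂ] H) (lam a : ℝ) : H →L[ℂ] H :=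
  if a = 0 then ContinuousLinearMap.id ℂ H
  else (((Real.Gamma a)⁻¹ : ℝ) : ℂ) •
    ∫ t in Ioi (0 : ℝ), ((t ^ (a - 1) * Real.exp (-(lam * t)) : ℝ) : ℂ) • S t

/-- The unbounded operator `(lam - L)^a` for `a ≥ 0`, the inverse of `(lam - L)^{-a}`, with domain
the range of `(lam - L)^{-a}`. -/
def posPow (S : ℝ → H →L[ℂ] H) (lam a : ℝ) : H →ₗ.[ℂ] H :=
  (((negPow S lam a : H →L[ℂ] H) : H →ₗ[ℂ] H).toPMap ⊤).inverse

/-! ### Interpolation spaces -/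

/-- The interpolation space `H_a` for `a ≥ 0`: the domain of `(lam - L)^a`, normed by
`‖x‖_a = ‖(lam - L)^a x‖`. -/
def Interp (S : ℝ → H →L[ℂ] H) (lam a : ℝ) : Type _ := (posPow S lam a).domain

namespace Interp

variable {S : ℝ → H →L[ℂ] H} {lam a : ℝ}

instance : AddCommGroup (Interp S lam a) :=
  inferInstanceAs (AddCommGroup (posPow S lam a).domain)

instance : Module ℂ (Interp S lam a) :=
  inferInstanceAs (Module ℂ (posPow S lam a).domain)

/-- `(lam - L)^a` as a linear map on `H_a`. -/
def pow : Interp S lam a →ₗ[ℂ] H := (posPow S lam a).toFun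

/-- The inclusion of `H_a` in `H`. -/
def incl : Interp S lam a →ₗ[ℂ] H := (posPow S lam a).domain.subtype

instance : SeminormedAddCommGroup (Interp S lam a) :=
  SeminormedAddCommGroup.induced (Interp S lam a) H pow

instance : NormedSpace ℂ (Interp S lam a) :=
  NormedSpace.induced ℂ (Interp S lam a) H pow

theorem norm_def (x : Interp S lam a) : ‖x‖ = ‖pow x‖ := rfl

end Interp

/-- The space `H` with the norm `‖(lam - L)^{-a} x‖`. -/
def PreExtrap (_S : ℝ → H →L[ℂ] H) (_lam _a : ℝ) : Type _ := H

namespace PreExtrap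

variable {S : ℝ → H →L[ℂ] H} {lam a : ℝ}

instance : AddCommGroup (PreExtrap S lam a) := inferInstanceAs (AddCommGroup H)

instance : Module ℂ (PreExtrap S lam a) := inferInstanceAs (Module ℂ H)

/-- `(lam - L)^{-a}` as a linear map on this copy of `H`. -/
def pow : PreExtrap S lam a →ₗ[ℂ] H := ((negPow S lam a : H →L[ℂ] H) : H →ₗ[ℂ] H)

/-- The identity, from `H` to this copy of it. -/
def ofH : H →ₗ[ℂ] PreExtrap S lam a := (LinearMap.id : H →ₗ[ℂ] H)

instance : SeminormedAddCommGroup (PreExtrap S lam a) :=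
  SeminormedAddCommGroup.induced (PreExtrap S lam a) H pow

instance : NormedSpace ℂ (PreExtrap S lam a) :=
  NormedSpace.induced ℂ (PreExtrap S lam a) H pow

theorem norm_ofH (x : H) : ‖(ofH x : PreExtrap S lam a)‖ = ‖negPow S lam a x‖ := rfl

end PreExtrap

/-- The space `H_{-a}` for `a > 0`: the completion of `H` for the norm `‖(lam - L)^{-a} x‖`. -/
def Extrap (S : ℝ → H →L[ℂ] H) (lam a : ℝ) : Type _ :=
  UniformSpace.Completion (PreExtrap S lam a)

namespace Extrap

variable {S : ℝ → H →L[ℂ] H} {lam a : ℝ}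

instance : NormedAddCommGroup (Extrap S lam a) :=
  inferInstanceAs (NormedAddCommGroup (UniformSpace.Completion (PreExtrap S lam a)))

instance : NormedSpace ℂ (Extrap S lam a) :=
  inferInstanceAs (NormedSpace ℂ (UniformSpace.Completion (PreExtrap S lam a)))

instance : CompleteSpace (Extrap S lam a) :=
  inferInstanceAs (CompleteSpace (UniformSpace.Completion (PreExtrap S lam a)))

/-- The canonical bounded map `H → H_{-a}`. -/
def ofH (S : ℝ → H →L[ℂ] H) (lam a : ℝ) : H →L[ℂ] Extrap S lam a :=
  (UniformSpace.Completion.toComplL (𝕜 := ℂ) (E := PreExtrap S lam a)).comp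
    (LinearMap.mkContinuous PreExtrap.ofH ‖negPow S lam a‖
      (fun x => (negPow S lam a).le_opNorm x))

theorem norm_ofH (x : H) : ‖ofH S lam a x‖ = ‖negPow S lam a x‖ :=
  UniformSpace.Completion.norm_coe (PreExtrap.ofH x : PreExtrap S lam a)

end Extrap

end Semigroup

/-! ### Cylindrical Wiener processes and the stochastic integral of deterministic integrands -/

section Stochastic

variable {K : Type*} [NormedAddCommGroup K] [InnerProductSpace ℝ K] [CompleteSpace K]
  {K' : Type*} [NormedAddCommGroup K'] [InnerProductSpace ℝ K'] [CompleteSpace K']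
  {Ω : Type*} [MeasurableSpace Ω]

/-- `W` is a cylindrical Wiener process on `K`, realised in the larger Hilbert space `K'`, in which
`K` is densely embedded by the Hilbert–Schmidt map `ι`: a centred Gaussian process with
`E ⟨h, W s⟩ ⟨W t, k⟩ = (s ∧ t) ⟨ι* h, ι* k⟩`. -/
structure IsCylindricalWiener [MeasurableSpace K'] (ι : K →L[ℝ] K') (W : ℝ≥0 → Ω → K')
    (P : Measure Ω) : Prop where
  hilbertSchmidt : hsNormSq ι < ∞
  injective : Function.Injective ι
  denseRange : DenseRange ι
  gaussian : IsGaussianProcess W P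
  centred : ∀ (t : ℝ≥0) (h : K'), ∫ ω, ⟪h, W t ω⟫_ℝ ∂P = 0
  covariance : ∀ (s t : ℝ≥0) (h k : K'),
    ∫ ω, ⟪h, W s ω⟫_ℝ * ⟪W t ω, k⟫_ℝ ∂P =
      ((min s t : ℝ≥0) : ℝ) *
        ⟪ContinuousLinearMap.adjoint ι h, ContinuousLinearMap.adjoint ι k⟫_ℝ

variable {E : Type*} [NormedAddCommGroup E] [NormedSpace ℝ E]

/-- Data of a deterministic step function `∑ 1_{(left i, right i]} B i ∘ ι` with values in the
Hilbert–Schmidt operators from `K` to `E`. -/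
structure StepFn (K' E : Type*) [NormedAddCommGroup K'] [NormedSpace ℝ K']
    [NormedAddCommGroup E] [NormedSpace ℝ E] where
  card : ℕ
  left : Fin card → ℝ≥0
  right : Fin card → ℝ≥0
  le : ∀ i, left i ≤ right i
  op : Fin card → K' →L[ℝ] E

/-- The operator-valued step function. -/
def StepFn.toFun (F : StepFn K' E) (ι : K →L[ℝ] K') (r : ℝ) : K →L[ℝ] E :=
  ∑ i, (Ioc (F.left i : ℝ) (F.right i)).indicator (fun _ => (F.op i).comp ι) r

/-- Its stochastic integral `∑ B i (W (right i) - W (left i))`. -/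
def StepFn.integral (F : StepFn K' E) (W : ℝ≥0 → Ω → K') (ω : Ω) : E :=
  ∑ i, F.op i (W (F.right i) ω - W (F.left i) ω)

/-- `I` is the stochastic integral `∫₀^∞ Φ(r) dW(r)` of the deterministic integrand `Φ`: there are
step functions converging to `Φ` in `L²(ℝ₊; HS(K, E))` whose stochastic integrals converge to `I`
in `L²(Ω; E)`. -/
def IsStochasticIntegral (ι : K →L[ℝ] K') (W : ℝ≥0 → Ω → K') (P : Measure Ω)
    (Φ : ℝ → K →L[ℝ] E) (I : Ω → E) : Prop :=
  (∀ k, AEStronglyMeasurable (fun r => Φ r k) (volume.restrict (Ioi (0 : ℝ)))) ∧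
  AEStronglyMeasurable I P ∧
  ∃ F : ℕ → StepFn K' E,
    Tendsto (fun n => ∫⁻ r in Ioi (0 : ℝ), hsNormSq (Φ r - (F n).toFun ι r)) atTop (𝓝 0) ∧
    Tendsto (fun n => ∫⁻ ω, ‖I ω - (F n).integral W ω‖ₑ ^ 2 ∂P) atTop (𝓝 0)

variable {H : Type*} [NormedAddCommGroup H] [NormedSpace ℂ H]

/-- `x` is a mild solution of `dx = L x dt + Q dW`, `x(0) = x₀`, with values in a space `E` to which
`H` is mapped by `j`: for every `t > 0`, almost surely
`x(t) = j S(t) x₀ + ∫₀ᵗ j S(t - r) Q dW(r)`. -/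
def IsMildSolution (S : ℝ → H →L[ℂ] H) (Q : K →L[ℝ] H) (x₀ : H)
    (ι : K →L[ℝ] K') (W : ℝ≥0 → Ω → K') (P : Measure Ω) (j : H →L[ℝ] E)
    (x : ℝ≥0 → Ω → E) : Prop :=
  ∀ t : ℝ≥0, 0 < t → ∃ I : Ω → E,
    IsStochasticIntegral ι W P
      ((Ioc (0 : ℝ) t).indicator
        (fun r => j.comp (((S ((t : ℝ) - r)).restrictScalars ℝ).comp Q))) I ∧
    ∀ᵐ ω ∂P, x t ω = j (S t x₀) + I ω

/-- A path is `δ`-Hölder continuous on every compact subinterval of `(0,∞)`. -/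
def LocallyHolder {F : Type*} [PseudoEMetricSpace F] (δ : ℝ≥0) (f : ℝ≥0 → F) : Prop :=
  ∀ t₀ T : ℝ≥0, 0 < t₀ → ∃ C : ℝ≥0, HolderOnWith C δ f (Icc t₀ T)

end Stochastic

end

end LinSPDE

namespace LinSPDE

noncomputable section

/-! Write `A = lam - L` and `T t = e^{-lam t} S t`, which is exponentially stable. Boundedness of
`Q` into `H_α` means `Q = A^{-α} Q'` with `Q'` bounded, and then `V = A^{-β} Q'` is Hilbert–Schmidt.
With `r = γ - α + β` one has, formally, `S(u) Q = A^{-γ} G(u) V` with `G(u) = e^{lam u} A^r T(u)`.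
The condition `γ < γ₀` is exactly `r < 1/2`, so the regularity statement in `H_γ` becomes a
statement in `H` about the stochastic convolution of the fixed Hilbert–Schmidt operator `V` with a
kernel that behaves at `0` like `u^{-r}`, or is bounded when `r ≤ 0`. For `γ < 0` the extension of
`A^γ` to `H_γ` is an isometry onto `H`, and the same reduction applies.

Analyticity enters through `‖A T(t)‖ ≤ C / t`, a Cauchy estimate on discs of radius proportional to
`t` (`IsAnalyticSemigroup.exists_norm_deriv_le`). It yields `‖A^q T(t)‖ ≤ C t^{-q}` and `‖A^q (T(t +
h) - T(t))‖ ≤ C h^θ t^{-q-θ}` for `0 < q < 1`. Positive powers of `A` are never applied as unbounded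
operators: `A^r T(t)` is written `A^{-(1-r)} (A T(t))`, with both factors bounded.

By these two bounds the integrands at times `s < t` are at squared distance at most `C (t - s)^{2θ}`
in `L²(HS)` for every `θ < 1/2 - max r 0` (`IsSingularKernel.exists_lintegral_sub_le`). The Itô
isometry turns this into a second moment of the increment. Gaussianity upgrades it to all even
moments (`lintegral_enorm_pow_le_of_coordinates`), and a Kolmogorov argument
(`exists_holder_modification`) gives Hölder paths for every `δ < 1/2 - max r 0`, which is `(1/2) ∧
(γ₀ - γ)`.

The initial value contributes `S(t) x₀ = A^{-γ} v(t)` with `v` of class `C¹` on `(0, ∞)`, hence the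
restriction to intervals bounded away from `0`. Arbitrary solutions agree almost surely at each time
with the one constructed, because the stochastic integral of a given integrand is unique up to null
sets. -/

theorem enorm_add_sq_le {E : Type*} [SeminormedAddGroup E] (a b : E) :
    ‖a + b‖ₑ ^ 2 ≤ 4 * (‖a‖ₑ ^ 2 + ‖b‖ₑ ^ 2) := by
  have h : ‖a + b‖ₑ ≤ 2 * max ‖a‖ₑ ‖b‖ₑ :=
    calc ‖a + b‖ₑ ≤ ‖a‖ₑ + ‖b‖ₑ := by
          simp only [← ofReal_norm]
          rw [← ENNReal.ofReal_add (norm_nonneg _) (norm_nonneg _)]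
          exact ENNReal.ofReal_le_ofReal (norm_add_le a b)
      _ ≤ 2 * max ‖a‖ₑ ‖b‖ₑ := by
          rw [two_mul]; exact add_le_add (le_max_left _ _) (le_max_right _ _)
  calc ‖a + b‖ₑ ^ 2 ≤ (2 * max ‖a‖ₑ ‖b‖ₑ) ^ 2 := by gcongr
    _ = 4 * (max ‖a‖ₑ ‖b‖ₑ) ^ 2 := by rw [mul_pow]; norm_num
    _ ≤ 4 * (‖a‖ₑ ^ 2 + ‖b‖ₑ ^ 2) := by
      gcongr
      rcases le_total ‖a‖ₑ ‖b‖ₑ with h | h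
      · rw [max_eq_right h]; exact le_add_self
      · rw [max_eq_left h]; exact le_self_add

/-! ### Hilbert–Schmidt norms: ideal property and quasi-triangle inequality. -/

section HilbertSchmidtGeneral

variable {𝕜 : Type*} [RCLike 𝕜]
  {K : Type*} [NormedAddCommGroup K] [InnerProductSpace 𝕜 K] [CompleteSpace K]
  {E : Type*} [SeminormedAddCommGroup E] [NormedSpace 𝕜 E]
  {F : Type*} [SeminormedAddCommGroup F] [NormedSpace 𝕜 F]

theorem hsNormSq_comp_le (B : E →L[𝕜] F) (A : K →L[𝕜] E) :
    hsNormSq (B.comp A) ≤ ‖B‖ₑ ^ 2 * hsNormSq A := by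
  unfold hsNormSq
  rw [← ENNReal.tsum_mul_left]
  refine ENNReal.tsum_le_tsum fun e => ?_
  rw [← mul_pow]
  gcongr
  exact B.le_opENorm _

@[simp]
theorem hsNormSq_zero : hsNormSq (0 : K →L[𝕜] E) = 0 := by
  simp [hsNormSq, ← ofReal_norm]

theorem hsNormSq_add_le (A B : K →L[𝕜] E) :
    hsNormSq (A + B) ≤ 4 * (hsNormSq A + hsNormSq B) := by
  unfold hsNormSq
  rw [← ENNReal.tsum_add, ← ENNReal.tsum_mul_left]
  exact ENNReal.tsum_le_tsum fun e => enorm_add_sq_le _ _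

theorem hsNormSq_neg (A : K →L[𝕜] E) : hsNormSq (-A) = hsNormSq A := by
  simp [hsNormSq]

theorem hsNormSq_sub_comm (A B : K →L[𝕜] E) : hsNormSq (A - B) = hsNormSq (B - A) := by
  rw [← hsNormSq_neg, neg_sub]

theorem hsNormSq_sub_le (A B : K →L[𝕜] E) :
    hsNormSq (A - B) ≤ 4 * (hsNormSq A + hsNormSq B) := by
  rw [sub_eq_add_neg, ← hsNormSq_neg B]
  exact hsNormSq_add_le _ _

theorem exists_hilbertBasis_onbSet (𝕜 : Type*) [RCLike 𝕜] (K : Type*) [NormedAddCommGroup K]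
    [InnerProductSpace 𝕜 K] [CompleteSpace K] :
    ∃ b : HilbertBasis (onbSet 𝕜 K) 𝕜 K, ⇑b = ((↑) : onbSet 𝕜 K → K) :=
  Classical.choose_spec (exists_hilbertBasis 𝕜 K)

/-- Orthonormal vectors are at distance `√2`, so the balls of radius `1/2` around them are disjoint
and open. -/
instance [TopologicalSpace.SeparableSpace K] : Countable (onbSet 𝕜 K) := by
  obtain ⟨b, hb⟩ := exists_hilbertBasis_onbSet 𝕜 K
  have ho : Orthonormal 𝕜 ((↑) : onbSet 𝕜 K → K) := hb ▸ b.orthonormal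
  refine Set.countable_coe_iff.2 ?_
  refine Set.PairwiseDisjoint.countable_of_isOpen (s := fun e : K => Metric.ball e (1 / 2))
    (fun e he f hf hef => ?_) (fun _ _ => Metric.isOpen_ball) fun e _ => ⟨e, by simp⟩
  refine Metric.ball_disjoint_ball ?_
  have h0 : ⟪e, f⟫_𝕜 = 0 :=
    ho.2 (i := ⟨e, he⟩) (j := ⟨f, hf⟩) (fun h => hef (congrArg Subtype.val h))
  have h1 : ‖e‖ = 1 := ho.1 ⟨e, he⟩
  have h2 : ‖f‖ = 1 := ho.1 ⟨f, hf⟩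
  have h3 := norm_sub_sq (𝕜 := 𝕜) e f
  rw [h0, h1, h2] at h3
  rw [dist_eq_norm]
  simp only [map_zero] at h3
  nlinarith [norm_nonneg (e - f)]

theorem aemeasurable_hsNormSq [TopologicalSpace.SeparableSpace K] {α : Type*} [MeasurableSpace α]
    {μ : Measure α} {Φ : α → K →L[𝕜] E} (h : ∀ k, AEStronglyMeasurable (fun r => Φ r k) μ) :
    AEMeasurable (fun r => hsNormSq (Φ r)) μ :=
  AEMeasurable.tsum fun e => ((h e).enorm).pow_const 2

end HilbertSchmidtGeneral

section RealComplex

variable {K : Type*} [NormedAddCommGroup K] [InnerProductSpace ℝ K] [CompleteSpace K]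
  {H : Type*} [NormedAddCommGroup H] [InnerProductSpace ℂ H] [CompleteSpace H]

/-- Over the reals, `Re ⟪y, Q bᵢ⟫` is the `i`-th coordinate of `Q* y`, so this is Parseval together
with `‖Q*‖ = ‖Q‖`. -/
theorem tsum_enorm_re_inner_sq_le {ι : Type*} (b : HilbertBasis ι ℝ K) (Q : K →L[ℝ] H) (y : H) :
    ∑' i, ‖RCLike.re ⟪y, Q (b i)⟫_ℂ‖ₑ ^ 2 ≤ ‖Q‖ₑ ^ 2 * ‖y‖ₑ ^ 2 := by
  let _ : InnerProductSpace ℝ H := InnerProductSpace.complexToReal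
  let A : H →L[ℝ] K := ContinuousLinearMap.adjoint (𝕜 := ℝ) (E := K) (F := H) Q
  have h (i : ι) : RCLike.re ⟪y, Q (b i)⟫_ℂ = ⟪b i, A y⟫_ℝ := by
    rw [ContinuousLinearMap.adjoint_inner_right, real_inner_comm]
    rfl
  simp_rw [h]
  rw [← enorm_sq_eq_tsum b, ← mul_pow]
  gcongr
  refine (A.le_opENorm y).trans_eq ?_
  congr 1
  simp only [A, ← ofReal_norm, LinearIsometryEquiv.norm_map]

/-- The operator `Q` is only real-linear, so the complex adjoint is not available for the composite.
Expanding in a complex basis of `H` and splitting `|z|² = (Re z)² + (Re (-i z))²` leaves two real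
Parseval sums, which explains the factor `2`; what remains is the Hilbert–Schmidt norm of `R*`. -/
theorem hsNormSq_restrictScalars_comp_le (R : H →L[ℂ] H) (Q : K →L[ℝ] H) :
    hsNormSq ((R.restrictScalars ℝ).comp Q) ≤ 2 * ‖Q‖ₑ ^ 2 * hsNormSq R := by
  obtain ⟨b, hb⟩ := exists_hilbertBasis_onbSet ℝ K
  obtain ⟨_, c, _⟩ := exists_hilbertBasis ℂ H
  have e1 : hsNormSq ((R.restrictScalars ℝ).comp Q) = ∑' i, ‖R (Q (b i))‖ₑ ^ 2 := by
    unfold hsNormSq; rw [hb]; rfl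
  rw [e1, hsNormSq_eq_tsum c, tsum_enorm_sq_adjoint c c, ← ENNReal.tsum_mul_left]
  simp_rw [enorm_sq_eq_tsum c]
  rw [ENNReal.tsum_comm]
  refine ENNReal.tsum_le_tsum fun j => ?_
  set y := ContinuousLinearMap.adjoint R (c j)
  have key (z : ℂ) : ‖z‖ₑ ^ 2 = ‖RCLike.re z‖ₑ ^ 2 + ‖RCLike.re (-Complex.I * z)‖ₑ ^ 2 := by
    have : ‖z‖ ^ 2 = ‖RCLike.re z‖ ^ 2 + ‖RCLike.re (-Complex.I * z)‖ ^ 2 := by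
      rw [← Complex.normSq_eq_norm_sq, Complex.normSq_apply]
      simp; ring
    simp only [← ofReal_norm, ← ENNReal.ofReal_pow (norm_nonneg _)]
    rw [this, ENNReal.ofReal_add (by positivity) (by positivity)]
  have h2 (i) : ‖⟪c j, R (Q (b i))⟫_ℂ‖ₑ ^ 2 = ‖RCLike.re ⟪y, Q (b i)⟫_ℂ‖ₑ ^ 2
      + ‖RCLike.re ⟪Complex.I • y, Q (b i)⟫_ℂ‖ₑ ^ 2 := by
    rw [← ContinuousLinearMap.adjoint_inner_left, key, inner_smul_left]
    simp [y]
  rw [← enorm_sq_eq_tsum c]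
  simp_rw [h2]
  rw [ENNReal.tsum_add]
  refine (add_le_add (tsum_enorm_re_inner_sq_le b Q y)
    (tsum_enorm_re_inner_sq_le b Q (Complex.I • y))).trans_eq ?_
  rw [enorm_smul, show ‖Complex.I‖ₑ = 1 by simp [← ofReal_norm]]
  ring

end RealComplex

/-! ### Approximation of Hilbert–Schmidt operators on `K` by operators factoring through `ι`. -/

section Approximation

variable {K : Type*} [NormedAddCommGroup K] [InnerProductSpace ℝ K] [CompleteSpace K]
  {K' : Type*} [NormedAddCommGroup K'] [InnerProductSpace ℝ K'] [CompleteSpace K']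
  {E : Type*} [NormedAddCommGroup E] [NormedSpace ℝ E]

/-- The orthogonal complement of the range of `ι*` is the kernel of `ι`. -/
theorem denseRange_adjoint {ι : K →L[ℝ] K'} (hι : Function.Injective ι) :
    DenseRange (ContinuousLinearMap.adjoint ι) := by
  have h := ContinuousLinearMap.orthogonal_range (ContinuousLinearMap.adjoint ι)
  rw [ContinuousLinearMap.adjoint_adjoint, LinearMap.ker_eq_bot.2 hι,
    ← Submodule.topologicalClosure_eq_top_iff] at h
  exact Submodule.dense_iff_topologicalClosure_eq_top.2 h

theorem hsNormSq_smulRight (f : K) (v : E) :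
    hsNormSq ((innerSL ℝ f).smulRight v) = ‖f‖ₑ ^ 2 * ‖v‖ₑ ^ 2 := by
  obtain ⟨b, hb⟩ := exists_hilbertBasis_onbSet ℝ K
  rw [enorm_sq_eq_tsum b, ← ENNReal.tsum_mul_right]
  unfold hsNormSq
  refine tsum_congr fun e => ?_
  simp [enorm_smul, mul_pow, hb, real_inner_comm]

/-- Approximate `e` by some `ι* h`: the rank-one operator built from `ι* h` and `v` is the one built
from `h` and `v`, composed with `ι`. -/
theorem exists_hsNormSq_sub_smulRight_lt {ι : K →L[ℝ] K'} (hι : Function.Injective ι) (e : K)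
    (v : E) {ε : ℝ≥0∞} (hε : 0 < ε) : ∃ B : K' →L[ℝ] E,
      hsNormSq ((innerSL ℝ e).smulRight v - B.comp ι) < ε := by
  have hc : Continuous fun f : K => ‖e - f‖ₑ ^ 2 * ‖v‖ₑ ^ 2 := by
    refine (ENNReal.continuous_mul_const (by simp)).comp ?_
    fun_prop
  have ho : IsOpen {f : K | ‖e - f‖ₑ ^ 2 * ‖v‖ₑ ^ 2 < ε} := isOpen_lt hc continuous_const
  obtain ⟨h, hh⟩ := (denseRange_adjoint hι).exists_mem_open ho ⟨e, by simpa using hε⟩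
  refine ⟨(innerSL ℝ h).smulRight v, ?_⟩
  have : (innerSL ℝ e).smulRight v - ((innerSL ℝ h).smulRight v).comp ι
      = (innerSL ℝ (e - ContinuousLinearMap.adjoint ι h)).smulRight v := by
    ext k
    simp [sub_smul, ContinuousLinearMap.adjoint_inner_left]
  rw [this, hsNormSq_smulRight]
  exact hh

theorem exists_hsNormSq_sum_sub_lt {ι : K →L[ℝ] K'} (hι : Function.Injective ι) (V : K →L[ℝ] E)
    (s : Finset K) {ε : ℝ≥0∞} (hε : 0 < ε) : ∃ B : K' →L[ℝ] E,
      hsNormSq (∑ e ∈ s, (innerSL ℝ e).smulRight (V e) - B.comp ι) < ε := by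
  classical
  induction s using Finset.induction_on generalizing ε with
  | empty => exact ⟨0, by simpa using hε⟩
  | insert e s hes ih =>
    have h8 : 0 < ε / 8 := ENNReal.div_pos hε.ne' (by simp)
    obtain ⟨B₁, h₁⟩ := exists_hsNormSq_sub_smulRight_lt hι e (V e) h8
    obtain ⟨B₂, h₂⟩ := ih h8
    refine ⟨B₁ + B₂, ?_⟩
    rw [Finset.sum_insert hes, ContinuousLinearMap.add_comp, add_sub_add_comm]
    calc _ ≤ _ := hsNormSq_add_le _ _
      _ < 4 * (ε / 8 + ε / 8) :=
        ENNReal.mul_lt_mul_right (by simp) (by simp) (ENNReal.add_lt_add h₁ h₂)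
      _ = ε := by
        rw [← ENNReal.add_div, ← two_mul, ← mul_div_assoc, ← mul_assoc]
        norm_num
        rw [mul_comm, mul_div_assoc, ENNReal.div_self (by simp) (by simp), mul_one]

/-- Truncating `V` to finitely many basis vectors costs only a tail of `∑ ‖V e‖²`; the remaining
finite-rank operator is handled term by term. -/
theorem exists_hsNormSq_sub_comp_lt {ι : K →L[ℝ] K'} (hι : Function.Injective ι) {V : K →L[ℝ] E}
    (hV : hsNormSq V < ∞) {ε : ℝ≥0∞} (hε : 0 < ε) : ∃ B : K' →L[ℝ] E,
      hsNormSq (V - B.comp ι) < ε := by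
  classical
  obtain ⟨b, hb⟩ := exists_hilbertBasis_onbSet ℝ K
  have ho : Orthonormal ℝ ((↑) : onbSet ℝ K → K) := hb ▸ b.orthonormal
  -- The quasi-triangle inequality has constant `4`, and `4 * (ε / 8 + ε / 8) = ε`.
  have h8 : 0 < ε / 8 := ENNReal.div_pos hε.ne' (by simp)
  have ht := ENNReal.tendsto_tsum_compl_atTop_zero hV.ne
  obtain ⟨s, hs⟩ := ((tendsto_order.1 ht).2 _ h8).exists
  obtain ⟨B, hB⟩ := exists_hsNormSq_sum_sub_lt hι V (s.map ⟨_, Subtype.val_injective⟩) h8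
  refine ⟨B, ?_⟩
  set P := ∑ e ∈ s.map ⟨((↑) : onbSet ℝ K → K), Subtype.val_injective⟩,
    (innerSL ℝ e).smulRight (V e) with hP
  have h1 : hsNormSq (V - P) < ε / 8 := by
    refine lt_of_le_of_lt ?_ hs
    have hval (e : onbSet ℝ K) : (V - P) e = if e ∈ s then 0 else V e := by
      have : P e = ∑ i ∈ s, (if i = e then V e else 0) := by
        simp only [hP, Finset.sum_map, sum_apply,
          Function.Embedding.coeFn_mk, ContinuousLinearMap.smulRight_apply, innerSL_apply_apply]
        refine Finset.sum_congr rfl fun i _ => ?_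
        rw [orthonormal_iff_ite.1 ho i e]
        split_ifs with h <;> simp [h]
      rw [sub_apply, this, Finset.sum_ite_eq']
      split_ifs <;> simp
    unfold hsNormSq
    rw [← tsum_subtype_eq_of_support_subset (s := {e : onbSet ℝ K | e ∉ s}) fun e he hes => he (by
      have h : (V - P) (e : K) = 0 := (hval e).trans (if_pos hes)
      simp only [h, enorm_zero, zero_pow two_ne_zero])]
    refine ENNReal.tsum_le_tsum fun i => ?_
    have h : (V - P) (i : onbSet ℝ K) = V (i : onbSet ℝ K) := (hval i).trans (if_neg i.2)
    exact (congrArg (fun v => ‖v‖ₑ ^ 2) h).le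
  calc hsNormSq (V - B.comp ι) = hsNormSq ((V - P) + (P - B.comp ι)) := by
        rw [sub_add_sub_cancel]
    _ ≤ 4 * (hsNormSq (V - P) + hsNormSq (P - B.comp ι)) := hsNormSq_add_le _ _
    _ < 4 * (ε / 8 + ε / 8) :=
        ENNReal.mul_lt_mul_right (by simp) (by simp) (ENNReal.add_lt_add h1 hB)
    _ = ε := by
        rw [← ENNReal.add_div, ← two_mul, ← mul_div_assoc, ← mul_assoc]
        norm_num
        rw [mul_comm, mul_div_assoc, ENNReal.div_self (by simp) (by simp), mul_one]

end Approximation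

/-! ### Fractional powers and smoothing estimates for exponentially stable analytic semigroups. -/

section Stable

variable {H : Type*} [NormedAddCommGroup H] [NormedSpace ℂ H]

/-- An exponentially stable strongly continuous semigroup with `‖T' t‖ ≤ C / t`. -/
structure IsStableAnalytic (T : ℝ → H →L[ℂ] H) : Prop where
  add : ∀ s t : ℝ, 0 ≤ s → 0 ≤ t → T (s + t) = T s * T t
  tendsto : ∀ x : H, Tendsto (fun t => T t x) (𝓝[>] 0) (𝓝 x)
  decay : ∃ M ε : ℝ, 0 < ε ∧ ∀ t : ℝ, 0 ≤ t → ‖T t‖ ≤ M * Real.exp (-(ε * t))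
  diff : ∀ t : ℝ, 0 < t → DifferentiableAt ℝ T t
  deriv_le : ∃ C : ℝ, ∀ t : ℝ, 0 < t → ‖deriv T t‖ ≤ C / t

/-- The negative fractional power of order `a` of the generator of `-T`. -/
def frac (T : ℝ → H →L[ℂ] H) (a : ℝ) : H →L[ℂ] H :=
  if a = 0 then 1 else (Real.Gamma a)⁻¹ • ∫ t in Ioi (0 : ℝ), t ^ (a - 1) • T t

/-- Minus the derivative of the semigroup. -/
def negDeriv (T : ℝ → H →L[ℂ] H) (t : ℝ) : H →L[ℂ] H := -deriv T t

/-- The fractional power of order `r ≤ 1` of the negative generator, composed with the semigroup. -/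
def smoothing (T : ℝ → H →L[ℂ] H) (r t : ℝ) : H →L[ℂ] H := frac T (1 - r) * negDeriv T t

theorem frac_zero (T : ℝ → H →L[ℂ] H) : frac T 0 = 1 := by simp [frac]

theorem integral_rpow_mul_sub_rpow {a b x : ℝ} (ha : 0 < a) (hb : 0 < b) (hx : 0 < x) :
    ∫ t in (0 : ℝ)..x, t ^ (a - 1) * (x - t) ^ (b - 1)
      = x ^ (a + b - 1) * ProbabilityTheory.beta a b := by
  have h := Complex.betaIntegral_scaled a b hx
  have e : ∫ t in (0 : ℝ)..x, (t : ℂ) ^ ((a : ℂ) - 1) * ((x : ℂ) - t) ^ ((b : ℂ) - 1)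
      = ((∫ t in (0 : ℝ)..x, t ^ (a - 1) * (x - t) ^ (b - 1) : ℝ) : ℂ) := by
    rw [← intervalIntegral.integral_ofReal]
    refine intervalIntegral.integral_congr fun t ht => ?_
    rw [uIcc_of_le hx.le] at ht
    simp only [Complex.ofReal_mul]
    rw [Complex.ofReal_cpow ht.1, Complex.ofReal_cpow (sub_nonneg.2 ht.2)]
    push_cast
    rfl
  rw [e] at h
  have h' := congrArg Complex.re h
  rw [Complex.ofReal_re] at h'
  rw [h', ProbabilityTheory.beta_eq_betaIntegralReal a b ha hb]
  rw [show ((x : ℂ) ^ ((a : ℂ) + b - 1)) = ((x ^ (a + b - 1) : ℝ) : ℂ) by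
    rw [Complex.ofReal_cpow hx.le]; push_cast; rfl, Complex.re_ofReal_mul]

namespace IsStableAnalytic

variable {T : ℝ → H →L[ℂ] H} (hT : IsStableAnalytic T)
include hT

theorem hasDerivAt {t : ℝ} (ht : 0 < t) : HasDerivAt T (-negDeriv T t) t := by
  rw [negDeriv, neg_neg]
  exact (hT.diff t ht).hasDerivAt

theorem continuousOn : ContinuousOn T (Ioi 0) := fun t ht =>
  (hT.diff t ht).continuousAt.continuousWithinAt

theorem commute {s t : ℝ} (hs : 0 ≤ s) (ht : 0 ≤ t) : Commute (T s) (T t) := by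
  rw [commute_iff_eq, ← hT.add s t hs ht, ← hT.add t s ht hs, add_comm]

/-- Differentiate `T (s + u) = T s * T u` in `u` at `u = t`. -/
theorem mul_negDeriv {s t : ℝ} (hs : 0 ≤ s) (ht : 0 < t) :
    T s * negDeriv T t = negDeriv T (s + t) := by
  have h1 : HasDerivAt (fun u => T (s + u)) (-negDeriv T (s + t)) t :=
    (hT.hasDerivAt (by positivity : 0 < s + t)).comp_const_add s t
  have h2 : HasDerivAt (fun u => T s * T u) (T s * -negDeriv T t) t :=
    (hT.hasDerivAt ht).const_mul (T s)
  have h3 : (fun u => T (s + u)) =ᶠ[𝓝 t] fun u => T s * T u := by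
    filter_upwards [lt_mem_nhds ht] with u hu using hT.add s u hs hu.le
  have h4 := h1.unique (h2.congr_of_eventuallyEq h3)
  rw [mul_neg, neg_inj] at h4
  exact h4.symm

theorem commute_negDeriv {B : H →L[ℂ] H} {t : ℝ} (ht : 0 < t)
    (hB : ∀ s : ℝ, 0 < s → Commute B (T s)) : Commute B (negDeriv T t) := by
  have h1 : HasDerivAt (fun u => B * T u) (B * -negDeriv T t) t :=
    (hT.hasDerivAt ht).const_mul B
  have h2 : HasDerivAt (fun u => T u * B) (-negDeriv T t * B) t :=
    (hT.hasDerivAt ht).mul_const B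
  have h3 : (fun u => B * T u) =ᶠ[𝓝 t] fun u => T u * B := by
    filter_upwards [lt_mem_nhds ht] with u hu using hB u hu
  have h4 := h1.unique (h2.congr_of_eventuallyEq h3)
  rw [mul_neg, neg_mul, neg_inj] at h4
  exact h4

/-- Near `t` the derivative is `T (u - t / 2)` times a fixed operator, so it inherits the continuity
of `T`. -/
theorem continuousOn_negDeriv : ContinuousOn (negDeriv T) (Ioi 0) := by
  intro t ht
  have ht : 0 < t := ht
  have h : negDeriv T =ᶠ[𝓝 t] fun u => T (u - t / 2) * negDeriv T (t / 2) := by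
    filter_upwards [lt_mem_nhds (half_lt_self ht)] with u hu
    rw [hT.mul_negDeriv (by linarith) (by linarith), sub_add_cancel]
  refine (ContinuousAt.congr ?_ h.symm).continuousWithinAt
  have h1 : ContinuousAt T (t - t / 2) := (hT.diff _ (by linarith)).continuousAt
  have h2 : ContinuousAt (fun u : ℝ => u - t / 2) t := by fun_prop
  exact (ContinuousAt.comp (f := fun u : ℝ => u - t / 2) (g := T) h1 h2).mul continuousAt_const

theorem contDiffOn : ContDiffOn ℝ 1 T (Ioi 0) := by
  rw [show (1 : WithTop ℕ∞) = 0 + 1 by simp, contDiffOn_succ_iff_deriv_of_isOpen isOpen_Ioi]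
  refine ⟨fun t ht => (hT.diff t ht).differentiableWithinAt, by simp, contDiffOn_zero.2 ?_⟩
  have h : deriv T = fun t => -negDeriv T t := by ext1 t; rw [negDeriv, neg_neg]
  rw [h]
  exact hT.continuousOn_negDeriv.neg

theorem exists_norm_le : ∃ M : ℝ, 0 < M ∧ ∀ t, 0 ≤ t → ‖T t‖ ≤ M := by
  obtain ⟨M, ε, hε, h⟩ := hT.decay
  refine ⟨max M 1, by positivity, fun t ht => (h t ht).trans ?_⟩
  have hM : 0 ≤ M := by
    have := (norm_nonneg _).trans (h 0 le_rfl)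
    simpa using this
  calc M * Real.exp (-(ε * t)) ≤ M * 1 := by
        gcongr
        exact Real.exp_le_one_iff.2 (by nlinarith)
    _ ≤ max M 1 := by rw [mul_one]; exact le_max_left _ _

theorem exists_norm_negDeriv_le : ∃ C : ℝ, 0 < C ∧ ∀ t, 0 < t → ‖negDeriv T t‖ ≤ C / t := by
  obtain ⟨C, h⟩ := hT.deriv_le
  refine ⟨max C 1, by positivity, fun t ht => ?_⟩
  rw [negDeriv, norm_neg]
  refine (h t ht).trans ?_
  gcongr
  exact le_max_left _ _

theorem tendsto_zero : Tendsto T atTop (𝓝 0) := by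
  obtain ⟨M, ε, hε, h⟩ := hT.decay
  refine squeeze_zero_norm' (a := fun t => M * Real.exp (-(ε * t))) ?_ ?_
  · filter_upwards [eventually_ge_atTop 0] with t ht using h t ht
  · rw [← mul_zero M]
    refine Tendsto.const_mul M ?_
    exact Real.tendsto_exp_neg_atTop_nhds_zero.comp (tendsto_id.const_mul_atTop hε)

theorem integrableOn {a : ℝ} (ha : 0 < a) :
    IntegrableOn (fun t => t ^ (a - 1) • T t) (Ioi 0) := by
  obtain ⟨M, ε, hε, h⟩ := hT.decay
  have hi : IntegrableOn (fun t : ℝ => M * (t ^ (a - 1) * Real.exp (-ε * t ^ (1 : ℝ)))) (Ioi 0) :=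
    (integrableOn_rpow_mul_exp_neg_mul_rpow (by linarith) zero_lt_one hε).const_mul M
  refine Integrable.mono' hi ?_ ?_
  · refine ContinuousOn.aestronglyMeasurable ?_ measurableSet_Ioi
    have hc : ContinuousOn (fun t : ℝ => t ^ (a - 1)) (Ioi 0) := fun t ht =>
      (Real.continuousAt_rpow_const _ _ (Or.inl (ne_of_gt ht))).continuousWithinAt
    exact hc.smul hT.continuousOn
  · refine (ae_restrict_iff' measurableSet_Ioi).2 (Eventually.of_forall fun t ht => ?_)
    have ht : 0 < t := ht
    rw [norm_smul, Real.norm_of_nonneg (by positivity), Real.rpow_one]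
    calc t ^ (a - 1) * ‖T t‖ ≤ t ^ (a - 1) * (M * Real.exp (-(ε * t))) := by
          gcongr; exact h t ht.le
      _ = _ := by rw [neg_mul]; ring

theorem commute_frac [CompleteSpace H] {B : H →L[ℂ] H} {a : ℝ} (ha : 0 ≤ a)
    (hB : ∀ s : ℝ, 0 < s → Commute B (T s)) : Commute B (frac T a) := by
  rcases ha.eq_or_lt with rfl | ha
  · rw [frac_zero]; exact Commute.one_right B
  rw [frac, if_neg ha.ne']
  refine Commute.smul_right ?_ _
  rw [commute_iff_eq, ← integral_const_mul_of_integrable (hT.integrableOn ha),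
    ← integral_mul_const_of_integrable (hT.integrableOn ha)]
  refine setIntegral_congr_fun measurableSet_Ioi fun t ht => ?_
  exact ((hB t ht).smul_right _).eq

theorem commute_frac_apply [CompleteSpace H] {a t : ℝ} (ha : 0 ≤ a) (ht : 0 ≤ t) :
    Commute (frac T a) (T t) :=
  (hT.commute_frac ha fun _ hs => hT.commute ht hs.le).symm

theorem commute_frac_negDeriv [CompleteSpace H] {a t : ℝ} (ha : 0 ≤ a) (ht : 0 < t) :
    Commute (frac T a) (negDeriv T t) :=
  hT.commute_negDeriv ht fun _ hs => hT.commute_frac_apply ha hs.le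

/-- The product of the two integrals is the integral of a convolution. By the semigroup law the
inner integral is a Beta integral times `T x`, and `B(a, b) = Γ(a) Γ(b) / Γ(a + b)`. -/
theorem frac_mul_frac [CompleteSpace H] {a b : ℝ} (ha : 0 ≤ a) (hb : 0 ≤ b) :
    frac T a * frac T b = frac T (a + b) := by
  rcases ha.eq_or_lt with rfl | ha
  · rw [frac_zero, one_mul, zero_add]
  rcases hb.eq_or_lt with rfl | hb
  · rw [frac_zero, mul_one, add_zero]
  have h : ∫ x in Ioi (0 : ℝ), ∫ t in (0 : ℝ)..x,
        (t ^ (a - 1) • T t) * ((x - t) ^ (b - 1) • T (x - t))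
      = (∫ t in Ioi (0 : ℝ), t ^ (a - 1) • T t) * ∫ t in Ioi (0 : ℝ), t ^ (b - 1) • T t :=
    integral_posConvolution (hT.integrableOn ha) (hT.integrableOn hb)
      (ContinuousLinearMap.mul ℝ (H →L[ℂ] H))
  have h2 : ∫ x in Ioi (0 : ℝ), ∫ t in (0 : ℝ)..x,
        (t ^ (a - 1) • T t) * ((x - t) ^ (b - 1) • T (x - t))
      = ProbabilityTheory.beta a b • ∫ x in Ioi (0 : ℝ), x ^ (a + b - 1) • T x := by
    rw [← integral_smul]
    refine setIntegral_congr_fun measurableSet_Ioi fun x hx => ?_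
    have hx : 0 < x := hx
    have : ∫ t in (0 : ℝ)..x, (t ^ (a - 1) • T t) * ((x - t) ^ (b - 1) • T (x - t))
        = ∫ t in (0 : ℝ)..x, (t ^ (a - 1) * (x - t) ^ (b - 1)) • T x := by
      refine intervalIntegral.integral_congr fun t ht => ?_
      rw [uIcc_of_le hx.le] at ht
      simp only [smul_mul_smul_comm]
      rw [← hT.add t (x - t) ht.1 (sub_nonneg.2 ht.2), add_sub_cancel]
    simp only [this]
    rw [intervalIntegral.integral_smul_const, integral_rpow_mul_sub_rpow ha hb hx, smul_smul,
      mul_comm]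
  have hab : a + b ≠ 0 := by positivity
  rw [frac, frac, frac, if_neg ha.ne', if_neg hb.ne', if_neg hab, smul_mul_smul_comm, ← h, h2,
    smul_smul]
  congr 1
  have h3 := (Real.Gamma_pos_of_pos ha).ne'
  have h4 := (Real.Gamma_pos_of_pos hb).ne'
  have h5 := (Real.Gamma_pos_of_pos (add_pos ha hb)).ne'
  rw [ProbabilityTheory.beta]
  field_simp

/-- Since `T` tends to `0` at infinity, `∫₀^∞ -T'(s + t) ds = T t`. This identity, `A⁻¹ (A T(t)) =
T(t)`, links the fractional powers to the derivative of the semigroup. -/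
theorem frac_one_mul_negDeriv [CompleteSpace H] {t : ℝ} (ht : 0 < t) :
    frac T 1 * negDeriv T t = T t := by
  have hi := hT.integrableOn one_pos
  have h0 : ∀ s ∈ Ioi (0 : ℝ), s ^ ((1 : ℝ) - 1) • T s = T s := fun s _ => by simp
  rw [frac, if_neg one_ne_zero, Real.Gamma_one, inv_one, one_smul,
    ← integral_mul_const_of_integrable hi]
  have hmul : ∀ s ∈ Ioi (0 : ℝ), s ^ ((1 : ℝ) - 1) • T s * negDeriv T t = negDeriv T (s + t) :=
    fun s hs => by rw [h0 s hs, hT.mul_negDeriv (le_of_lt hs) ht]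
  have hint : IntegrableOn (fun s => negDeriv T (s + t)) (Ioi 0) :=
    IntegrableOn.congr_fun (hi.mul_const (negDeriv T t)) hmul measurableSet_Ioi
  rw [setIntegral_congr_fun measurableSet_Ioi hmul]
  rw [integral_Ioi_of_hasDerivAt_of_tendsto' (f := fun s => -T (s + t)) (m := 0) ?_ hint ?_]
  · simp
  · intro s hs
    have hs : 0 ≤ s := hs
    have := ((hT.hasDerivAt (by positivity : 0 < s + t)).comp_add_const s t).neg
    rwa [neg_neg] at this
  · rw [← neg_zero]
    exact (hT.tendsto_zero.comp (tendsto_atTop_add_const_right _ t tendsto_id)).neg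

theorem frac_mul_smoothing [CompleteSpace H] {a r t : ℝ} (ha : 0 ≤ a) (hr : r ≤ 1) :
    frac T a * smoothing T r t = smoothing T (r - a) t := by
  rw [smoothing, smoothing, ← mul_assoc, hT.frac_mul_frac ha (by linarith)]
  congr 2; ring

/-- For nonpositive exponents the notation `A^r T(t)` agrees with the product of a negative power
and the semigroup. -/
theorem smoothing_of_nonpos [CompleteSpace H] {r t : ℝ} (hr : r ≤ 0) (ht : 0 < t) :
    smoothing T r t = frac T (-r) * T t := by
  rw [smoothing, show (1 : ℝ) - r = -r + 1 by ring,
    ← hT.frac_mul_frac (by linarith) zero_le_one, mul_assoc, hT.frac_one_mul_negDeriv ht]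

theorem commute_frac_smoothing [CompleteSpace H] {a r t : ℝ} (ha : 0 ≤ a) (hr : r ≤ 1)
    (ht : 0 < t) : Commute (frac T a) (smoothing T r t) := by
  refine Commute.mul_right ?_ (hT.commute_frac_negDeriv ha ht)
  rw [commute_iff_eq, hT.frac_mul_frac ha (by linarith), hT.frac_mul_frac (by linarith) ha,
    add_comm]

theorem mul_smoothing [CompleteSpace H] {r s t : ℝ} (hr : r ≤ 1) (hs : 0 ≤ s) (ht : 0 < t) :
    T s * smoothing T r t = smoothing T r (s + t) := by
  rw [smoothing, smoothing, ← hT.mul_negDeriv hs ht, ← mul_assoc, ← mul_assoc,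
    (hT.commute_frac_apply (by linarith) hs).eq]

/-- Here `A^r T(t)` equals `Γ(1 - r)⁻¹ ∫ s^{-r} A T(s + t) ds`, with integrand of norm at most `C
s^{-r} / (s + t)`. Splitting at `s = t` and bounding `s + t` below by `t`, respectively `s`, gives
`1 / (1 - r)` and `1 / r`; this is where both `r < 1` and `0 < r` are needed. -/
theorem exists_norm_smoothing_le [CompleteSpace H] {r : ℝ} (hr0 : 0 < r) (hr1 : r < 1) :
    ∃ C : ℝ, 0 < C ∧ ∀ t, 0 < t → ‖smoothing T r t‖ ≤ C * t ^ (-r) := by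
  obtain ⟨C, hC, h⟩ := hT.exists_norm_negDeriv_le
  have h1r : 0 < 1 - r := by linarith
  have hG := Real.Gamma_pos_of_pos h1r
  refine ⟨(Real.Gamma (1 - r))⁻¹ * (C * (1 / (1 - r) + 1 / r)), by positivity, fun t ht => ?_⟩
  have hi : IntegrableOn (fun s => s ^ (1 - r - 1) • T s * negDeriv T t) (Ioi 0) :=
    (hT.integrableOn h1r).mul_const (negDeriv T t)
  have hb : ∀ s, 0 < s → ‖s ^ (1 - r - 1) • T s * negDeriv T t‖ ≤ C * (s ^ (-r) * (s + t)⁻¹) := by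
    intro s hs
    rw [smul_mul_assoc, hT.mul_negDeriv hs.le ht, norm_smul, Real.norm_of_nonneg (by positivity)]
    have := h (s + t) (by positivity)
    calc s ^ (1 - r - 1) * ‖negDeriv T (s + t)‖ ≤ s ^ (1 - r - 1) * (C / (s + t)) := by gcongr
      _ = _ := by rw [show 1 - r - 1 = -r by ring]; ring
  rw [smoothing, frac, if_neg h1r.ne', smul_mul_assoc,
    ← integral_mul_const_of_integrable (hT.integrableOn h1r), norm_smul,
    Real.norm_of_nonneg (by positivity), mul_assoc]
  gcongr
  rw [← Ioc_union_Ioi_eq_Ioi ht.le, setIntegral_union Ioc_disjoint_Ioi_same measurableSet_Ioi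
    (hi.mono_set Ioc_subset_Ioi_self) (hi.mono_set (Ioi_subset_Ioi ht.le))]
  have e1 : ∫ s in Ioc 0 t, C * (s ^ (-r) * t⁻¹) = C * (1 / (1 - r)) * t ^ (-r) := by
    rw [← intervalIntegral.integral_of_le ht.le, intervalIntegral.integral_const_mul,
      intervalIntegral.integral_mul_const, integral_rpow (Or.inl (by linarith)),
      Real.zero_rpow (by linarith), Real.rpow_add ht, Real.rpow_one]
    have : 1 - r ≠ 0 := h1r.ne'
    rw [show -r + 1 = 1 - r by ring]
    field_simp
    ring
  have e2 : ∫ s in Ioi t, C * s ^ (-r - 1) = C * (1 / r) * t ^ (-r) := by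
    rw [integral_const_mul, integral_Ioi_rpow_of_lt (by linarith) ht]
    rw [show -r - 1 + 1 = -r by ring]
    field_simp
  have i1 : IntegrableOn (fun s => C * (s ^ (-r) * t⁻¹)) (Ioc 0 t) := by
    have := (intervalIntegral.intervalIntegrable_rpow' (a := 0) (b := t) (r := -r)
      (by linarith)).1
    exact (this.mul_const _).const_mul _
  have i2 : IntegrableOn (fun s => C * s ^ (-r - 1)) (Ioi t) :=
    (integrableOn_Ioi_rpow_of_lt (by linarith) ht).const_mul C
  refine (norm_add_le _ _).trans ?_
  rw [mul_add, add_mul, ← e1, ← e2]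
  refine add_le_add (norm_integral_le_of_norm_le i1 ?_) (norm_integral_le_of_norm_le i2 ?_)
  · refine (ae_restrict_iff' measurableSet_Ioc).2 (Eventually.of_forall fun s hs => ?_)
    have hs0 : 0 < s := hs.1
    refine (hb s hs0).trans ?_
    gcongr
    linarith
  · refine (ae_restrict_iff' measurableSet_Ioi).2 (Eventually.of_forall fun s hs => ?_)
    have hs0 : 0 < s := ht.trans hs
    refine (hb s hs0).trans ?_
    rw [Real.rpow_sub_one hs0.ne', div_eq_mul_inv]
    gcongr
    linarith

theorem norm_sub_le {C : ℝ} (hC : ∀ t, 0 < t → ‖negDeriv T t‖ ≤ C / t) (hC0 : 0 ≤ C) {t h : ℝ}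
    (ht : 0 < t) (hh : 0 ≤ h) : ‖T (h + t) - T t‖ ≤ C / t * h := by
  have := Convex.norm_image_sub_le_of_norm_hasDerivWithin_le (f := T) (s := Ici t)
    (f' := fun u => -negDeriv T u) (C := C / t) (x := t) (y := h + t)
    (fun u hu => (hT.hasDerivAt (ht.trans_le hu)).hasDerivWithinAt)
    (fun u hu => by
      rw [norm_neg]
      exact (hC u (ht.trans_le hu)).trans (div_le_div_of_nonneg_left hC0 ht hu))
    (convex_Ici t) self_mem_Ici (by simpa using hh)
  simpa [abs_of_nonneg hh] using this

/-- Half of the time `t` is spent on the singular factor: the difference is `(T (h + t / 2) - T (t /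
2)) * A^r T(t / 2)`. The first factor is bounded by a constant and also by a multiple of `h / t`,
hence by a multiple of `(h / t) ^ θ`. -/
theorem exists_norm_smoothing_sub_le [CompleteSpace H] {r θ : ℝ} (hr0 : 0 < r) (hr1 : r < 1)
    (hθ0 : 0 ≤ θ) (hθ1 : θ ≤ 1) :
    ∃ C : ℝ, 0 < C ∧ ∀ t h, 0 < t → 0 ≤ h →
      ‖smoothing T r (h + t) - smoothing T r t‖ ≤ C * (h ^ θ * t ^ (-r - θ)) := by
  obtain ⟨C, hC, hD⟩ := hT.exists_norm_negDeriv_le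
  obtain ⟨M, hM, hTM⟩ := hT.exists_norm_le
  obtain ⟨C', hC', hS⟩ := hT.exists_norm_smoothing_le hr0 hr1
  refine ⟨max (2 * M) (2 * C) * (C' * (2⁻¹ : ℝ) ^ (-r)), by positivity, fun t h ht hh => ?_⟩
  have ht2 : 0 < t / 2 := by positivity
  have e : smoothing T r (h + t) - smoothing T r t
      = (T (h + t / 2) - T (t / 2)) * smoothing T r (t / 2) := by
    rw [sub_mul, hT.mul_smoothing hr1.le (by positivity) ht2,
      hT.mul_smoothing hr1.le ht2.le ht2]
    congr 2 <;> ring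
  have h1 : ‖T (h + t / 2) - T (t / 2)‖ ≤ max (2 * M) (2 * C) * (h / t) ^ θ := by
    rcases le_total t h with hth | hth
    · have : 1 ≤ (h / t) ^ θ := Real.one_le_rpow ((one_le_div ht).2 hth) hθ0
      calc _ ≤ ‖T (h + t / 2)‖ + ‖T (t / 2)‖ := _root_.norm_sub_le _ _
        _ ≤ M + M := add_le_add (hTM _ (by positivity)) (hTM _ ht2.le)
        _ = 2 * M * 1 := by ring
        _ ≤ _ := by gcongr; exact le_max_left _ _
    · have : h / t ≤ (h / t) ^ θ := by
        rcases hh.eq_or_lt with rfl | hh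
        · rw [zero_div]; exact Real.rpow_nonneg le_rfl _
        conv_lhs => rw [← Real.rpow_one (h / t)]
        exact Real.rpow_le_rpow_of_exponent_ge (by positivity) ((div_le_one ht).2 hth) hθ1
      calc _ ≤ C / (t / 2) * h := hT.norm_sub_le hD hC.le ht2 hh
        _ = 2 * C * (h / t) := by field_simp
        _ ≤ _ := by gcongr; exact le_max_right _ _
  calc _ ≤ ‖T (h + t / 2) - T (t / 2)‖ * ‖smoothing T r (t / 2)‖ := by
        rw [e]; exact norm_mul_le _ _
    _ ≤ (max (2 * M) (2 * C) * (h / t) ^ θ) * (C' * (t / 2) ^ (-r)) := by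
        gcongr; exact hS _ ht2
    _ = _ := by
        rw [Real.div_rpow hh ht.le, div_eq_mul_inv t 2, Real.mul_rpow ht.le (by norm_num),
          Real.rpow_sub ht]
        field_simp

theorem frac_natCast [CompleteSpace H] (n : ℕ) : frac T n = frac T 1 ^ n := by
  induction n with
  | zero => simp [frac_zero]
  | succ n ih =>
    rw [Nat.cast_succ, ← hT.frac_mul_frac n.cast_nonneg zero_le_one, ih, pow_succ]

/-- If `A⁻¹ x = 0` then `T(t) x = A T(t) A⁻¹ x = 0` for all `t > 0`, and `t ↓ 0` gives `x = 0`.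
Integer powers follow by iteration, and `A^{-a}` is a right factor of an integer power. -/
theorem frac_injective [CompleteSpace H] {a : ℝ} (ha : 0 ≤ a) :
    Function.Injective (frac T a) := by
  have h1 : Function.Injective (frac T 1) := by
    refine (injective_iff_map_eq_zero _).2 fun x hx => ?_
    refine tendsto_nhds_unique (hT.tendsto x) (tendsto_const_nhds.congr' ?_)
    filter_upwards [self_mem_nhdsWithin] with t ht
    have ht : 0 < t := ht
    rw [← hT.frac_one_mul_negDeriv ht, (hT.commute_frac_negDeriv zero_le_one ht).eq,
      mul_apply_eq_comp, hx, map_zero]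
  have hn (n : ℕ) : Function.Injective (frac T n) := by
    rw [hT.frac_natCast, FunLike.coe_pow_eq_iterate]
    exact h1.iterate n
  refine Function.Injective.of_comp (f := frac T (⌈a⌉₊ - a)) ?_
  have := hT.frac_mul_frac (a := ⌈a⌉₊ - a) (sub_nonneg.2 (Nat.le_ceil a)) ha
  rw [sub_add_cancel] at this
  have h2 := hn ⌈a⌉₊
  rw [← this] at h2
  exact h2

theorem pow_succ_eq (m : ℕ) {u : ℝ} (hu : 0 ≤ u) : T u ^ (m + 1) = T (u * (m + 1 : ℕ)) := by
  induction m with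
  | zero => simp
  | succ m ih =>
    rw [pow_succ, ih, ← hT.add _ _ (by positivity) hu]
    congr 1; push_cast; ring

/-- The function `v` is `A^a T(t) x`, realised as `A^{-(n+1-a)} (A T(t / (n+1)))^{n+1} x`. Locally
`v` is a fixed bounded linear map applied to a translate of `T`, so it is as smooth as `T`. -/
theorem exists_frac_eq [CompleteSpace H] {a : ℝ} (ha : 0 ≤ a) (x : H) :
    ∃ v : ℝ → H, (∀ t, 0 < t → frac T a (v t) = T t x) ∧ ContDiffOn ℝ 1 v (Ioi 0) := by
  -- The extra `1` keeps the exponent positive even when `a = 0`, so that `t` can be divided by it.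
  obtain ⟨n, hn⟩ : ∃ n : ℕ, a ≤ (n + 1 : ℕ) :=
    ⟨⌈a⌉₊, (Nat.le_ceil a).trans (by push_cast; linarith)⟩
  have hn0 : (0 : ℝ) < (n + 1 : ℕ) := by positivity
  let p : ℝ → H →L[ℂ] H := fun t => negDeriv T (t / (n + 1 : ℕ)) ^ (n + 1)
  have hadd {s t : ℝ} (hs : 0 ≤ s) (ht : 0 < t) : T s * p t = p (s + t) := by
    have h1 : T s = T (s / (n + 1 : ℕ)) ^ (n + 1) := by
      rw [hT.pow_succ_eq _ (by positivity), div_mul_cancel₀ _ hn0.ne']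
    have h2 : Commute (T (s / (n + 1 : ℕ))) (negDeriv T (t / (n + 1 : ℕ))) :=
      hT.commute_negDeriv (by positivity) fun u hu => hT.commute (by positivity) hu.le
    simp only [p]
    rw [h1, ← h2.mul_pow, hT.mul_negDeriv (by positivity) (by positivity), add_div]
  have hp {t : ℝ} (ht : 0 < t) : frac T (n + 1 : ℕ) * p t = T t := by
    have h2 : Commute (frac T 1) (negDeriv T (t / (n + 1 : ℕ))) :=
      hT.commute_frac_negDeriv zero_le_one (by positivity)
    simp only [p]
    rw [hT.frac_natCast, ← h2.mul_pow, hT.frac_one_mul_negDeriv (by positivity)]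
    rw [hT.pow_succ_eq _ (by positivity), div_mul_cancel₀ _ hn0.ne']
  refine ⟨fun t => frac T ((n + 1 : ℕ) - a) (p t x), fun t ht => ?_, fun t ht => ?_⟩
  · rw [← mul_apply_eq_comp, hT.frac_mul_frac ha (sub_nonneg.2 hn), add_sub_cancel,
      ← hp ht, mul_apply_eq_comp]
  · have ht : 0 < t := ht
    have h : (fun u => frac T ((n + 1 : ℕ) - a) (p u x)) =ᶠ[𝓝 t]
        fun u => frac T ((n + 1 : ℕ) - a) (T (u - t / 2) (p (t / 2) x)) := by
      filter_upwards [lt_mem_nhds (half_lt_self ht)] with u hu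
      rw [← mul_apply_eq_comp (T (u - t / 2)), hadd (by linarith) (by linarith),
        sub_add_cancel]
    refine (ContDiffAt.congr_of_eventuallyEq ?_ h).contDiffWithinAt
    have h1 : ContDiffAt ℝ 1 T (t - t / 2) :=
      hT.contDiffOn.contDiffAt (Ioi_mem_nhds (by linarith))
    have h2 : ContDiffAt ℝ 1 (fun u : ℝ => T (u - t / 2)) t :=
      ContDiffAt.comp (g := T) (f := fun u : ℝ => u - t / 2) t h1 (by fun_prop)
    have h3 : ContDiff ℝ 1 fun B : H →L[ℂ] H =>
        frac T ((n + 1 : ℕ) - a) (B (p (t / 2) x)) :=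
      (((frac T ((n + 1 : ℕ) - a)).comp
        (ContinuousLinearMap.apply ℂ H (p (t / 2) x))).restrictScalars ℝ).contDiff
    exact h3.contDiffAt.comp t h2

end IsStableAnalytic

end Stable

/-! ### The derivative bound for analytic semigroups, and passage to the shifted semigroup. -/

section Analytic

variable {H : Type*} [NormedAddCommGroup H] [NormedSpace ℂ H]

/-- The rescaled semigroup `e^{-lam t} S t`. -/
def shifted (S : ℝ → H →L[ℂ] H) (lam t : ℝ) : H →L[ℂ] H := Real.exp (-(lam * t)) • S t

theorem negPow_eq_frac (S : ℝ → H →L[ℂ] H) (lam a : ℝ) :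
    negPow S lam a = frac (shifted S lam) a := by
  unfold negPow frac shifted
  split_ifs with h
  · rfl
  · rw [Complex.coe_smul]
    congr 1
    refine integral_congr_ae (Eventually.of_forall fun t => ?_)
    simp only [Complex.coe_smul, smul_smul]

/-- Orbits are bounded on compact time intervals, so the uniform boundedness principle applies. -/
theorem IsC0Semigroup.exists_norm_le [CompleteSpace H] {S : ℝ → H →L[ℂ] H} (hS : IsC0Semigroup S)
    (R : ℝ) : ∃ M : ℝ, 0 < M ∧ ∀ t ∈ Icc 0 R, ‖S t‖ ≤ M := by
  obtain ⟨M, hM⟩ := banach_steinhaus (g := fun t : Icc (0 : ℝ) R => S t) fun x => by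
    have hc : ContinuousOn (fun t : ℝ => S t x) (Icc 0 R) := by
      refine hS.cont.comp (f := fun t : ℝ => (x, t)) (by fun_prop) fun t ht => ?_
      exact ⟨mem_univ _, ht.1⟩
    obtain ⟨C, hC⟩ := isCompact_Icc.exists_bound_of_continuousOn hc
    exact ⟨C, fun t => hC t t.2⟩
  exact ⟨max M 1, by positivity, fun t ht => (hM ⟨t, ht⟩).trans (le_max_left _ _)⟩

theorem mem_sector_of_abs_im_lt {θ : ℝ} (hθ0 : 0 < θ) (hθ : θ < Real.pi / 2) {z : ℂ}
    (hre : 0 < z.re) (him : |z.im| < z.re * Real.tan θ) : z ∈ sector θ := by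
  have hz : z ≠ 0 := fun h => by simp [h] at hre
  refine ⟨hz, ?_⟩
  have h1 : |z.arg| < Real.pi / 2 := Complex.abs_arg_lt_pi_div_two_iff.2 (Or.inl hre)
  have h2 := abs_lt.1 h1
  have h3 : z.im = z.re * Real.tan z.arg := by
    rw [Complex.tan_arg]; field_simp
  have h4 := abs_lt.1 him
  refine abs_lt.2 ⟨?_, ?_⟩
  · by_contra! h
    have : Real.tan z.arg ≤ Real.tan (-θ) :=
      Real.strictMonoOn_tan.monotoneOn ⟨h2.1, h2.2⟩ ⟨by linarith, by linarith⟩ h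
    rw [Real.tan_neg] at this
    nlinarith [h4.1]
  · by_contra! h
    have : Real.tan θ ≤ Real.tan z.arg :=
      Real.strictMonoOn_tan.monotoneOn ⟨by linarith, by linarith⟩ ⟨h2.1, h2.2⟩ h
    nlinarith [h4.2]

/-- The definition of an analytic semigroup gives bounds only along rays. Writing `z` as a sum of
points on the rays at angles `±φ` makes the operator at `z` a product of two operators bounded on
those rays. The radius `sin φ / 4 * t` ensures `|Im z| / sin φ ≤ t / 4`, below `Re z / cos φ ≥ 3 t /
4`, so both coefficients are positive. -/
theorem exists_sector_decomposition {φ : ℝ} (h0 : 0 < φ) (h1 : φ ≤ Real.pi / 4) {t : ℝ}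
    (ht : 0 < t) {z : ℂ} (hz : ‖z - t‖ ≤ Real.sin φ / 4 * t) :
    ∃ s₁ ∈ Ioc 0 (4 * t), ∃ s₂ ∈ Ioc 0 (4 * t),
      z = s₁ * Complex.exp (φ * Complex.I) + s₂ * Complex.exp ((-φ : ℝ) * Complex.I) := by
  have hs0 : 0 < Real.sin φ := Real.sin_pos_of_pos_of_lt_pi h0 (by linarith [Real.pi_pos])
  have hs1 : Real.sin φ ≤ 1 := Real.sin_le_one φ
  have hc : 1 / 2 ≤ Real.cos φ := by
    rw [← Real.cos_pi_div_three]
    exact Real.cos_le_cos_of_nonneg_of_le_pi h0.le (by linarith [Real.pi_pos])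
      (by linarith [Real.pi_pos])
  have hc1 : Real.cos φ ≤ 1 := Real.cos_le_one φ
  have hc0 : 0 < Real.cos φ := by linarith
  have hre : |z.re - t| ≤ Real.sin φ / 4 * t := by
    have := (Complex.abs_re_le_norm (z - t)).trans hz
    simpa using this
  have him : |z.im| ≤ Real.sin φ / 4 * t := by
    have := (Complex.abs_im_le_norm (z - t)).trans hz
    simpa using this
  have hre' := abs_le.1 hre
  have hst : Real.sin φ / 4 * t ≤ t / 4 := by nlinarith
  have hx0 : 3 / 4 * t ≤ z.re := by linarith [hre'.1]
  have hx1 : z.re ≤ 5 / 4 * t := by linarith [hre'.2]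
  have hy : |z.im / Real.sin φ| ≤ t / 4 := by
    rw [abs_div, abs_of_pos hs0, div_le_iff₀ hs0]
    linarith
  have hy' := abs_le.1 hy
  have hX0 : 3 / 4 * t ≤ z.re / Real.cos φ := by
    rw [le_div_iff₀ hc0]; nlinarith
  have hX1 : z.re / Real.cos φ ≤ 5 / 2 * t := by
    rw [div_le_iff₀ hc0]; nlinarith
  refine ⟨(z.re / Real.cos φ + z.im / Real.sin φ) / 2, ⟨by linarith, by linarith⟩,
    (z.re / Real.cos φ - z.im / Real.sin φ) / 2, ⟨by linarith, by linarith⟩, ?_⟩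
  rw [Complex.exp_mul_I, Complex.exp_mul_I, ← Complex.ofReal_cos, ← Complex.ofReal_sin,
    ← Complex.ofReal_cos, ← Complex.ofReal_sin, Real.cos_neg, Real.sin_neg]
  generalize Real.cos φ = c at *
  generalize Real.sin φ = s at *
  apply Complex.ext
  · simp
    field_simp
    ring
  · simp
    field_simp
    ring

/-- Cauchy's estimate on the disc of radius `sin φ / 4 * t` around `t`, on whose boundary the
extension is bounded by the product of two ray bounds. -/
theorem IsAnalyticSemigroup.exists_norm_deriv_le [CompleteSpace H] {S : ℝ → H →L[ℂ] H}
    (hS : IsAnalyticSemigroup S) :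
    (∀ t : ℝ, 0 < t → DifferentiableAt ℝ S t) ∧
      ∃ C : ℝ, 0 ≤ C ∧ ∀ t : ℝ, 0 < t → t ≤ 1 → ‖deriv S t‖ ≤ C / t := by
  obtain ⟨θ, hθ0, hθ1, T, hTS, han, hmul, hray⟩ := hS.exists_extension
  -- Halving puts the rays at angles `±φ` strictly inside the sector and gives `φ ≤ π / 4`.
  set φ := θ / 2 with hφ
  have hφ0 : 0 < φ := by positivity
  have hφ1 : φ ≤ Real.pi / 4 := by linarith
  have hs0 : 0 < Real.sin φ := Real.sin_pos_of_pos_of_lt_pi hφ0 (by linarith [Real.pi_pos])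
  have hsec {s ψ : ℝ} (hs : 0 < s) (hψ : |ψ| = φ) :
      (s : ℂ) * Complex.exp ((ψ : ℂ) * Complex.I) ∈ sector θ := by
    have hψ' := abs_le.1 hψ.le
    refine ⟨mul_ne_zero (by exact_mod_cast hs.ne') (Complex.exp_ne_zero _), ?_⟩
    rw [Complex.exp_mul_I, Complex.arg_mul_cos_add_sin_mul_I hs
      ⟨by linarith [Real.pi_pos], by linarith [Real.pi_pos]⟩, hψ]
    linarith
  have hball {t : ℝ} (ht : 0 < t) {z : ℂ} (hz : ‖z - t‖ ≤ Real.sin φ / 4 * t) :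
      z ∈ sector θ := by
    have hst : Real.sin φ / 4 * t ≤ t / 4 := by nlinarith [Real.sin_le_one φ]
    have h1 := (Complex.abs_re_le_norm (z - t)).trans hz
    have h2 := (Complex.abs_im_le_norm (z - t)).trans hz
    simp only [Complex.sub_re, Complex.sub_im, Complex.ofReal_re, Complex.ofReal_im,
      sub_zero] at h1 h2
    have hx := (abs_le.1 h1).1
    have hx0 : 3 / 4 * t ≤ z.re := by linarith
    have hc0 : 0 < Real.cos φ := Real.cos_pos_of_mem_Ioo
      ⟨by linarith [Real.pi_pos], by linarith [Real.pi_pos]⟩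
    have htan : Real.sin φ ≤ Real.tan φ := by
      rw [Real.tan_eq_sin_div_cos, le_div_iff₀ hc0]
      nlinarith [Real.cos_le_one φ]
    have hmem := mem_sector_of_abs_im_lt hφ0 (by linarith [Real.pi_pos]) (z := z) (by linarith)
      (by nlinarith)
    exact ⟨hmem.1, hmem.2.trans (by linarith)⟩
  have hself {t : ℝ} (ht : 0 < t) : (t : ℂ) ∈ sector θ :=
    hball ht (by rw [sub_self, norm_zero]; positivity)
  have hderiv {t : ℝ} (ht : 0 < t) : HasDerivAt S (deriv T (t : ℂ)) t := by
    have h1 : HasDerivAt T (deriv T (t : ℂ)) (t : ℂ) :=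
      (han _ (hself ht)).differentiableAt.hasDerivAt
    have h2 : HasDerivAt (fun u : ℝ => T (u : ℂ)) (deriv T (t : ℂ)) t := by
      have := HasDerivAt.scomp (h := fun u : ℝ => (u : ℂ)) t h1 Complex.ofRealCLM.hasDerivAt
      rw [show Complex.ofRealCLM 1 = 1 by simp, one_smul] at this
      exact this
    refine h2.congr_of_eventuallyEq ?_
    filter_upwards [lt_mem_nhds ht] with u hu using (hTS u hu.le).symm
  refine ⟨fun t ht => (hderiv ht).differentiableAt, ?_⟩
  -- The ray coefficients are at most `4 * t`, hence at most `4` for `t ≤ 1`.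
  obtain ⟨M₁, hM₁, h₁⟩ := (hray φ (by rw [abs_of_pos hφ0]; linarith)).exists_norm_le 4
  obtain ⟨M₂, hM₂, h₂⟩ := (hray (-φ) (by rw [abs_neg, abs_of_pos hφ0]; linarith)).exists_norm_le 4
  refine ⟨M₁ * M₂ / (Real.sin φ / 4), by positivity, fun t ht ht1 => ?_⟩
  rw [(hderiv ht).deriv, div_div]
  refine Complex.norm_deriv_le_of_forall_mem_sphere_norm_le (by positivity) ?_ ?_
  · refine DifferentiableOn.diffContOnCl fun z hz => ?_
    have hz' := closure_minimal Metric.ball_subset_closedBall Metric.isClosed_closedBall hz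
    rw [Metric.mem_closedBall, dist_eq_norm] at hz'
    exact (han z (hball ht hz')).differentiableAt.differentiableWithinAt
  · intro z hz
    rw [mem_sphere_iff_norm] at hz
    obtain ⟨s₁, hs₁, s₂, hs₂, rfl⟩ := exists_sector_decomposition hφ0 hφ1 ht hz.le
    rw [hmul _ (hsec hs₁.1 (abs_of_pos hφ0)) _
      (hsec hs₂.1 (by rw [abs_neg, abs_of_pos hφ0]))]
    refine (ContinuousLinearMap.opNorm_comp_le _ _).trans ?_
    exact mul_le_mul (h₁ s₁ ⟨hs₁.1.le, hs₁.2.trans (by linarith)⟩)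
      (h₂ s₂ ⟨hs₂.1.le, hs₂.2.trans (by linarith)⟩) (norm_nonneg _) hM₁.le

/-- For `t ≤ 1` the bound `C / t` survives the exponential factor. For `t ≥ 1` the derivative at `t`
is `T (t - 1)` times the derivative at `1`, and exponential decay beats `1 / t`. -/
theorem IsAnalyticSemigroup.isStableAnalytic_shifted [CompleteSpace H] {S : ℝ → H →L[ℂ] H}
    (hS : IsAnalyticSemigroup S) {lam : ℝ} (hlam : IsAdmissibleShift S lam) :
    IsStableAnalytic (shifted S lam) := by
  obtain ⟨hdiff, C, hC, hderiv⟩ := hS.exists_norm_deriv_le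
  have hadd (s t : ℝ) (hs : 0 ≤ s) (ht : 0 ≤ t) :
      shifted S lam (s + t) = shifted S lam s * shifted S lam t := by
    unfold shifted
    rw [hS.c0.add s t hs ht, smul_mul_smul_comm, ← Real.exp_add]
    congr 2
    ring
  have hdecay : ∃ M ε : ℝ, 0 < ε ∧ ∀ t : ℝ, 0 ≤ t →
      ‖shifted S lam t‖ ≤ M * Real.exp (-(ε * t)) := by
    obtain ⟨M, a, ha, h⟩ := hlam
    refine ⟨M, lam - a, by linarith, fun t ht => ?_⟩
    rw [shifted, norm_smul, Real.norm_of_nonneg (Real.exp_pos _).le]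
    calc _ ≤ Real.exp (-(lam * t)) * (M * Real.exp (a * t)) := by gcongr; exact h t ht
      _ = M * (Real.exp (-(lam * t)) * Real.exp (a * t)) := by ring
      _ = _ := by rw [← Real.exp_add]; congr 2; ring
  have hd {t : ℝ} (ht : 0 < t) : HasDerivAt (shifted S lam)
      (Real.exp (-(lam * t)) • deriv S t + (Real.exp (-(lam * t)) * -lam) • S t) t := by
    have h1 : HasDerivAt (fun u => Real.exp (-(lam * u))) (Real.exp (-(lam * t)) * -lam) t := by
      have := ((hasDerivAt_id t).const_mul lam).neg.exp
      simpa using this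
    exact h1.smul (hdiff t ht).hasDerivAt
  refine ⟨hadd, fun x => ?_, hdecay, fun t ht => (hd ht).differentiableAt, ?_⟩
  · have h1 : ContinuousWithinAt (fun t : ℝ => S t x) (Ici 0) 0 := by
      have := hS.c0.cont (x, 0) ⟨mem_univ _, self_mem_Ici⟩
      exact this.comp (f := fun t : ℝ => (x, t)) (by fun_prop : ContinuousAt _ _).continuousWithinAt
        fun t ht => ⟨mem_univ _, ht⟩
    have h2 : Tendsto (fun t : ℝ => S t x) (𝓝[>] 0) (𝓝 x) := by
      have := h1.tendsto.mono_left (nhdsWithin_mono _ Ioi_subset_Ici_self)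
      simpa [hS.c0.zero] using this
    have h3 : Tendsto (fun t : ℝ => Real.exp (-(lam * t))) (𝓝[>] 0) (𝓝 1) := by
      have : ContinuousAt (fun t : ℝ => Real.exp (-(lam * t))) 0 := by fun_prop
      have := this.tendsto.mono_left (nhdsWithin_le_nhds (s := Ioi 0))
      simpa using this
    simpa [shifted] using h3.smul h2
  · obtain ⟨M, ε, hε, hM⟩ := hdecay
    obtain ⟨M₁, hM₁, hSM⟩ := hS.c0.exists_norm_le 1
    have hMnn : 0 ≤ M := by simpa using (norm_nonneg _).trans (hM 0 le_rfl)
    have hexp (t : ℝ) (ht : 0 < t) (ht1 : t ≤ 1) : Real.exp (-(lam * t)) ≤ Real.exp |lam| := by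
      refine Real.exp_le_exp.2 ?_
      calc -(lam * t) ≤ |lam * t| := neg_le_abs _
        _ = |lam| * t := by rw [abs_mul, abs_of_pos ht]
        _ ≤ |lam| * 1 := by gcongr
        _ = |lam| := mul_one _
    set C₁ := Real.exp |lam| * C + Real.exp |lam| * |lam| * M₁ with hC₁
    have hC₁0 : 0 ≤ C₁ := by positivity
    have hsmall (t : ℝ) (ht : 0 < t) (ht1 : t ≤ 1) : ‖deriv (shifted S lam) t‖ ≤ C₁ / t := by
      rw [(hd ht).deriv]
      refine (norm_add_le _ _).trans ?_
      rw [norm_smul, norm_smul, norm_mul, norm_neg, Real.norm_of_nonneg (Real.exp_pos _).le,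
        Real.norm_eq_abs]
      have h1 : ‖deriv S t‖ ≤ C / t := hderiv t ht ht1
      have h2 : ‖S t‖ ≤ M₁ / t := (hSM t ⟨ht.le, ht1⟩).trans (by
        rw [le_div_iff₀ ht]; nlinarith)
      have h3 := hexp t ht ht1
      calc _ ≤ Real.exp |lam| * (C / t) + Real.exp |lam| * |lam| * (M₁ / t) := by gcongr
        _ = C₁ / t := by rw [hC₁]; ring
    -- The factor `1 / ε` comes from `e^{-ε t} ≤ 1 / (ε t)`, and `e^ε` from the shift of time by
    -- `1`.
    refine ⟨max C₁ (M / ε * C₁ * Real.exp ε), fun t ht => ?_⟩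
    rcases le_total t 1 with ht1 | ht1
    · refine (hsmall t ht ht1).trans ?_
      gcongr
      exact le_max_left _ _
    · have h2 : HasDerivAt (shifted S lam)
          (shifted S lam (t - 1) * deriv (shifted S lam) 1) t := by
        have h4 : HasDerivAt (fun u => shifted S lam (t - 1) * shifted S lam (u - (t - 1)))
            (shifted S lam (t - 1) * deriv (shifted S lam) 1) t := by
          have h5 : HasDerivAt (shifted S lam) (deriv (shifted S lam) 1) (t - (t - 1)) := by
            rw [sub_sub_cancel]
            exact (hd one_pos).differentiableAt.hasDerivAt
          exact (h5.comp_sub_const t (t - 1)).const_mul _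
        refine h4.congr_of_eventuallyEq ?_
        filter_upwards [lt_mem_nhds (show t - 1 < t by linarith)] with u hu
        rw [← hadd _ _ (by linarith) (by linarith)]
        congr 1; ring
      rw [h2.deriv]
      have h3 : ‖shifted S lam (t - 1)‖ ≤ M / ε / t * Real.exp ε := by
        refine (hM _ (by linarith)).trans ?_
        have h6 : Real.exp (-(ε * t)) ≤ 1 / (ε * t) := by
          rw [Real.exp_neg, inv_eq_one_div]
          refine one_div_le_one_div_of_le (by positivity) ?_
          linarith [Real.add_one_le_exp (ε * t)]
        calc M * Real.exp (-(ε * (t - 1))) = M * Real.exp (-(ε * t)) * Real.exp ε := by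
              rw [mul_assoc, ← Real.exp_add]; congr 2; ring
          _ ≤ M * (1 / (ε * t)) * Real.exp ε := by gcongr
          _ = _ := by field_simp
      calc _ ≤ ‖shifted S lam (t - 1)‖ * ‖deriv (shifted S lam) 1‖ := norm_mul_le _ _
        _ ≤ (M / ε / t * Real.exp ε) * C₁ := by
          gcongr
          simpa using hsmall 1 one_pos le_rfl
        _ = (M / ε * C₁ * Real.exp ε) / t := by ring
        _ ≤ _ := by gcongr; exact le_max_right _ _

end Analytic

theorem enorm_sq_eq_ofReal {E : Type*} [SeminormedAddGroup E] (x : E) :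
    ‖x‖ₑ ^ 2 = ENNReal.ofReal (‖x‖ ^ 2) := by
  rw [← ofReal_norm, ← ENNReal.ofReal_pow (norm_nonneg _)]

/-! ### Moments of Gaussian random variables with values in a Hilbert space. -/

section Moments

variable {Ω : Type*} [MeasurableSpace Ω] {P : Measure Ω}

/-- The moment of order `2 n` of the standard Gaussian distribution. -/
def gaussMoment (n : ℕ) : ℝ≥0∞ := ∫⁻ x, ‖x‖ₑ ^ (2 * n) ∂gaussianReal 0 1

theorem gaussMoment_lt_top {n : ℕ} (hn : n ≠ 0) : gaussMoment n < ∞ := by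
  have h := (memLp_id_gaussianReal' (μ := 0) (v := 1) (2 * n : ℕ)
    (ENNReal.natCast_ne_top _)).eLpNorm_lt_top
  rw [eLpNorm_lt_top_iff_lintegral_rpow_enorm_lt_top (by simpa using hn)
    (ENNReal.natCast_ne_top _)] at h
  simpa [gaussMoment, ← ENNReal.rpow_natCast] using h

/-- A centred Gaussian variable has the law of `√v` times a standard one, where `v` is its second
moment. -/
theorem lintegral_enorm_pow_of_hasGaussianLaw {X : Ω → ℝ} (hX : HasGaussianLaw X P)
    (h0 : ∫ ω, X ω ∂P = 0) (n : ℕ) :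
    ∫⁻ ω, ‖X ω‖ₑ ^ (2 * n) ∂P = gaussMoment n * (∫⁻ ω, ‖X ω‖ₑ ^ 2 ∂P) ^ n := by
  set v := Var[X; P].toNNReal with hv
  have hmap : P.map X = (gaussianReal 0 1).map (Real.sqrt v * ·) := by
    rw [hX.map_eq_gaussianReal, h0, gaussianReal_map_const_mul, mul_zero, mul_one]
    congr 1
    ext
    simp [hv]
  have h2 : ∫⁻ ω, ‖X ω‖ₑ ^ 2 ∂P = v := by
    have e1 := variance_of_integral_eq_zero hX.aemeasurable h0
    have e2 : ∫⁻ ω, ‖X ω‖ₑ ^ 2 ∂P = ENNReal.ofReal (∫ ω, X ω ^ 2 ∂P) := by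
      rw [ofReal_integral_eq_lintegral_ofReal hX.memLp_two.integrable_sq
        (Eventually.of_forall fun _ => sq_nonneg _)]
      refine lintegral_congr fun ω => ?_
      rw [enorm_sq_eq_ofReal, Real.norm_eq_abs, sq_abs]
    rw [e2, ← e1]
    rfl
  have hm (k : ℕ) : Measurable fun x : ℝ => ‖x‖ₑ ^ k := by fun_prop
  have e3 : ∫⁻ ω, ‖X ω‖ₑ ^ (2 * n) ∂P = ∫⁻ x, ‖x‖ₑ ^ (2 * n) ∂P.map X :=
    (lintegral_map' (hm _).aemeasurable hX.aemeasurable).symm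
  rw [e3, hmap, lintegral_map (hm _) (by fun_prop), h2, gaussMoment,
    mul_comm (∫⁻ x, _ ∂_) _, ← lintegral_const_mul _ (hm _)]
  refine lintegral_congr fun x => ?_
  rw [enorm_mul, mul_pow, pow_mul]
  congr 2
  rw [enorm_sq_eq_ofReal, Real.norm_eq_abs, sq_abs,
    Real.sq_sqrt v.coe_nonneg, ENNReal.ofReal_coe_nnreal]

theorem lintegral_finset_sum_pow_le {α ι : Type*} [MeasurableSpace α] {μ : Measure α}
    {f : ι → α → ℝ≥0∞} (hf : ∀ i, AEMeasurable (f i) μ) {p : ℝ} (hp : 1 ≤ p) (s : Finset ι) :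
    (∫⁻ a, (∑ i ∈ s, f i a) ^ p ∂μ) ^ (1 / p) ≤ ∑ i ∈ s, (∫⁻ a, f i a ^ p ∂μ) ^ (1 / p) := by
  classical
  induction s using Finset.induction_on with
  | empty => simp [ENNReal.zero_rpow_of_pos (zero_lt_one.trans_le hp), zero_lt_one.trans_le hp]
  | insert i s hi ih =>
    simp only [Finset.sum_insert hi]
    refine (ENNReal.lintegral_Lp_add_le (hf i)
      (Finset.aemeasurable_fun_sum s fun j _ => hf j) hp).trans ?_
    gcongr

/-- Minkowski's inequality for countable sums: the finite case passes to the supremum over the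
directed family of finite subsets by monotone convergence. -/
theorem lintegral_tsum_pow_le {α ι : Type*} [Countable ι] [MeasurableSpace α] {μ : Measure α}
    {f : ι → α → ℝ≥0∞} (hf : ∀ i, AEMeasurable (f i) μ) {p : ℝ} (hp : 1 ≤ p) :
    ∫⁻ a, (∑' i, f i a) ^ p ∂μ ≤ (∑' i, (∫⁻ a, f i a ^ p ∂μ) ^ (1 / p)) ^ p := by
  have hp0 : 0 < p := zero_lt_one.trans_le hp
  have h1 (a : α) : (∑' i, f i a) ^ p = ⨆ s : Finset ι, (∑ i ∈ s, f i a) ^ p := by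
    rw [ENNReal.tsum_eq_iSup_sum]
    exact (ENNReal.orderIsoRpow p hp0).map_iSup _
  simp_rw [h1]
  rw [lintegral_iSup_directed]
  · refine iSup_le fun s => ?_
    have := lintegral_finset_sum_pow_le hf hp s
    rw [one_div, ENNReal.rpow_inv_le_iff hp0, ← one_div] at this
    refine this.trans ?_
    gcongr
    exact ENNReal.sum_le_tsum s
  · exact fun s => (Finset.aemeasurable_fun_sum s fun j _ => hf j).pow_const p
  · refine directed_of_isDirected_le fun s t hst a => ?_
    simp only
    gcongr

/-- Write `‖X‖²` as the sum of the squared coordinates and apply Minkowski in `Lⁿ`. For each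
coordinate the `Lⁿ` norm of its square is a fixed multiple of its mean, so the means add up again
and the constant is the one-dimensional one, independent of the dimension. -/
theorem lintegral_enorm_pow_le_of_coordinates {E : Type*} [NormedAddCommGroup E]
    [InnerProductSpace ℝ E] [CompleteSpace E] [TopologicalSpace.SeparableSpace E] {X : Ω → E}
    (hX : ∀ y : E, HasGaussianLaw (fun ω => ⟪y, X ω⟫_ℝ) P)
    (h0 : ∀ y : E, ∫ ω, ⟪y, X ω⟫_ℝ ∂P = 0) {n : ℕ} (hn : n ≠ 0) :
    ∫⁻ ω, ‖X ω‖ₑ ^ (2 * n) ∂P ≤ gaussMoment n * (∫⁻ ω, ‖X ω‖ₑ ^ 2 ∂P) ^ n := by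
  obtain ⟨b, hb⟩ := exists_hilbertBasis_onbSet ℝ E
  have hn1 : (1 : ℝ) ≤ n := by exact_mod_cast Nat.one_le_iff_ne_zero.2 hn
  have hm (i : onbSet ℝ E) : AEMeasurable (fun ω => ‖⟪b i, X ω⟫_ℝ‖ₑ ^ 2) P :=
    (hX (b i)).aemeasurable.enorm.pow_const 2
  have hn0 : (n : ℝ) ≠ 0 := by exact_mod_cast hn
  calc ∫⁻ ω, ‖X ω‖ₑ ^ (2 * n) ∂P = ∫⁻ ω, (∑' i, ‖⟪b i, X ω⟫_ℝ‖ₑ ^ 2) ^ (n : ℝ) ∂P := by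
        refine lintegral_congr fun ω => ?_
        rw [← enorm_sq_eq_tsum b, ENNReal.rpow_natCast, pow_mul]
    _ ≤ (∑' i, (∫⁻ ω, (‖⟪b i, X ω⟫_ℝ‖ₑ ^ 2) ^ (n : ℝ) ∂P) ^ (1 / (n : ℝ))) ^ (n : ℝ) :=
        lintegral_tsum_pow_le hm hn1
    _ = (∑' i, gaussMoment n ^ (1 / (n : ℝ)) * ∫⁻ ω, ‖⟪b i, X ω⟫_ℝ‖ₑ ^ 2 ∂P) ^ (n : ℝ) := by
        congr 1
        refine tsum_congr fun i => ?_
        simp only [ENNReal.rpow_natCast, ← pow_mul]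
        rw [lintegral_enorm_pow_of_hasGaussianLaw (hX (b i)) (h0 (b i)),
          ENNReal.mul_rpow_of_nonneg _ _ (by positivity)]
        congr 1
        rw [← ENNReal.rpow_natCast, ← ENNReal.rpow_mul, mul_one_div_cancel hn0, ENNReal.rpow_one]
    _ = gaussMoment n * (∫⁻ ω, ‖X ω‖ₑ ^ 2 ∂P) ^ n := by
        rw [ENNReal.tsum_mul_left, ← lintegral_tsum hm,
          ENNReal.mul_rpow_of_nonneg _ _ (by positivity), ← ENNReal.rpow_mul,
          one_div_mul_cancel hn0, ENNReal.rpow_one, ENNReal.rpow_natCast]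
        simp_rw [← enorm_sq_eq_tsum b]

end Moments

/-! ### Gaussian law and covariance of the finite linear combinations of `W`. -/

section Wiener

variable {K : Type*} [NormedAddCommGroup K] [InnerProductSpace ℝ K] [CompleteSpace K]
  {K' : Type*} [NormedAddCommGroup K'] [InnerProductSpace ℝ K'] [CompleteSpace K']
  [MeasurableSpace K'] [BorelSpace K'] [SecondCountableTopology K']
  {Ω : Type*} [MeasurableSpace Ω] {P : Measure Ω}
  {ι : K →L[ℝ] K'} {W : ℝ≥0 → Ω → K'}

theorem IsCylindricalWiener.hasGaussianLaw_sum_inner (hW : IsCylindricalWiener ι W P)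
    {J : Type*} [Fintype J] (s : J → ℝ≥0) (a : J → K') :
    HasGaussianLaw (fun ω => ∑ j, ⟪a j, W (s j) ω⟫_ℝ) P := by
  classical
  -- The times `s j` may repeat, so the finite marginal is indexed by their image.
  let I : Finset ℝ≥0 := Finset.univ.image s
  let L : (I → K') →L[ℝ] ℝ := ∑ j, (innerSL ℝ (a j)).comp
    (ContinuousLinearMap.proj (⟨s j, Finset.mem_image_of_mem s (Finset.mem_univ j)⟩ : I))
  have h := (hW.gaussian.hasGaussianLaw I).map_fun L
  have e : (fun ω => ∑ j, ⟪a j, W (s j) ω⟫_ℝ) = fun ω => L (I.restrict (W · ω)) := by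
    ext ω
    simp [L, Finset.restrict_def]
  rwa [e]

variable [IsProbabilityMeasure P]

omit [IsProbabilityMeasure P] in
theorem IsCylindricalWiener.memLp_inner (hW : IsCylindricalWiener ι W P) (t : ℝ≥0) (h : K') :
    MemLp (fun ω => ⟪h, W t ω⟫_ℝ) 2 P := by
  have := hW.hasGaussianLaw_sum_inner (fun _ : Unit => t) (fun _ => h)
  simpa using this.memLp_two

theorem IsCylindricalWiener.integral_sum_inner (hW : IsCylindricalWiener ι W P)
    {J : Type*} [Fintype J] (s : J → ℝ≥0) (a : J → K') :
    ∫ ω, ∑ j, ⟪a j, W (s j) ω⟫_ℝ ∂P = 0 := by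
  rw [integral_finsetSum _ fun j _ => (hW.memLp_inner (s j) (a j)).integrable one_le_two]
  exact Finset.sum_eq_zero fun j _ => hW.centred (s j) (a j)

theorem integral_indicator_mul_indicator (s t : ℝ≥0) :
    ∫ u in Ioi (0 : ℝ), (Ioc (0 : ℝ) s).indicator (fun _ => (1 : ℝ)) u
      * (Ioc (0 : ℝ) t).indicator (fun _ => (1 : ℝ)) u = ((min s t : ℝ≥0) : ℝ) := by
  have h (u : ℝ) : (Ioc (0 : ℝ) s).indicator (fun _ => (1 : ℝ)) u
      * (Ioc (0 : ℝ) t).indicator (fun _ => (1 : ℝ)) u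
      = (Ioc (0 : ℝ) (min s t : ℝ≥0)).indicator (fun _ => (1 : ℝ)) u := by
    rw [← inter_indicator_mul, Ioc_inter_Ioc]
    simp
  simp_rw [h]
  rw [setIntegral_indicator measurableSet_Ioc,
    inter_eq_self_of_subset_right Ioc_subset_Ioi_self]
  simp

/-- This is the Itô isometry for one coordinate: `s ∧ t` is the `L²` inner product of the indicators
of `(0, s]` and `(0, t]`, so both sides expand to the same double sum. -/
theorem IsCylindricalWiener.lintegral_sum_inner_sq (hW : IsCylindricalWiener ι W P)
    {J : Type*} [Fintype J] (s : J → ℝ≥0) (a : J → K') :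
    ∫⁻ ω, ‖∑ j, ⟪a j, W (s j) ω⟫_ℝ‖ₑ ^ 2 ∂P
      = ∫⁻ u in Ioi (0 : ℝ), ‖∑ j, (Ioc (0 : ℝ) (s j)).indicator (fun _ => (1 : ℝ)) u
          • ContinuousLinearMap.adjoint ι (a j)‖ₑ ^ 2 := by
  have hint (i j : J) : IntegrableOn (fun u : ℝ => (Ioc (0 : ℝ) (s i)).indicator
      (fun _ => (1 : ℝ)) u * (Ioc (0 : ℝ) (s j)).indicator (fun _ => (1 : ℝ)) u) (Ioi 0) := by
    have h (u : ℝ) : (Ioc (0 : ℝ) (s i)).indicator (fun _ => (1 : ℝ)) u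
        * (Ioc (0 : ℝ) (s j)).indicator (fun _ => (1 : ℝ)) u
        = (Ioc (0 : ℝ) (s i) ∩ Ioc (0 : ℝ) (s j)).indicator (fun _ => (1 : ℝ)) u := by
      rw [← inter_indicator_mul]; simp
    simp_rw [h]
    refine Integrable.integrableOn (IntegrableOn.integrable_indicator ?_
      (measurableSet_Ioc.inter measurableSet_Ioc))
    rw [Ioc_inter_Ioc]
    simp [integrableOn_const_iff]
  have e1 (ω : Ω) : ‖∑ j, ⟪a j, W (s j) ω⟫_ℝ‖ ^ 2
      = ∑ i, ∑ j, ⟪a i, W (s i) ω⟫_ℝ * ⟪W (s j) ω, a j⟫_ℝ := by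
    rw [Real.norm_eq_abs, sq_abs, sq, Finset.sum_mul_sum]
    simp_rw [real_inner_comm (a _) (W _ ω)]
  have e2 (u : ℝ) : ‖∑ j, (Ioc (0 : ℝ) (s j)).indicator (fun _ => (1 : ℝ)) u
          • ContinuousLinearMap.adjoint ι (a j)‖ ^ 2
      = ∑ i, ∑ j, ((Ioc (0 : ℝ) (s i)).indicator (fun _ => (1 : ℝ)) u
        * (Ioc (0 : ℝ) (s j)).indicator (fun _ => (1 : ℝ)) u)
        * ⟪ContinuousLinearMap.adjoint ι (a i), ContinuousLinearMap.adjoint ι (a j)⟫_ℝ := by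
    rw [← real_inner_self_eq_norm_sq, sum_inner]
    simp_rw [inner_sum, real_inner_smul_left, real_inner_smul_right, mul_assoc]
  have i1 (i j : J) : Integrable (fun ω => ⟪a i, W (s i) ω⟫_ℝ * ⟪W (s j) ω, a j⟫_ℝ) P := by
    simp_rw [real_inner_comm (a j) (W (s j) _)]
    exact (hW.memLp_inner (s i) (a i)).integrable_mul (hW.memLp_inner (s j) (a j))
  have i2 (i j : J) : IntegrableOn (fun u : ℝ => ((Ioc (0 : ℝ) (s i)).indicator
      (fun _ => (1 : ℝ)) u * (Ioc (0 : ℝ) (s j)).indicator (fun _ => (1 : ℝ)) u)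
        * ⟪ContinuousLinearMap.adjoint ι (a i), ContinuousLinearMap.adjoint ι (a j)⟫_ℝ) (Ioi 0) :=
    (hint i j).mul_const _
  simp_rw [enorm_sq_eq_ofReal]
  rw [← ofReal_integral_eq_lintegral_ofReal _ (Eventually.of_forall fun _ => sq_nonneg _),
    ← ofReal_integral_eq_lintegral_ofReal _ (Eventually.of_forall fun _ => sq_nonneg _)]
  · simp_rw [e1, e2]
    rw [integral_finsetSum _ fun i _ => integrable_finsetSum _ fun j _ => i1 i j,
      integral_finsetSum _ fun i _ => integrable_finsetSum _ fun j _ => i2 i j]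
    congr 1
    refine Finset.sum_congr rfl fun i _ => ?_
    rw [integral_finsetSum _ fun j _ => i1 i j, integral_finsetSum _ fun j _ => i2 i j]
    refine Finset.sum_congr rfl fun j _ => ?_
    rw [hW.covariance, integral_mul_const, integral_indicator_mul_indicator]
  · simp_rw [e2]
    exact integrable_finsetSum _ fun i _ => integrable_finsetSum _ fun j _ => i2 i j
  · simp_rw [e1]
    exact integrable_finsetSum _ fun i _ => integrable_finsetSum _ fun j _ => i1 i j

end Wiener

/-! ### Algebra of step functions and their integrals. -/

section StepFunctions

variable {K : Type*} [NormedAddCommGroup K] [InnerProductSpace ℝ K]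
  {K' : Type*} [NormedAddCommGroup K'] [InnerProductSpace ℝ K']
  {Ω : Type*}
  {E : Type*} [NormedAddCommGroup E] [NormedSpace ℝ E]
  {E' : Type*} [NormedAddCommGroup E'] [NormedSpace ℝ E']

/-- The difference of two step functions. -/
def StepFn.sub (F G : StepFn K' E) : StepFn K' E where
  card := F.card + G.card
  left := Fin.append F.left G.left
  right := Fin.append F.right G.right
  le i := by
    refine Fin.addCases (fun i => ?_) (fun i => ?_) i
    · simpa using F.le i
    · simpa using G.le i
  op := Fin.append F.op (fun i => -G.op i)

theorem StepFn.toFun_sub (F G : StepFn K' E) (ι : K →L[ℝ] K') (r : ℝ) :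
    (F.sub G).toFun ι r = F.toFun ι r - G.toFun ι r := by
  have h : (F.sub G).toFun ι r = ∑ i : Fin (F.card + G.card),
      (Ioc ((Fin.append F.left G.left i : ℝ≥0) : ℝ)
        (Fin.append F.right G.right i : ℝ≥0)).indicator
        (fun _ => (Fin.append F.op (fun i => -G.op i) i).comp ι) r := rfl
  rw [h, Fin.sum_univ_add]
  simp only [StepFn.toFun, Fin.append_left, Fin.append_right,
    sub_eq_add_neg, ← Finset.sum_neg_distrib, ContinuousLinearMap.neg_comp]
  congr 1
  refine Finset.sum_congr rfl fun i _ => ?_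
  by_cases h : r ∈ Ioc (G.left i : ℝ) (G.right i) <;> simp [h]

theorem StepFn.integral_sub (F G : StepFn K' E) (W : ℝ≥0 → Ω → K') (ω : Ω) :
    (F.sub G).integral W ω = F.integral W ω - G.integral W ω := by
  have h : (F.sub G).integral W ω = ∑ i : Fin (F.card + G.card),
      Fin.append F.op (fun i => -G.op i) i
        (W (Fin.append F.right G.right i) ω - W (Fin.append F.left G.left i) ω) := rfl
  rw [h, Fin.sum_univ_add]
  simp only [StepFn.integral, Fin.append_left, Fin.append_right, sub_eq_add_neg,
    ← Finset.sum_neg_distrib, neg_apply]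

/-- The image of a step function under a bounded operator. -/
def StepFn.map (B : E →L[ℝ] E') (F : StepFn K' E) : StepFn K' E' where
  card := F.card
  left := F.left
  right := F.right
  le := F.le
  op i := B.comp (F.op i)

theorem StepFn.toFun_map (B : E →L[ℝ] E') (F : StepFn K' E) (ι : K →L[ℝ] K') (r : ℝ) :
    (F.map B).toFun ι r = B.comp (F.toFun ι r) := by
  simp only [StepFn.toFun, StepFn.map, ContinuousLinearMap.comp_finsetSum]
  refine Finset.sum_congr rfl fun i _ => ?_
  by_cases h : r ∈ Ioc (F.left i : ℝ) (F.right i) <;>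
    simp [h, ContinuousLinearMap.comp_assoc]

theorem StepFn.integral_map (B : E →L[ℝ] E') (F : StepFn K' E) (W : ℝ≥0 → Ω → K') (ω : Ω) :
    (F.map B).integral W ω = B (F.integral W ω) := by
  simp only [StepFn.integral, map_sum]
  rfl

theorem StepFn.stronglyMeasurable_toFun (F : StepFn K' E) (ι : K →L[ℝ] K') :
    StronglyMeasurable (F.toFun ι) := by
  have : F.toFun ι = fun r => ∑ i, (Ioc (F.left i : ℝ) (F.right i)).indicator
    (fun _ => (F.op i).comp ι) r := rfl
  rw [this]
  exact Finset.stronglyMeasurable_fun_sum _ fun i _ =>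
    stronglyMeasurable_const.indicator measurableSet_Ioc

theorem StepFn.aestronglyMeasurable_toFun_apply (F : StepFn K' E) (ι : K →L[ℝ] K') (k : K)
    (μ : Measure ℝ) : AEStronglyMeasurable (fun r => F.toFun ι r k) μ :=
  ((ContinuousLinearMap.apply ℝ E k).continuous.comp_stronglyMeasurable
    (F.stronglyMeasurable_toFun ι)).aestronglyMeasurable

theorem Ioc_indicator_eq_sub {M : Type*} [AddCommGroup M] {l r : ℝ≥0} (h : l ≤ r) (f : ℝ → M) (u : ℝ) :
    (Ioc (l : ℝ) r).indicator f u
      = (Ioc (0 : ℝ) r).indicator f u - (Ioc (0 : ℝ) l).indicator f u := by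
  have h' : (l : ℝ) ≤ r := by exact_mod_cast h
  have hl := l.coe_nonneg
  by_cases h1 : 0 < u <;> by_cases h2 : u ≤ l <;> by_cases h3 : u ≤ r <;>
    simp [indicator, h1, h2, h3] <;> exact absurd h1 (by linarith)

end StepFunctions

/-! ### The Itô isometry and moment bounds for step functions. -/

section Isometry

variable {K : Type*} [NormedAddCommGroup K] [InnerProductSpace ℝ K] [CompleteSpace K]
  {K' : Type*} [NormedAddCommGroup K'] [InnerProductSpace ℝ K'] [CompleteSpace K']
  {E : Type*} [NormedAddCommGroup E] [InnerProductSpace ℝ E] [CompleteSpace E]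
  {Ω : Type*} {ι : K →L[ℝ] K'} {W : ℝ≥0 → Ω → K'}

/-- The endpoints of the intervals of a step function. -/
def StepFn.endpoint (F : StepFn K' E) : Fin F.card ⊕ Fin F.card → ℝ≥0 := Sum.elim F.right F.left

/-- The vectors representing a coordinate of the integral of a step function. -/
def StepFn.coord (F : StepFn K' E) (y : E) : Fin F.card ⊕ Fin F.card → K' :=
  Sum.elim (fun i => ContinuousLinearMap.adjoint (F.op i) y)
    (fun i => -ContinuousLinearMap.adjoint (F.op i) y)

theorem StepFn.inner_integral (F : StepFn K' E) (y : E) (ω : Ω) :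
    ⟪y, F.integral W ω⟫_ℝ = ∑ j, ⟪F.coord y j, W (F.endpoint j) ω⟫_ℝ := by
  simp only [StepFn.integral, StepFn.coord, StepFn.endpoint, inner_sum, Fintype.sum_sum_type,
    Sum.elim_inl, Sum.elim_inr, inner_neg_left, ContinuousLinearMap.adjoint_inner_left,
    ← Finset.sum_add_distrib, map_sub, inner_sub_right, ← sub_eq_add_neg]

/-- The same vectors and times represent `F(u)* y` and the coordinate `⟪y, ∫ F dW⟫`; this matching
lets the scalar isometry apply. -/
theorem StepFn.adjoint_toFun (F : StepFn K' E) (y : E) (u : ℝ) :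
    ContinuousLinearMap.adjoint (F.toFun ι u) y
      = ∑ j, (Ioc (0 : ℝ) (F.endpoint j)).indicator (fun _ => (1 : ℝ)) u
          • ContinuousLinearMap.adjoint ι (F.coord y j) := by
  simp only [StepFn.toFun, StepFn.coord, StepFn.endpoint, Fintype.sum_sum_type, map_sum,
    Sum.elim_inl, Sum.elim_inr, map_neg, smul_neg, ← Finset.sum_add_distrib, sum_apply]
  refine Finset.sum_congr rfl fun i _ => ?_
  rw [← sub_eq_add_neg, ← sub_smul, ← Ioc_indicator_eq_sub (F.le i)]
  by_cases h : u ∈ Ioc (F.left i : ℝ) (F.right i) <;> simp [h, ContinuousLinearMap.adjoint_comp]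

variable [MeasurableSpace K'] [BorelSpace K'] [SecondCountableTopology K']
  [MeasurableSpace Ω] {P : Measure Ω}
  [TopologicalSpace.SeparableSpace E]

theorem StepFn.aestronglyMeasurable_integral {E : Type*} [NormedAddCommGroup E] [NormedSpace ℝ E]
    (F : StepFn K' E) (hW : IsCylindricalWiener ι W P) :
    AEStronglyMeasurable (F.integral W) P := by
  have hm (t : ℝ≥0) : AEStronglyMeasurable (W t) P :=
    (hW.gaussian.aemeasurable t).aestronglyMeasurable
  refine Finset.aestronglyMeasurable_fun_sum _ fun i _ => ?_
  exact (F.op i).continuous.comp_aestronglyMeasurable ((hm _).sub (hm _))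

variable [IsProbabilityMeasure P]

/-- Parseval in `E` reduces to one coordinate at a time, and an operator and its adjoint have the
same Hilbert–Schmidt norm. -/
theorem StepFn.lintegral_integral_sq [TopologicalSpace.SeparableSpace K] (F : StepFn K' E)
    (hW : IsCylindricalWiener ι W P) :
    ∫⁻ ω, ‖F.integral W ω‖ₑ ^ 2 ∂P = ∫⁻ u in Ioi (0 : ℝ), hsNormSq (F.toFun ι u) := by
  obtain ⟨b, hb⟩ := exists_hilbertBasis_onbSet ℝ E
  obtain ⟨c, hc⟩ := exists_hilbertBasis_onbSet ℝ K
  have h1 (u : ℝ) : hsNormSq (F.toFun ι u)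
      = ∑' i, ‖ContinuousLinearMap.adjoint (F.toFun ι u) (b i)‖ₑ ^ 2 := by
    rw [hsNormSq_eq_tsum c, tsum_enorm_sq_adjoint c b]
  simp_rw [h1, enorm_sq_eq_tsum b, F.inner_integral]
  rw [lintegral_tsum, lintegral_tsum]
  · refine tsum_congr fun i => ?_
    rw [hW.lintegral_sum_inner_sq]
    simp_rw [F.adjoint_toFun]
  · intro i
    have hm : StronglyMeasurable fun u => ContinuousLinearMap.adjoint (F.toFun ι u) (b i) :=
      ((ContinuousLinearMap.apply ℝ K (b i)).continuous.comp
        ContinuousLinearMap.adjoint.continuous).comp_stronglyMeasurable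
          (F.stronglyMeasurable_toFun ι)
    exact (hm.enorm.pow_const 2).aemeasurable
  · intro i
    simp_rw [← F.inner_integral]
    exact ((aestronglyMeasurable_const.inner (F.aestronglyMeasurable_integral hW)).enorm).pow_const 2

theorem StepFn.lintegral_integral_pow_le [TopologicalSpace.SeparableSpace K] (F : StepFn K' E)
    (hW : IsCylindricalWiener ι W P) {n : ℕ} (hn : n ≠ 0) :
    ∫⁻ ω, ‖F.integral W ω‖ₑ ^ (2 * n) ∂P
      ≤ gaussMoment n * (∫⁻ u in Ioi (0 : ℝ), hsNormSq (F.toFun ι u)) ^ n := by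
  rw [← F.lintegral_integral_sq hW]
  refine lintegral_enorm_pow_le_of_coordinates (fun y => ?_) (fun y => ?_) hn
  · simp_rw [F.inner_integral]
    exact hW.hasGaussianLaw_sum_inner _ _
  · simp_rw [F.inner_integral]
    exact hW.integral_sum_inner _ _

end Isometry

/-! ### The stochastic integral: linearity, moments, uniqueness and existence. -/

section StochasticIntegral

variable {K : Type*} [NormedAddCommGroup K] [InnerProductSpace ℝ K] [CompleteSpace K]
  {K' : Type*} [NormedAddCommGroup K'] [InnerProductSpace ℝ K']
  {Ω : Type*} [MeasurableSpace Ω] {ι : K →L[ℝ] K'} {W : ℝ≥0 → Ω → K'} {P : Measure Ω}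

section NormedTarget

variable {E : Type*} [NormedAddCommGroup E] [NormedSpace ℝ E]
  {E' : Type*} [NormedAddCommGroup E'] [NormedSpace ℝ E']
  {Φ Ψ : ℝ → K →L[ℝ] E} {I J : Ω → E}

/-- Bounded operators map the approximating step functions to approximating step functions. This
transports integrals between `H` and the spaces `H_γ`. -/
theorem IsStochasticIntegral.map (h : IsStochasticIntegral ι W P Φ I) (B : E →L[ℝ] E') :
    IsStochasticIntegral ι W P (fun r => B.comp (Φ r)) (fun ω => B (I ω)) := by
  obtain ⟨h1, h2, F, h3, h4⟩ := h
  refine ⟨fun k => B.continuous.comp_aestronglyMeasurable (h1 k),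
    B.continuous.comp_aestronglyMeasurable h2, fun n => (F n).map B, ?_, ?_⟩
  · have hz := ENNReal.Tendsto.const_mul (a := ‖B‖ₑ ^ 2) h3 (Or.inr (by simp))
    rw [mul_zero] at hz
    refine tendsto_of_tendsto_of_tendsto_of_le_of_le tendsto_const_nhds hz
      (fun _ => zero_le) fun n => ?_
    simp only [StepFn.toFun_map, ← ContinuousLinearMap.comp_sub]
    rw [← lintegral_const_mul' _ _ (by simp)]
    exact lintegral_mono fun r => hsNormSq_comp_le _ _
  · have hz := ENNReal.Tendsto.const_mul (a := ‖B‖ₑ ^ 2) h4 (Or.inr (by simp))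
    rw [mul_zero] at hz
    refine tendsto_of_tendsto_of_tendsto_of_le_of_le tendsto_const_nhds hz
      (fun _ => zero_le) fun n => ?_
    simp only [StepFn.integral_map, ← map_sub]
    rw [← lintegral_const_mul' _ _ (by simp)]
    refine lintegral_mono fun ω => ?_
    rw [← mul_pow]
    gcongr
    exact B.le_opENorm _

theorem IsStochasticIntegral.sub [TopologicalSpace.SeparableSpace K]
    (hF : ∀ F : StepFn K' E, AEStronglyMeasurable (F.integral W) P)
    (h : IsStochasticIntegral ι W P Φ I) (h' : IsStochasticIntegral ι W P Ψ J) :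
    IsStochasticIntegral ι W P (fun r => Φ r - Ψ r) (fun ω => I ω - J ω) := by
  obtain ⟨h1, h2, F, h3, h4⟩ := h
  obtain ⟨h1', h2', G, h3', h4'⟩ := h'
  refine ⟨fun k => (h1 k).sub (h1' k), h2.sub h2', fun n => (F n).sub (G n), ?_, ?_⟩
  · have hz := ENNReal.Tendsto.const_mul (a := 4) (h3.add h3') (Or.inr (by simp))
    rw [add_zero, mul_zero] at hz
    refine tendsto_of_tendsto_of_tendsto_of_le_of_le tendsto_const_nhds hz
      (fun _ => zero_le) fun n => ?_
    simp only [StepFn.toFun_sub]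
    rw [← lintegral_add_left', ← lintegral_const_mul' _ _ (by simp)]
    · refine lintegral_mono fun r => ?_
      rw [sub_sub_sub_comm]
      exact hsNormSq_sub_le _ _
    · exact aemeasurable_hsNormSq fun k =>
        (h1 k).sub ((F n).aestronglyMeasurable_toFun_apply ι k _)
  · have hz := ENNReal.Tendsto.const_mul (a := 4) (h4.add h4') (Or.inr (by simp))
    rw [add_zero, mul_zero] at hz
    refine tendsto_of_tendsto_of_tendsto_of_le_of_le tendsto_const_nhds hz
      (fun _ => zero_le) fun n => ?_
    simp only [StepFn.integral_sub]
    rw [← lintegral_add_left', ← lintegral_const_mul' _ _ (by simp)]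
    · refine lintegral_mono fun ω => ?_
      rw [sub_sub_sub_comm, sub_eq_add_neg, ← enorm_neg (J ω - _)]
      exact enorm_add_sq_le _ _
    · exact (h2.sub (hF (F n))).enorm.pow_const 2

theorem IsStochasticIntegral.congr (h : IsStochasticIntegral ι W P Φ I)
    (hΦ : ∀ᵐ r ∂volume.restrict (Ioi (0 : ℝ)), Φ r = Ψ r) :
    IsStochasticIntegral ι W P Ψ I := by
  obtain ⟨h1, h2, F, h3, h4⟩ := h
  refine ⟨fun k => (h1 k).congr (hΦ.mono fun r hr => by simp only [hr]), h2, F,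
    h3.congr fun n => lintegral_congr_ae (hΦ.mono fun r hr => by simp only [hr]), h4⟩

end NormedTarget

section HilbertTarget

variable {E : Type*} [NormedAddCommGroup E] [InnerProductSpace ℝ E] [CompleteSpace E]
  [TopologicalSpace.SeparableSpace E] [TopologicalSpace.SeparableSpace K]
  [CompleteSpace K'] [MeasurableSpace K'] [BorelSpace K'] [SecondCountableTopology K']
  [IsProbabilityMeasure P]
  {Φ : ℝ → K →L[ℝ] E} {I J : Ω → E}

omit [IsProbabilityMeasure P] in
theorem exists_ae_tendsto_of_lintegral_tendsto {E : Type*} [NormedAddCommGroup E] {f : ℕ → Ω → E}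
    {g : Ω → E} (hf : ∀ n, AEStronglyMeasurable (f n) P) (hg : AEStronglyMeasurable g P)
    (h : Tendsto (fun n => ∫⁻ ω, ‖g ω - f n ω‖ₑ ^ 2 ∂P) atTop (𝓝 0)) :
    ∃ ns : ℕ → ℕ, StrictMono ns ∧ ∀ᵐ ω ∂P, Tendsto (fun i => f (ns i) ω) atTop (𝓝 (g ω)) := by
  refine (tendstoInMeasure_of_tendsto_eLpNorm (p := 2) two_ne_zero hf hg ?_).exists_seq_tendsto_ae
  have h2 := h.ennrpow_const (1 / 2)
  rw [ENNReal.zero_rpow_of_pos (by norm_num)] at h2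
  refine h2.congr fun n => ?_
  rw [eLpNorm_eq_lintegral_rpow_enorm_toReal two_ne_zero (by simp)]
  simp only [ENNReal.toReal_ofNat, Pi.sub_apply]
  congr 1
  refine lintegral_congr fun ω => ?_
  rw [← enorm_neg (g ω - _), neg_sub]
  norm_cast

/-- Fatou's lemma along an almost surely convergent subsequence of the approximating integrals. The
factor `4` is that of the quasi-triangle inequality; an inequality is enough for uniqueness and for
Kolmogorov's criterion. -/
theorem IsStochasticIntegral.lintegral_pow_le (hW : IsCylindricalWiener ι W P)
    (h : IsStochasticIntegral ι W P Φ I) {n : ℕ} (hn : n ≠ 0) :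
    ∫⁻ ω, ‖I ω‖ₑ ^ (2 * n) ∂P
      ≤ gaussMoment n * (4 * ∫⁻ r in Ioi (0 : ℝ), hsNormSq (Φ r)) ^ n := by
  obtain ⟨h1, h2, F, h3, h4⟩ := h
  have hF (m : ℕ) := (F m).aestronglyMeasurable_integral hW
  obtain ⟨ns, hns, hlim⟩ := exists_ae_tendsto_of_lintegral_tendsto hF h2 h4
  have e1 : ∫⁻ ω, ‖I ω‖ₑ ^ (2 * n) ∂P
      ≤ liminf (fun i => ∫⁻ ω, ‖(F (ns i)).integral W ω‖ₑ ^ (2 * n) ∂P) atTop := by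
    refine (lintegral_mono_ae ?_).trans
      (lintegral_liminf_le' fun i => (hF (ns i)).enorm.pow_const (2 * n))
    filter_upwards [hlim] with ω hω
    exact ((ENNReal.Tendsto.pow hω.enorm).liminf_eq).ge
  have e2 (m : ℕ) : ∫⁻ u in Ioi (0 : ℝ), hsNormSq ((F m).toFun ι u)
      ≤ 4 * ((∫⁻ r in Ioi (0 : ℝ), hsNormSq (Φ r))
        + ∫⁻ r in Ioi (0 : ℝ), hsNormSq (Φ r - (F m).toFun ι r)) := by
    rw [← lintegral_add_left' (aemeasurable_hsNormSq h1), ← lintegral_const_mul' _ _ (by simp)]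
    refine lintegral_mono fun r => ?_
    conv_lhs => rw [← sub_sub_cancel (Φ r) ((F m).toFun ι r)]
    exact hsNormSq_sub_le _ _
  have e3 : Tendsto (fun i => gaussMoment n * (4 * ((∫⁻ r in Ioi (0 : ℝ), hsNormSq (Φ r))
        + ∫⁻ r in Ioi (0 : ℝ), hsNormSq (Φ r - (F (ns i)).toFun ι r))) ^ n) atTop
      (𝓝 (gaussMoment n * (4 * ((∫⁻ r in Ioi (0 : ℝ), hsNormSq (Φ r)) + 0)) ^ n)) := by
    refine ENNReal.Tendsto.const_mul ?_ (Or.inr (gaussMoment_lt_top hn).ne)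
    refine ENNReal.Tendsto.pow ?_
    refine ENNReal.Tendsto.const_mul ?_ (Or.inr (by simp))
    exact tendsto_const_nhds.add (h3.comp hns.tendsto_atTop)
  rw [add_zero] at e3
  refine e1.trans (e3.liminf_eq ▸ liminf_le_liminf (Eventually.of_forall fun i => ?_))
  refine ((F (ns i)).lintegral_integral_pow_le hW hn).trans ?_
  gcongr
  exact e2 _

/-- The difference is a stochastic integral of `0`, so its second moment vanishes. -/
theorem IsStochasticIntegral.ae_eq (hW : IsCylindricalWiener ι W P)
    (h : IsStochasticIntegral ι W P Φ I) (h' : IsStochasticIntegral ι W P Φ J) :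
    ∀ᵐ ω ∂P, I ω = J ω := by
  have hs := h.sub (fun F => F.aestronglyMeasurable_integral hW) h'
  have h1 := hs.lintegral_pow_le hW one_ne_zero
  simp only [sub_self, hsNormSq_zero, lintegral_zero, mul_zero, pow_one, mul_one] at h1
  rw [nonpos_iff_eq_zero, lintegral_eq_zero_iff' (hs.2.1.enorm.pow_const 2)] at h1
  filter_upwards [h1] with ω hω
  simpa [sub_eq_zero] using hω

/-- By the isometry the integrals of the step functions form a Cauchy sequence in the complete space
`L²(Ω; E)`. -/
theorem exists_isStochasticIntegral (hW : IsCylindricalWiener ι W P)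
    (hΦ : ∀ k, AEStronglyMeasurable (fun r => Φ r k) (volume.restrict (Ioi (0 : ℝ))))
    {F : ℕ → StepFn K' E}
    (hF : Tendsto (fun n => ∫⁻ r in Ioi (0 : ℝ), hsNormSq (Φ r - (F n).toFun ι r)) atTop (𝓝 0))
    (hfin : ∀ n, ∫⁻ r in Ioi (0 : ℝ), hsNormSq ((F n).toFun ι r) < ∞) :
    ∃ I : Ω → E, IsStochasticIntegral ι W P Φ I := by
  have hm (n : ℕ) := (F n).aestronglyMeasurable_integral hW
  have hnorm {f : Ω → E} : eLpNorm f 2 P = (∫⁻ ω, ‖f ω‖ₑ ^ 2 ∂P) ^ (1 / 2 : ℝ) := by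
    rw [eLpNorm_eq_lintegral_rpow_enorm_toReal two_ne_zero (by simp)]
    simp only [ENNReal.toReal_ofNat]
    norm_cast
  have hLp (n : ℕ) : MemLp ((F n).integral W) 2 P := by
    refine ⟨hm n, ?_⟩
    rw [hnorm, (F n).lintegral_integral_sq hW]
    exact ENNReal.rpow_lt_top_of_nonneg (by norm_num) (hfin n).ne
  have hdiff (n m : ℕ) : ∫⁻ ω, ‖(F n).integral W ω - (F m).integral W ω‖ₑ ^ 2 ∂P
      ≤ 4 * ((∫⁻ r in Ioi (0 : ℝ), hsNormSq (Φ r - (F n).toFun ι r))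
        + ∫⁻ r in Ioi (0 : ℝ), hsNormSq (Φ r - (F m).toFun ι r)) := by
    simp_rw [← StepFn.integral_sub]
    rw [((F n).sub (F m)).lintegral_integral_sq hW]
    rw [← lintegral_add_left', ← lintegral_const_mul' _ _ (by simp)]
    · refine lintegral_mono fun r => ?_
      rw [StepFn.toFun_sub, hsNormSq_sub_comm,
        ← sub_sub_sub_cancel_left ((F n).toFun ι r) ((F m).toFun ι r) (Φ r)]
      exact hsNormSq_sub_le _ _
    · exact aemeasurable_hsNormSq fun k =>
        (hΦ k).sub ((F n).aestronglyMeasurable_toFun_apply ι k _)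
  have hcau : CauchySeq fun n => (hLp n).toLp := by
    rw [EMetric.cauchySeq_iff]
    intro ε hε
    -- The bound is on the squared distance and carries the constant `4`: `4 * (ε² / 8 + ε² / 8) =
    -- ε²`.
    have hε2 : 0 < ε ^ (2 : ℝ) / 8 := ENNReal.div_pos (by simp [hε.ne']) (by simp)
    obtain ⟨N, hN⟩ := eventually_atTop.1 ((tendsto_order.1 hF).2 _ hε2)
    refine ⟨N, fun n hn m hm => ?_⟩
    rw [Lp.edist_toLp_toLp, hnorm, one_div, ENNReal.rpow_inv_lt_iff two_pos]
    refine (hdiff n m).trans_lt ?_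
    calc _ < 4 * (ε ^ (2 : ℝ) / 8 + ε ^ (2 : ℝ) / 8) :=
          ENNReal.mul_lt_mul_right (by simp) (by simp) (ENNReal.add_lt_add (hN n hn) (hN m hm))
      _ = ε ^ (2 : ℝ) := by
        rw [← ENNReal.add_div, ← two_mul, ← mul_div_assoc, ← mul_assoc]
        norm_num
        rw [mul_comm, mul_div_assoc, ENNReal.div_self (by simp) (by simp), mul_one]
  obtain ⟨I, hI⟩ := cauchySeq_tendsto_of_complete hcau
  refine ⟨I, hΦ, (Lp.aestronglyMeasurable I), F, hF, ?_⟩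
  have h1 : Tendsto (fun n => edist I (hLp n).toLp) atTop (𝓝 0) := by
    simpa [edist_comm] using tendsto_iff_edist_tendsto_0.1 hI
  have h2 := h1.ennrpow_const 2
  rw [ENNReal.zero_rpow_of_pos two_pos] at h2
  refine h2.congr fun n => ?_
  have e : edist I (hLp n).toLp = eLpNorm (fun ω => I ω - (F n).integral W ω) 2 P := by
    rw [Lp.edist_def]
    refine eLpNorm_congr_ae ?_
    filter_upwards [(hLp n).coeFn_toLp] with ω hω
    simp [hω]
  rw [e, hnorm, ← ENNReal.rpow_mul]
  norm_num

end HilbertTarget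

end StochasticIntegral

/-! ### Dyadic chaining for a single path. -/

section Chaining

variable {E : Type*} [NormedAddCommGroup E]

/-- The largest dyadic number of level `k` below `t`. -/
def dyadicFloor (k : ℕ) (t : ℝ≥0) : ℝ≥0 := ⌊2 ^ k * t⌋₊ / 2 ^ k

theorem dyadicFloor_le (k : ℕ) (t : ℝ≥0) : dyadicFloor k t ≤ t := by
  rw [dyadicFloor, div_le_iff₀ (by positivity), mul_comm]
  exact Nat.floor_le (by positivity)

theorem sub_dyadicFloor_le (k : ℕ) (t : ℝ≥0) : (t : ℝ) - dyadicFloor k t ≤ (1 / 2) ^ k := by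
  have h : (2 ^ k * t : ℝ≥0) < ⌊2 ^ k * t⌋₊ + 1 := Nat.lt_floor_add_one _
  have h' : (2 ^ k * t : ℝ) < ⌊2 ^ k * t⌋₊ + 1 := by exact_mod_cast h
  have h2 : (0 : ℝ) < 2 ^ k := by positivity
  rw [dyadicFloor]
  push_cast
  rw [one_div, inv_pow, sub_le_iff_le_add, ← one_div, ← add_div, le_div_iff₀ h2]
  linarith

/-- The increments of `g` over neighbouring dyadic numbers in `[0, N]` are controlled by `M` with
exponent `δ`. -/
def DyadicIncrementsLE (g : ℝ≥0 → E) (N : ℕ) (δ M : ℝ) : Prop :=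
  ∀ k i : ℕ, i < N * 2 ^ k → ‖g ((i + 1 : ℕ) / 2 ^ k) - g (i / 2 ^ k)‖ ≤ M * ((2 : ℝ) ^ (-δ)) ^ k

namespace DyadicIncrementsLE

variable {g : ℝ≥0 → E} {N : ℕ} {δ M : ℝ}

/-- With `m = ⌊2^k t⌋`, the finer floor is `2 m` or `2 m + 1`, so successive approximations coincide
or are neighbours on the finer grid. -/
theorem dist_dyadicFloor_succ_le (h : DyadicIncrementsLE g N δ M) (hM : 0 ≤ M) {t : ℝ≥0}
    (ht : t ≤ N) (k : ℕ) : dist (g (dyadicFloor k t)) (g (dyadicFloor (k + 1) t))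
      ≤ M * (2 : ℝ) ^ (-δ) * ((2 : ℝ) ^ (-δ)) ^ k := by
  set m := ⌊2 ^ k * t⌋₊ with hm
  set m' := ⌊2 ^ (k + 1) * t⌋₊ with hm'
  have e : dyadicFloor k t = ((2 * m : ℕ) : ℝ≥0) / 2 ^ (k + 1) := by
    rw [dyadicFloor, ← hm, pow_succ]
    push_cast
    field_simp
  have e' : dyadicFloor (k + 1) t = m' / 2 ^ (k + 1) := rfl
  have h1 : (m : ℝ≥0) ≤ 2 ^ k * t := Nat.floor_le (by positivity)
  have h2 : 2 ^ k * t < (m : ℝ≥0) + 1 := Nat.lt_floor_add_one _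
  have h3 : 2 * m ≤ m' := by
    refine Nat.le_floor ?_
    rw [pow_succ]; push_cast
    calc (2 : ℝ≥0) * m ≤ 2 * (2 ^ k * t) := by gcongr
      _ = _ := by ring
  have h4 : m' < 2 * m + 2 := by
    refine (Nat.floor_lt (by positivity)).2 ?_
    rw [pow_succ]; push_cast
    calc (2 : ℝ≥0) ^ k * 2 * t = 2 * (2 ^ k * t) := by ring
      _ < 2 * (m + 1) := by gcongr
      _ = _ := by ring
  rw [e, e']
  rcases (by omega : m' = 2 * m ∨ m' = 2 * m + 1) with h5 | h5
  · rw [h5, dist_self]; positivity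
  · have h6 : ((2 * m + 1 : ℕ) : ℝ≥0) ≤ (N * 2 ^ (k + 1) : ℕ) := by
      rw [← h5]
      refine (Nat.floor_le (by positivity)).trans ?_
      push_cast
      rw [mul_comm]
      gcongr
    have h7 : 2 * m + 1 ≤ N * 2 ^ (k + 1) := by exact_mod_cast h6
    rw [h5, dist_comm, dist_eq_norm]
    refine (h (k + 1) (2 * m) (by omega)).trans_eq ?_
    rw [pow_succ]; ring

theorem rpow_neg_lt_one (hδ : 0 < δ) : (2 : ℝ) ^ (-δ) < 1 :=
  Real.rpow_lt_one_of_one_lt_of_neg one_lt_two (by linarith)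

theorem exists_tendsto [CompleteSpace E] (h : DyadicIncrementsLE g N δ M) (hM : 0 ≤ M)
    (hδ : 0 < δ) {t : ℝ≥0} (ht : t ≤ N) :
    ∃ a, Tendsto (fun k => g (dyadicFloor k t)) atTop (𝓝 a) :=
  cauchySeq_tendsto_of_complete (cauchySeq_of_le_geometric _ _ (rpow_neg_lt_one hδ)
    (h.dist_dyadicFloor_succ_le hM ht))

theorem dist_same_level_le (h : DyadicIncrementsLE g N δ M) {k m n : ℕ}
    (hmn : m ≤ n) (hn : n ≤ N * 2 ^ k) :
    dist (g (m / 2 ^ k)) (g (n / 2 ^ k)) ≤ (n - m : ℕ) * (M * ((2 : ℝ) ^ (-δ)) ^ k) := by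
  have := dist_le_Ico_sum_of_dist_le (f := fun i : ℕ => g (i / 2 ^ k)) hmn
    (d := fun _ => M * ((2 : ℝ) ^ (-δ)) ^ k) (fun {i} _ hi => by
      rw [dist_comm, dist_eq_norm]
      exact h k i (hi.trans_le hn))
  simpa using this

/-- If `2^{-(k+1)} < t - s ≤ 2^{-k}`, the level `k` floors of `s` and `t` are at most one step
apart, and the distance from there to `y s` and `y t` is a geometric tail of order `2^{-δ k}`. -/
theorem exists_holderOnWith (h : DyadicIncrementsLE g N δ M) (hM : 0 ≤ M) (hδ : 0 < δ)
    {y : ℝ≥0 → E} (hy : ∀ t : ℝ≥0, t ≤ N → Tendsto (fun k => g (dyadicFloor k t)) atTop (𝓝 (y t))) :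
    ∃ C : ℝ≥0, HolderOnWith C δ.toNNReal y (Icc 0 N) := by
  set r : ℝ := (2 : ℝ) ^ (-δ) with hr
  have hr0 : 0 < r := by positivity
  have hr1 : r < 1 := rpow_neg_lt_one hδ
  set A := M * r / (1 - r) with hA
  have hA0 : 0 ≤ A := div_nonneg (by positivity) (by linarith)
  have hlim {t : ℝ≥0} (ht : t ≤ N) (k : ℕ) : dist (g (dyadicFloor k t)) (y t) ≤ A * r ^ k := by
    refine (dist_le_of_le_geometric_of_tendsto _ _ hr1
      (h.dist_dyadicFloor_succ_le hM ht) (hy t ht) k).trans_eq ?_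
    rw [hA]; ring
  have hfl {t : ℝ≥0} (ht : t ≤ N) (k : ℕ) : ⌊2 ^ k * t⌋₊ ≤ N * 2 ^ k := by
    have : (⌊2 ^ k * t⌋₊ : ℝ≥0) ≤ (N * 2 ^ k : ℕ) := by
      refine (Nat.floor_le (by positivity)).trans ?_
      push_cast
      rw [mul_comm]; gcongr
    exact_mod_cast this
  have hpair {s t : ℝ≥0} (hst : s ≤ t) (ht : t ≤ N) (k c : ℕ)
      (hc : ⌊2 ^ k * t⌋₊ - ⌊2 ^ k * s⌋₊ ≤ c) :
      dist (y s) (y t) ≤ (2 * A + c * M) * r ^ k := by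
    have h1 := hlim (hst.trans ht) k
    have h2 := hlim ht k
    have h3 : dist (g (dyadicFloor k s)) (g (dyadicFloor k t)) ≤ c * (M * r ^ k) := by
      refine (h.dist_same_level_le (Nat.floor_mono (by gcongr)) (hfl ht k)).trans ?_
      gcongr
    rw [dist_comm] at h1
    calc dist (y s) (y t) ≤ dist (y s) (g (dyadicFloor k s))
          + dist (g (dyadicFloor k s)) (g (dyadicFloor k t)) + dist (g (dyadicFloor k t)) (y t) :=
          dist_triangle4 _ _ _ _
      _ ≤ A * r ^ k + c * (M * r ^ k) + A * r ^ k := by gcongr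
      _ = _ := by ring
  -- The coefficient `N + 1` covers both one step at level `k` and the at most `N` steps at level
  -- `0` used for `t - s ≥ 1`; `2 ^ δ` pays for passing from level `k + 1` to level `k`.
  set C := (2 * A + (N + 1) * M) * 2 ^ δ with hC
  have hC0 : 0 ≤ C := by positivity
  have h2δ : (1 : ℝ) ≤ 2 ^ δ := Real.one_le_rpow one_le_two hδ.le
  have main {s t : ℝ≥0} (hst : s < t) (ht : t ≤ N) :
      dist (y s) (y t) ≤ C * ((t : ℝ) - s) ^ δ := by
    have hst' : (0 : ℝ) < (t : ℝ) - s := sub_pos.2 (by exact_mod_cast hst)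
    rcases le_total ((t : ℝ) - s) 1 with h1 | h1
    · obtain ⟨k, hk1, hk2⟩ := exists_nat_pow_near_of_lt_one hst' h1
        (by norm_num : (0 : ℝ) < 1 / 2) (by norm_num)
      have hfloor : ⌊2 ^ k * t⌋₊ - ⌊2 ^ k * s⌋₊ ≤ 1 := by
        have h3 : (2 ^ k * t : ℝ≥0) ≤ 2 ^ k * s + (1 : ℕ) := by
          rw [← NNReal.coe_le_coe]
          push_cast
          rw [one_div, inv_pow, ← one_div, le_div_iff₀ (by positivity)] at hk2
          linarith
        have h4 := Nat.floor_mono h3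
        rw [Nat.floor_add_natCast (by positivity)] at h4
        omega
      have hrk : r ^ k ≤ 2 ^ δ * ((t : ℝ) - s) ^ δ := by
        have e : r ^ k = ((1 / 2 : ℝ) ^ k) ^ δ := by
          rw [hr, Real.rpow_neg two_pos.le, ← Real.inv_rpow two_pos.le, ← one_div,
            ← Real.rpow_natCast, ← Real.rpow_mul (by norm_num), mul_comm,
            Real.rpow_mul (by norm_num), Real.rpow_natCast]
        rw [e, ← Real.mul_rpow two_pos.le hst'.le]
        refine Real.rpow_le_rpow (by positivity) ?_ hδ.le
        rw [pow_succ] at hk1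
        linarith
      calc dist (y s) (y t) ≤ (2 * A + (1 : ℕ) * M) * r ^ k := hpair hst.le ht k 1 hfloor
        _ ≤ (2 * A + (N + 1) * M) * (2 ^ δ * ((t : ℝ) - s) ^ δ) := by
          gcongr
          push_cast
          linarith [(Nat.cast_nonneg N : (0 : ℝ) ≤ N)]
        _ = _ := by rw [hC]; ring
    · have h3 : (1 : ℝ) ≤ ((t : ℝ) - s) ^ δ := Real.one_le_rpow h1 hδ.le
      calc dist (y s) (y t) ≤ (2 * A + N * M) * r ^ 0 :=
            hpair hst.le ht 0 N (by have := hfl ht 0; omega)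
        _ ≤ (2 * A + (N + 1) * M) * 1 * 1 := by
            rw [pow_zero, mul_one, mul_one, mul_one]
            gcongr
            linarith
        _ ≤ _ := by rw [hC]; gcongr
  refine ⟨C.toNNReal, fun s hs t ht => ?_⟩
  rw [edist_dist, edist_dist, Real.coe_toNNReal _ hδ.le,
    ENNReal.ofReal_rpow_of_nonneg dist_nonneg hδ.le]
  change _ ≤ ENNReal.ofReal C * _
  rw [← ENNReal.ofReal_mul hC0]
  refine ENNReal.ofReal_le_ofReal ?_
  rcases lt_trichotomy s t with hst | rfl | hst
  · rw [NNReal.dist_eq, abs_sub_comm, abs_of_pos (sub_pos.2 (by exact_mod_cast hst))]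
    exact main hst ht.2
  · rw [dist_self]; positivity
  · rw [NNReal.dist_eq, abs_of_pos (sub_pos.2 (by exact_mod_cast hst)), dist_comm]
    exact main hst hs.2

end DyadicIncrementsLE

end Chaining

/-! ### Kolmogorov's continuity theorem. -/

section Kolmogorov

variable {E : Type*} [NormedAddCommGroup E] {Ω : Type*} [MeasurableSpace Ω] {P : Measure Ω}
  {X : ℝ≥0 → Ω → E}

/-- The moment condition in Kolmogorov's continuity theorem on `[0, N]`, for the exponent `δ`. -/
def MomentCondition (X : ℝ≥0 → Ω → E) (P : Measure Ω) (N : ℕ) (δ : ℝ) : Prop :=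
  ∃ p : ℕ, p ≠ 0 ∧ ∃ ε : ℝ, 0 < ε ∧ ∃ C : ℝ, 0 ≤ C ∧ ∀ s t : ℝ≥0, s ≤ t → t ≤ N →
    ∫⁻ ω, ‖X t ω - X s ω‖ₑ ^ p ∂P ≤ ENNReal.ofReal (C * ((t : ℝ) - s) ^ (1 + ε + p * δ))

/-- The sum over all levels and positions of the `p`-th powers of the increments, weighted by `2^{δ
k p}`, has finite expectation: level `k` has `N 2^k` terms of expected size at most `C 2^{-(1+ε)k}`.
The sum is therefore almost surely finite, and its `p`-th root bounds every weighted increment. -/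
theorem MomentCondition.ae_dyadicIncrementsLE (hX : ∀ t, AEStronglyMeasurable (X t) P) {N : ℕ}
    {δ : ℝ} (h : MomentCondition X P N δ) :
    ∀ᵐ ω ∂P, ∃ M : ℝ, 0 ≤ M ∧ DyadicIncrementsLE (fun t => X t ω) N δ M := by
  obtain ⟨p, hp, ε, hε, C, hC, hmom⟩ := h
  set R : ℝ := 2 ^ δ with hR
  have hR0 : 0 < R := by positivity
  let D : ℕ → ℕ → Ω → ℝ≥0∞ := fun k i ω =>
    (‖X ((i + 1 : ℕ) / 2 ^ k) ω - X (i / 2 ^ k) ω‖ₑ * ENNReal.ofReal (R ^ k)) ^ p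
  have hDm (k i : ℕ) : AEMeasurable (D k i) P :=
    (((hX _).sub (hX _)).enorm.mul_const _).pow_const p
  have hint (k i : ℕ) (hi : i < N * 2 ^ k) : ∫⁻ ω, D k i ω ∂P
      ≤ ENNReal.ofReal (C * ((2 : ℝ) ^ (-(1 + ε))) ^ k) := by
    simp only [D, mul_pow]
    rw [lintegral_mul_const' _ _ (by simp), ← ENNReal.ofReal_pow (by positivity)]
    have hi' : (((i + 1 : ℕ) : ℝ≥0) / 2 ^ k) ≤ N := by
      rw [div_le_iff₀ (by positivity)]
      exact_mod_cast hi
    have h1 := hmom (i / 2 ^ k) ((i + 1 : ℕ) / 2 ^ k) (by gcongr; simp) hi'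
    have h2 : ((((i + 1 : ℕ) : ℝ≥0) / 2 ^ k : ℝ≥0) : ℝ) - ((i / 2 ^ k : ℝ≥0) : ℝ)
        = (2 : ℝ) ^ (-(k : ℝ)) := by
      rw [Real.rpow_neg two_pos.le, Real.rpow_natCast]
      push_cast
      field_simp
      ring
    rw [h2] at h1
    refine (mul_le_mul_left h1 _).trans ?_
    rw [← ENNReal.ofReal_mul (by positivity)]
    refine ENNReal.ofReal_le_ofReal (le_of_eq ?_)
    rw [mul_assoc]
    congr 1
    rw [hR, ← Real.rpow_natCast, ← Real.rpow_natCast, ← Real.rpow_natCast,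
      ← Real.rpow_mul (by positivity), ← Real.rpow_mul (by positivity),
      ← Real.rpow_mul (by positivity), ← Real.rpow_mul (by positivity),
      ← Real.rpow_add two_pos]
    congr 1
    ring
  have hsum : ∫⁻ ω, ∑' k, ∑ i ∈ Finset.range (N * 2 ^ k), D k i ω ∂P < ∞ := by
    rw [lintegral_tsum fun k => Finset.aemeasurable_fun_sum _ fun i _ => hDm k i]
    have hb (k : ℕ) : ∫⁻ ω, ∑ i ∈ Finset.range (N * 2 ^ k), D k i ω ∂P
        ≤ ENNReal.ofReal (N * C * ((2 : ℝ) ^ (-ε)) ^ k) := by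
      rw [lintegral_finsetSum' _ fun i _ => hDm k i]
      refine (Finset.sum_le_sum fun i hi => hint k i (Finset.mem_range.1 hi)).trans ?_
      rw [Finset.sum_const, Finset.card_range, nsmul_eq_mul, ← ENNReal.ofReal_natCast,
        ← ENNReal.ofReal_mul (by positivity)]
      refine ENNReal.ofReal_le_ofReal (le_of_eq ?_)
      rw [neg_add, Real.rpow_add two_pos, mul_pow, Real.rpow_neg_one, inv_pow]
      push_cast
      field_simp
    refine (ENNReal.tsum_le_tsum hb).trans_lt ?_
    have hg : Summable fun k : ℕ => N * C * ((2 : ℝ) ^ (-ε)) ^ k :=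
      (summable_geometric_of_lt_one (by positivity)
        (DyadicIncrementsLE.rpow_neg_lt_one hε)).mul_left _
    rw [← ENNReal.ofReal_tsum_of_nonneg (fun k => by positivity) hg]
    exact ENNReal.ofReal_lt_top
  have hae := ae_lt_top' (AEMeasurable.tsum fun k =>
    Finset.aemeasurable_fun_sum _ fun i _ => hDm k i) hsum.ne
  filter_upwards [hae] with ω hω
  set S := ∑' k, ∑ i ∈ Finset.range (N * 2 ^ k), D k i ω with hS
  refine ⟨(S ^ (1 / (p : ℝ))).toReal, ENNReal.toReal_nonneg, fun k i hi => ?_⟩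
  have hle : D k i ω ≤ S := by
    refine le_trans ?_ (ENNReal.le_tsum k)
    exact Finset.single_le_sum (f := fun i => D k i ω) (fun _ _ => zero_le)
      (Finset.mem_range.2 hi)
  have hp0 : (0 : ℝ) < p := by exact_mod_cast Nat.pos_of_ne_zero hp
  have hle2 : ‖X ((i + 1 : ℕ) / 2 ^ k) ω - X (i / 2 ^ k) ω‖ₑ * ENNReal.ofReal (R ^ k)
      ≤ S ^ (1 / (p : ℝ)) := by
    rw [one_div, ENNReal.le_rpow_inv_iff hp0, ENNReal.rpow_natCast]
    exact hle
  have hfin : S ^ (1 / (p : ℝ)) ≠ ∞ := (ENNReal.rpow_lt_top_of_nonneg (by positivity) hω.ne).ne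
  have h3 := ENNReal.toReal_mono hfin hle2
  rw [ENNReal.toReal_mul, toReal_enorm, ENNReal.toReal_ofReal (by positivity)] at h3
  rw [Real.rpow_neg two_pos.le, inv_pow, ← div_eq_mul_inv, le_div_iff₀ (by positivity)]
  exact h3

/-- The increments from the dyadic floors to `t` tend to `0` in `p`-th moment, so Fatou identifies
the limit with `X t`. -/
theorem MomentCondition.ae_eq_of_tendsto (hX : ∀ t, AEStronglyMeasurable (X t) P) {N : ℕ}
    {δ : ℝ} (hδ : 0 < δ) (h : MomentCondition X P N δ) {t : ℝ≥0} (ht : t ≤ N) {Z : Ω → E}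
    (hZ : ∀ᵐ ω ∂P, Tendsto (fun k => X (dyadicFloor k t) ω) atTop (𝓝 (Z ω))) :
    ∀ᵐ ω ∂P, Z ω = X t ω := by
  obtain ⟨p, hp, ε, hε, C, hC, hmom⟩ := h
  have hZm : AEStronglyMeasurable Z P := aestronglyMeasurable_of_tendsto_ae atTop (fun k => hX _) hZ
  have h1 : ∫⁻ ω, ‖X t ω - Z ω‖ₑ ^ p ∂P
      ≤ liminf (fun k => ∫⁻ ω, ‖X t ω - X (dyadicFloor k t) ω‖ₑ ^ p ∂P) atTop := by
    refine (lintegral_mono_ae ?_).trans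
      (lintegral_liminf_le' fun k => ((hX t).sub (hX _)).enorm.pow_const p)
    filter_upwards [hZ] with ω hω
    exact ((ENNReal.Tendsto.pow (tendsto_const_nhds.sub hω).enorm).liminf_eq).ge
  have h2 : Tendsto (fun k => ∫⁻ ω, ‖X t ω - X (dyadicFloor k t) ω‖ₑ ^ p ∂P) atTop (𝓝 0) := by
    have h3 : Tendsto (fun k : ℕ => ENNReal.ofReal (C * (((1 : ℝ) / 2) ^ k) ^ (1 + ε + p * δ)))
        atTop (𝓝 0) := by
      rw [← ENNReal.ofReal_zero]
      refine ENNReal.tendsto_ofReal ?_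
      have h4 := (tendsto_pow_atTop_nhds_zero_of_lt_one (r := (1 : ℝ) / 2) (by norm_num)
        (by norm_num)).rpow_const (p := 1 + ε + p * δ) (Or.inr (by positivity))
      rw [Real.zero_rpow (by positivity)] at h4
      simpa using h4.const_mul C
    refine tendsto_of_tendsto_of_tendsto_of_le_of_le tendsto_const_nhds h3
      (fun _ => zero_le) fun k => (hmom _ t (dyadicFloor_le k t) ht).trans ?_
    refine ENNReal.ofReal_le_ofReal ?_
    have h5 : (0 : ℝ) ≤ (t : ℝ) - dyadicFloor k t :=
      sub_nonneg.2 (by exact_mod_cast dyadicFloor_le k t)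
    gcongr
    exact sub_dyadicFloor_le k t
  have hm : AEMeasurable (fun ω => ‖X t ω - Z ω‖ₑ ^ p) P :=
    ((hX t).sub hZm).enorm.pow_const p
  rw [h2.liminf_eq, nonpos_iff_eq_zero, lintegral_eq_zero_iff' hm] at h1
  filter_upwards [h1] with ω hω
  have := pow_eq_zero_iff hp |>.1 hω
  rw [enorm_eq_zero, sub_eq_zero] at this
  exact this.symm

/-- One limit along dyadic floors serves every exponent; a sequence of exponents increasing to `δ₀`
leaves only countably many null sets. -/
theorem exists_holder_modification [CompleteSpace E] (hX : ∀ t, AEStronglyMeasurable (X t) P)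
    {δ₀ : ℝ} (hδ₀ : 0 < δ₀)
    (h : ∀ δ : ℝ, 0 < δ → δ < δ₀ → ∀ N : ℕ, MomentCondition X P N δ) :
    ∃ Y : ℝ≥0 → Ω → E, (∀ t, ∀ᵐ ω ∂P, Y t ω = X t ω) ∧
      ∀ᵐ ω ∂P, ∀ δ : ℝ≥0, (δ : ℝ) < δ₀ → ∀ T : ℝ≥0,
        ∃ C : ℝ≥0, HolderOnWith C δ (fun t => Y t ω) (Icc 0 T) := by
  obtain ⟨u, -, hu, hulim⟩ := exists_seq_strictMono_tendsto' hδ₀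
  have hall : ∀ᵐ ω ∂P, ∀ n N : ℕ, ∃ M : ℝ, 0 ≤ M ∧
      DyadicIncrementsLE (fun t => X t ω) N (u n) M :=
    ae_all_iff.2 fun n => ae_all_iff.2 fun N =>
      (h (u n) (hu n).1 (hu n).2 N).ae_dyadicIncrementsLE hX
  -- Where the dyadic values do not converge, which happens only on a null set, the value of
  -- `limUnder` is arbitrary.
  let Y : ℝ≥0 → Ω → E := fun t ω => limUnder atTop fun k => X (dyadicFloor k t) ω
  have hlim : ∀ᵐ ω ∂P, ∀ t, Tendsto (fun k => X (dyadicFloor k t) ω) atTop (𝓝 (Y t ω)) := by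
    filter_upwards [hall] with ω hω t
    obtain ⟨N, hN⟩ := exists_nat_ge t
    obtain ⟨M, hM, hd⟩ := hω 0 N
    exact tendsto_nhds_limUnder (hd.exists_tendsto hM (hu 0).1 hN)
  refine ⟨Y, fun t => ?_, ?_⟩
  · obtain ⟨N, hN⟩ := exists_nat_ge t
    exact (h (u 0) (hu 0).1 (hu 0).2 N).ae_eq_of_tendsto hX (hu 0).1 hN
      (hlim.mono fun ω hω => hω t)
  · filter_upwards [hall, hlim] with ω hω hωlim δ hδ T
    obtain ⟨n, hn⟩ := ((tendsto_order.1 hulim).1 _ hδ).exists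
    obtain ⟨N, hN⟩ := exists_nat_ge T
    obtain ⟨M, hM, hd⟩ := hω n N
    obtain ⟨C, hC⟩ := hd.exists_holderOnWith hM (hu n).1 (y := fun t => Y t ω)
      fun t _ => hωlim t
    refine ⟨_, ((hC.mono (Icc_subset_Icc_right hN)).of_le (D := T) (fun x hx y hy => ?_)
      (NNReal.le_toNNReal_of_coe_le hn.le))⟩
    rw [edist_nndist, ENNReal.coe_le_coe, NNReal.nndist_eq]
    exact max_le (tsub_le_self.trans hx.2) (tsub_le_self.trans hy.2)

end Kolmogorov

/-! ### Convolution with singular kernels: `L²` increments and step approximation. -/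

section Kernel

theorem lintegral_Ioc_sub_rpow {a s t : ℝ} (ha : a < 1) (hst : s ≤ t) :
    ∫⁻ r in Ioc s t, ENNReal.ofReal ((t - r) ^ (-a))
      = ENNReal.ofReal ((t - s) ^ (1 - a) / (1 - a)) := by
  have hi : IntervalIntegrable (fun r : ℝ => (t - r) ^ (-a)) volume s t := by
    have := (intervalIntegral.intervalIntegrable_rpow' (a := 0) (b := t - s) (r := -a)
      (by linarith)).comp_sub_left t
    simpa using this.symm
  rw [← ofReal_integral_eq_lintegral_ofReal hi.1 ((ae_restrict_iff' measurableSet_Ioc).2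
    (Eventually.of_forall fun r hr => Real.rpow_nonneg (sub_nonneg.2 hr.2) _)),
    ← intervalIntegral.integral_of_le hst,
    intervalIntegral.integral_comp_sub_left (fun x => x ^ (-a)) t, sub_self,
    integral_rpow (Or.inl (by linarith)), Real.zero_rpow (by linarith), sub_zero,
    neg_add_eq_sub]

variable {K : Type*} [NormedAddCommGroup K] [InnerProductSpace ℝ K] [CompleteSpace K]
  {F : Type*} [NormedAddCommGroup F] [NormedSpace ℝ F]

/-- An operator-valued kernel on `(0, ∞)` with singularity `u ^ (-r)` at `0`, up to an arbitrarily
small loss in the exponent. -/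
structure IsSingularKernel {E : Type*} [NormedAddCommGroup E] [NormedSpace ℝ E]
    (G : ℝ → F →L[ℝ] E) (r : ℝ) : Prop where
  cont : ContinuousOn G (Ioi 0)
  bound : ∀ q : ℝ, r < q → q < 1 / 2 → ∀ R : ℝ, ∃ C : ℝ, 0 ≤ C ∧ ∀ u : ℝ, 0 < u → u ≤ R →
    ‖G u‖ ≤ C * u ^ (-q)
  holder : ∀ q θ : ℝ, r < q → q < 1 / 2 → 0 ≤ θ → θ ≤ 1 → ∀ R : ℝ, ∃ C : ℝ, 0 ≤ C ∧
    ∀ u h : ℝ, 0 < u → 0 ≤ h → h + u ≤ R → ‖G (h + u) - G u‖ ≤ C * (h ^ θ * u ^ (-q - θ))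

/-- The integrand `r ↦ 1_{(0,t]}(r) G(t - r) V` of a stochastic convolution. -/
def convIntegrand {E : Type*} [NormedAddCommGroup E] [NormedSpace ℝ E] (G : ℝ → F →L[ℝ] E)
    (V : K →L[ℝ] F) (t : ℝ≥0) : ℝ → K →L[ℝ] E :=
  (Ioc (0 : ℝ) t).indicator fun r => (G (t - r)).comp V

theorem enorm_sq_le_ofReal {E : Type*} [SeminormedAddGroup E] {x : E} {b : ℝ} (h : ‖x‖ ≤ b) :
    ‖x‖ₑ ^ 2 ≤ ENNReal.ofReal (b ^ 2) := by
  rw [enorm_sq_eq_ofReal]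
  exact ENNReal.ofReal_le_ofReal (by gcongr)

namespace IsSingularKernel

variable {E : Type*} [NormedAddCommGroup E] [NormedSpace ℝ E] {G : ℝ → F →L[ℝ] E} {r : ℝ}
  {V : K →L[ℝ] F}

omit [CompleteSpace K] in
theorem aestronglyMeasurable (hG : IsSingularKernel G r) (V : K →L[ℝ] F) (t : ℝ≥0) (k : K) :
    AEStronglyMeasurable (fun s => convIntegrand G V t s k) (volume.restrict (Ioi (0 : ℝ))) := by
  have e : (fun s => convIntegrand G V t s k)
      = (Ioc (0 : ℝ) t).indicator fun s => G (t - s) (V k) := by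
    ext s
    by_cases h : s ∈ Ioc (0 : ℝ) t <;> simp [convIntegrand, h]
  rw [e]
  refine AEStronglyMeasurable.restrict ?_
  rw [aestronglyMeasurable_indicator_iff measurableSet_Ioc, ← restrict_Ioo_eq_restrict_Ioc]
  refine ContinuousOn.aestronglyMeasurable ?_ measurableSet_Ioo
  have h1 : ContinuousOn (fun s : ℝ => G (t - s)) (Ioo 0 t) :=
    hG.cont.comp (by fun_prop) fun s hs => sub_pos.2 hs.2
  exact h1.clm_apply continuousOn_const

/-- On `(0, s]` the Hölder bound gives `(t - s)^{2θ}` times the integral of `(s - u)^{-2(q+θ)}`,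
finite since `q + θ < 1/2`. On `(s, t]` only one kernel remains and contributes a multiple of `(t -
s)^{1-2q}`, which is of higher order because `2θ < 1 - 2q`. -/
theorem exists_lintegral_sub_le (hG : IsSingularKernel G r) (hr : 0 ≤ r) {θ : ℝ} (hθ0 : 0 < θ)
    (hθ : θ < 1 / 2 - r) (R : ℝ≥0) (V : K →L[ℝ] F) :
    ∃ C : ℝ, 0 ≤ C ∧ ∀ s t : ℝ≥0, s ≤ t → t ≤ R →
      ∫⁻ u in Ioi (0 : ℝ), hsNormSq (convIntegrand G V t u - convIntegrand G V s u)
        ≤ hsNormSq V * ENNReal.ofReal (C * ((t : ℝ) - s) ^ (2 * θ)) := by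
  -- Take `q` midway between `r` and `1/2 - θ`.
  obtain ⟨q, hq, hq2⟩ : ∃ q, r < q ∧ q + θ < 1 / 2 :=
    ⟨r + (1 / 2 - r - θ) / 2, by linarith, by linarith⟩
  obtain ⟨C₁, hC₁, h₁⟩ := hG.bound q hq (by linarith) R
  obtain ⟨C₂, hC₂, h₂⟩ := hG.holder q θ hq (by linarith) hθ0.le (by linarith) R
  have ha : 2 * (q + θ) < 1 := by linarith
  have hb : 2 * q < 1 := by linarith
  refine ⟨C₂ ^ 2 * ((R : ℝ) ^ (1 - 2 * (q + θ)) / (1 - 2 * (q + θ)))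
    + C₁ ^ 2 * ((R : ℝ) ^ (1 - 2 * q - 2 * θ) / (1 - 2 * q)), ?_, fun s t hst ht => ?_⟩
  · have : 0 ≤ 1 - 2 * (q + θ) := by linarith
    have : 0 ≤ 1 - 2 * q := by linarith
    positivity
  have hst' : (s : ℝ) ≤ t := by exact_mod_cast hst
  have ht' : (t : ℝ) ≤ R := by exact_mod_cast ht
  have hts : (0 : ℝ) ≤ (t : ℝ) - s := sub_nonneg.2 hst'
  have hs0 := s.coe_nonneg
  set f₁ : ℝ → ℝ≥0∞ := fun u => hsNormSq V * (ENNReal.ofReal (C₂ ^ 2 * ((t : ℝ) - s) ^ (2 * θ))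
    * ENNReal.ofReal (((s : ℝ) - u) ^ (-(2 * (q + θ))))) with hf₁
  set f₂ : ℝ → ℝ≥0∞ := fun u => hsNormSq V * (ENNReal.ofReal (C₁ ^ 2)
    * ENNReal.ofReal (((t : ℝ) - u) ^ (-(2 * q)))) with hf₂
  have hsq {x a : ℝ} (hx : 0 < x) : (x ^ (-a)) ^ 2 = x ^ (-(2 * a)) := by
    rw [← Real.rpow_natCast, ← Real.rpow_mul hx.le]
    congr 1; push_cast; ring
  have hpt : ∀ᵐ u : ℝ, hsNormSq (convIntegrand G V t u - convIntegrand G V s u)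
      ≤ (Ioc (0 : ℝ) s).indicator f₁ u + (Ioc (s : ℝ) t).indicator f₂ u := by
    -- At `u = s` and `u = t` a kernel is evaluated at `0`, where nothing is known about it.
    filter_upwards [Measure.ae_ne volume (s : ℝ), Measure.ae_ne volume (t : ℝ)] with u hus hut
    by_cases h1 : u ∈ Ioc (0 : ℝ) s
    · have hu : 0 < (s : ℝ) - u := sub_pos.2 (lt_of_le_of_ne h1.2 hus)
      have hm : u ∈ Ioc (0 : ℝ) t := ⟨h1.1, h1.2.trans hst'⟩
      rw [convIntegrand, convIntegrand, indicator_of_mem h1, indicator_of_mem h1,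
        indicator_of_mem hm,
        ← ContinuousLinearMap.sub_comp]
      refine (hsNormSq_comp_le _ _).trans (le_trans ?_ le_self_add)
      rw [hf₁, mul_comm]
      simp only
      gcongr
      rw [← ENNReal.ofReal_mul (by positivity)]
      have h3 := h₂ (s - u) (t - s) hu hts (by linarith [h1.1])
      rw [sub_add_sub_cancel] at h3
      refine (enorm_sq_le_ofReal h3).trans_eq ?_
      congr 1
      rw [show -q - θ = -(q + θ) by ring, mul_pow, mul_pow, hsq hu, ← Real.rpow_natCast _ 2,
        ← Real.rpow_natCast _ 2, ← Real.rpow_mul hts, mul_comm θ]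
      push_cast
      ring
    · by_cases h2 : u ∈ Ioc (s : ℝ) t
      · have hu : 0 < (t : ℝ) - u := sub_pos.2 (lt_of_le_of_ne h2.2 hut)
        have hm : u ∈ Ioc (0 : ℝ) t := ⟨hs0.trans_lt h2.1, h2.2⟩
        rw [convIntegrand, convIntegrand, indicator_of_notMem h1, indicator_of_notMem h1,
          indicator_of_mem h2, zero_add, sub_zero, indicator_of_mem hm]
        refine (hsNormSq_comp_le _ _).trans ?_
        rw [hf₂, mul_comm]
        simp only
        gcongr
        rw [← ENNReal.ofReal_mul (by positivity)]
        have h3 := h₁ (t - u) hu (by linarith [h2.1])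
        refine (enorm_sq_le_ofReal h3).trans_eq ?_
        rw [mul_pow, hsq hu]
      · have h3 : u ∉ Ioc (0 : ℝ) t := fun h => by
          rcases le_or_gt u s with h4 | h4
          · exact h1 ⟨h.1, h4⟩
          · exact h2 ⟨h4, h.2⟩
        rw [convIntegrand, convIntegrand, indicator_of_notMem h1, indicator_of_notMem h3,
          sub_zero, hsNormSq_zero]
        exact zero_le
  have hmeas (x a : ℝ) : Measurable fun u : ℝ => ENNReal.ofReal ((x - u) ^ a) := by fun_prop
  have hm₁ : Measurable f₁ := ((hmeas _ _).const_mul _).const_mul _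
  have i₁ : ∫⁻ u in Ioc (0 : ℝ) s, f₁ u = hsNormSq V
      * ENNReal.ofReal (C₂ ^ 2 * ((t : ℝ) - s) ^ (2 * θ)
        * ((s : ℝ) ^ (1 - 2 * (q + θ)) / (1 - 2 * (q + θ)))) := by
    rw [hf₁, lintegral_const_mul _ ((hmeas _ _).const_mul _), lintegral_const_mul _ (hmeas _ _),
      lintegral_Ioc_sub_rpow ha hs0, sub_zero, ← ENNReal.ofReal_mul (by positivity)]
  have i₂ : ∫⁻ u in Ioc (s : ℝ) t, f₂ u = hsNormSq V
      * ENNReal.ofReal (C₁ ^ 2 * (((t : ℝ) - s) ^ (1 - 2 * q) / (1 - 2 * q))) := by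
    rw [hf₂, lintegral_const_mul _ ((hmeas _ _).const_mul _), lintegral_const_mul _ (hmeas _ _),
      lintegral_Ioc_sub_rpow hb hst', ← ENNReal.ofReal_mul (by positivity)]
  have hd : 0 < 1 - 2 * (q + θ) := by linarith
  have hd' : 0 < 1 - 2 * q := by linarith
  calc _ ≤ ∫⁻ u : ℝ, hsNormSq (convIntegrand G V t u - convIntegrand G V s u) :=
        setLIntegral_le_lintegral _ _
    _ ≤ ∫⁻ u : ℝ, ((Ioc (0 : ℝ) s).indicator f₁ u + (Ioc (s : ℝ) t).indicator f₂ u) :=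
        lintegral_mono_ae hpt
    _ = hsNormSq V * (ENNReal.ofReal (C₂ ^ 2 * ((t : ℝ) - s) ^ (2 * θ)
        * ((s : ℝ) ^ (1 - 2 * (q + θ)) / (1 - 2 * (q + θ))))
        + ENNReal.ofReal (C₁ ^ 2 * (((t : ℝ) - s) ^ (1 - 2 * q) / (1 - 2 * q)))) := by
      rw [lintegral_add_left (hm₁.indicator measurableSet_Ioc),
        lintegral_indicator measurableSet_Ioc, lintegral_indicator measurableSet_Ioc, i₁, i₂]
      exact (mul_add _ _ _).symm
    _ ≤ _ := by
      rw [← ENNReal.ofReal_add (by positivity) (by positivity)]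
      gcongr
      have e1 : ((t : ℝ) - s) ^ (1 - 2 * q)
          ≤ ((t : ℝ) - s) ^ (2 * θ) * (R : ℝ) ^ (1 - 2 * q - 2 * θ) := by
        rcases hts.eq_or_lt with h0 | h0
        · rw [← h0, Real.zero_rpow hd'.ne']
          positivity
        · rw [show 1 - 2 * q = 2 * θ + (1 - 2 * q - 2 * θ) by ring, Real.rpow_add h0,
            add_sub_cancel_left]
          gcongr <;> linarith
      have e2 : (s : ℝ) ^ (1 - 2 * (q + θ)) ≤ (R : ℝ) ^ (1 - 2 * (q + θ)) := by
        gcongr; linarith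
      calc _ ≤ C₂ ^ 2 * ((t : ℝ) - s) ^ (2 * θ)
            * ((R : ℝ) ^ (1 - 2 * (q + θ)) / (1 - 2 * (q + θ)))
            + C₁ ^ 2 * ((((t : ℝ) - s) ^ (2 * θ) * (R : ℝ) ^ (1 - 2 * q - 2 * θ))
              / (1 - 2 * q)) := by gcongr
        _ = _ := by ring

end IsSingularKernel

section Approximation

variable {K' : Type*} [NormedAddCommGroup K'] [InnerProductSpace ℝ K']
  {E : Type*} [NormedAddCommGroup E] [NormedSpace ℝ E]

/-- The step function on `(0, t]` with `N` steps of equal length, which takes on each step the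
value of `A` at the left endpoint. -/
def StepFn.uniform (A : ℝ → K' →L[ℝ] E) (t : ℝ≥0) (N : ℕ) : StepFn K' E where
  card := N
  left i := t * i / N
  right i := t * (i + 1) / N
  le i := by gcongr; simp
  op i := A (t * i / N)

omit [CompleteSpace K] in
theorem StepFn.uniform_toFun_of_notMem (A : ℝ → K' →L[ℝ] E) (t : ℝ≥0) (N : ℕ) (ι : K →L[ℝ] K')
    {u : ℝ} (hu : u ∉ Ioc (0 : ℝ) t) : (StepFn.uniform A t N).toFun ι u = 0 := by
  refine Finset.sum_eq_zero fun i _ => indicator_of_notMem (fun h => hu ?_) _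
  have hi : ((i : Fin N) : ℕ) + 1 ≤ N := i.2
  have hN : (0 : ℝ) < N := by
    have : 0 < N := by omega
    exact_mod_cast this
  refine ⟨lt_of_le_of_lt ((StepFn.uniform A t N).left i).coe_nonneg h.1, h.2.trans ?_⟩
  simp only [StepFn.uniform]
  push_cast
  rw [div_le_iff₀ hN]
  gcongr
  exact_mod_cast hi

omit [CompleteSpace K] in
theorem StepFn.exists_uniform_toFun_eq (A : ℝ → K' →L[ℝ] E) (t : ℝ≥0) {N : ℕ} (hN : N ≠ 0)
    (ι : K →L[ℝ] K') {u : ℝ} (hu : u ∈ Ioc (0 : ℝ) t) :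
    ∃ l : ℝ, 0 ≤ l ∧ l ≤ u ∧ u - l ≤ t / N ∧
      (StepFn.uniform A t N).toFun ι u = (A l).comp ι := by
  have hN0 : (0 : ℝ) < N := by exact_mod_cast Nat.pos_of_ne_zero hN
  have ht : (0 : ℝ) < t := hu.1.trans_le hu.2
  set x := u * N / t with hx
  have hx0 : 0 < x := div_pos (mul_pos hu.1 hN0) ht
  have hxN : x ≤ N := by
    rw [hx, div_le_iff₀ ht, mul_comm]
    exact mul_le_mul_of_nonneg_left hu.2 hN0.le
  have hm1 : 0 < ⌈x⌉₊ := Nat.ceil_pos.2 hx0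
  have hmN : ⌈x⌉₊ ≤ N := Nat.ceil_le.2 hxN
  -- The intervals are open on the left and closed on the right, so the index of the one containing
  -- `u` is `⌈u N / t⌉ - 1`.
  obtain ⟨i, hi⟩ : ∃ i : ℕ, ⌈x⌉₊ = i + 1 := ⟨⌈x⌉₊ - 1, by omega⟩
  have hix : (i : ℝ) < x := by
    have := Nat.lt_ceil.1 (show i < ⌈x⌉₊ by omega)
    exact this
  have hxi : x ≤ (i : ℝ) + 1 := by
    have := Nat.le_ceil x
    rw [hi] at this
    exact_mod_cast this
  have hmem (j : ℕ) : u ∈ Ioc (t * j / N : ℝ) (t * (j + 1) / N) ↔ (j : ℝ) < x ∧ x ≤ j + 1 := by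
    rw [mem_Ioc, hx, div_lt_iff₀ hN0, le_div_iff₀ hN0, lt_div_iff₀ ht, div_le_iff₀ ht]
    simp only [mul_comm]
  have hi2 := (hmem i).2 ⟨hix, hxi⟩
  refine ⟨t * i / N, by positivity, hi2.1.le, ?_, ?_⟩
  · have := hi2.2
    rw [mul_add, add_div, mul_one] at this
    linarith
  · have hiN : i < N := by omega
    have hcoe (j : Fin N) : Ioc (((StepFn.uniform A t N).left j : ℝ≥0) : ℝ)
        ((StepFn.uniform A t N).right j) = Ioc (t * (j : ℕ) / N : ℝ) (t * ((j : ℕ) + 1) / N) := by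
      simp [StepFn.uniform]
    refine (Finset.sum_eq_single (⟨i, hiN⟩ : Fin N) (fun j _ hj => ?_) fun h =>
      absurd (Finset.mem_univ _) h).trans ?_
    · refine indicator_of_notMem (fun h => hj ?_) _
      rw [hcoe, hmem] at h
      have h1 : ((j : ℕ) : ℝ) < i + 1 := h.1.trans_le hxi
      have h2 : (i : ℝ) < (j : ℕ) + 1 := hix.trans_le h.2
      have h1' : (j : ℕ) < i + 1 := by exact_mod_cast h1
      have h2' : i < (j : ℕ) + 1 := by exact_mod_cast h2
      exact Fin.ext (by simp only; omega)
    · rw [indicator_of_mem]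
      · rfl
      · rw [hcoe]; exact hi2

/-- Freeze `G(t - ·)` at the left endpoint `l` of each step and replace `V` by `B n ∘ ι`. Since `l ≤
u`, the frozen kernel is evaluated further from the singularity, and `(t - l)^{-q} ≤ (t - u)^{-q}`
gives an integrable majorant that does not depend on the step size. The error splits into a Hölder
term of order `(t / (n + 1))^{2θ}` and the approximation error of `V`. -/
theorem IsSingularKernel.exists_stepFn {G : ℝ → F →L[ℝ] E} {r : ℝ} {V : K →L[ℝ] F}
    (hG : IsSingularKernel G r) (hr : 0 ≤ r) (hr2 : r < 1 / 2) [CompleteSpace K']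
    {ι : K →L[ℝ] K'} (hι : Function.Injective ι) (hV : hsNormSq V < ∞) (t : ℝ≥0) :
    ∃ S : ℕ → StepFn K' E,
      Tendsto (fun n => ∫⁻ u in Ioi (0 : ℝ), hsNormSq (convIntegrand G V t u - (S n).toFun ι u))
        atTop (𝓝 0) ∧
      ∀ n, ∫⁻ u in Ioi (0 : ℝ), hsNormSq (convIntegrand G V t u - (S n).toFun ι u) < ∞ := by
  obtain ⟨q, hq, hq2⟩ : ∃ q, r < q ∧ q < 1 / 2 := exists_between hr2
  obtain ⟨θ, hθ0, hθ⟩ : ∃ θ, 0 < θ ∧ θ < 1 / 2 - q := exists_between (by linarith)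
  obtain ⟨C₁, hC₁, h₁⟩ := hG.bound q hq hq2 t
  obtain ⟨C₂, hC₂, h₂⟩ := hG.holder q θ hq hq2 hθ0.le (by linarith) t
  have ha : 2 * (q + θ) < 1 := by linarith
  have hb : 2 * q < 1 := by linarith
  have hε (n : ℕ) : (0 : ℝ≥0∞) < ((n + 1 : ℕ) : ℝ≥0∞)⁻¹ := by simp
  choose B hB using fun n => exists_hsNormSq_sub_comp_lt hι hV (hε n)
  let S : ℕ → StepFn K' E := fun n => StepFn.uniform (fun l => (G (t - l)).comp (B n)) t (n + 1)
  have ht0 := t.coe_nonneg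
  let J₁ : ℝ≥0∞ := ENNReal.ofReal (((t : ℝ) - 0) ^ (1 - 2 * (q + θ)) / (1 - 2 * (q + θ)))
  let J₂ : ℝ≥0∞ := ENNReal.ofReal (((t : ℝ) - 0) ^ (1 - 2 * q) / (1 - 2 * q))
  let c : ℕ → ℝ := fun n => C₂ ^ 2 * ((t : ℝ) / (n + 1 : ℕ)) ^ (2 * θ)
  let bnd : ℕ → ℝ≥0∞ := fun n => 4 * (hsNormSq V * (ENNReal.ofReal (c n) * J₁)
    + ((n + 1 : ℕ) : ℝ≥0∞)⁻¹ * (ENNReal.ofReal (C₁ ^ 2) * J₂))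
  have hsq {x a : ℝ} (hx : 0 < x) : (x ^ (-a)) ^ 2 = x ^ (-(2 * a)) := by
    rw [← Real.rpow_natCast, ← Real.rpow_mul hx.le]
    congr 1; push_cast; ring
  have hmeas (x a : ℝ) : Measurable fun u : ℝ => ENNReal.ofReal ((x - u) ^ a) := by fun_prop
  have hle (n : ℕ) : ∫⁻ u in Ioi (0 : ℝ), hsNormSq (convIntegrand G V t u - (S n).toFun ι u)
      ≤ bnd n := by
    set f : ℝ → ℝ≥0∞ := fun u => 4 * (hsNormSq V
      * (ENNReal.ofReal (c n) * ENNReal.ofReal (((t : ℝ) - u) ^ (-(2 * (q + θ)))))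
      + ((n + 1 : ℕ) : ℝ≥0∞)⁻¹
        * (ENNReal.ofReal (C₁ ^ 2) * ENNReal.ofReal (((t : ℝ) - u) ^ (-(2 * q))))) with hf
    have hpt : ∀ᵐ u : ℝ, hsNormSq (convIntegrand G V t u - (S n).toFun ι u)
        ≤ (Ioc (0 : ℝ) t).indicator f u := by
      filter_upwards [Measure.ae_ne volume (t : ℝ)] with u hut
      by_cases hu : u ∈ Ioc (0 : ℝ) t
      · have hu0 : 0 < (t : ℝ) - u := sub_pos.2 (lt_of_le_of_ne hu.2 hut)
        obtain ⟨l, hl0, hlu, hul, hS⟩ := StepFn.exists_uniform_toFun_eq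
          (fun l => (G (t - l)).comp (B n)) t n.succ_ne_zero ι hu
        rw [indicator_of_mem hu, convIntegrand, indicator_of_mem hu, hS]
        have e : (G (t - u)).comp V - ((G (t - l)).comp (B n)).comp ι
            = (G (t - u) - G (t - l)).comp V + (G (t - l)).comp (V - (B n).comp ι) := by
          rw [ContinuousLinearMap.sub_comp, ContinuousLinearMap.comp_sub,
            ContinuousLinearMap.comp_assoc]
          abel
        rw [e]
        refine (hsNormSq_add_le _ _).trans ?_
        rw [hf]
        simp only
        gcongr
        · refine (hsNormSq_comp_le _ _).trans ?_
          rw [mul_comm]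
          gcongr
          rw [← ENNReal.ofReal_mul (by positivity)]
          have h3 := h₂ (t - u) (u - l) hu0 (by linarith) (by linarith)
          rw [show u - l + (t - u) = t - l by ring, norm_sub_rev] at h3
          refine (enorm_sq_le_ofReal h3).trans (ENNReal.ofReal_le_ofReal ?_)
          have hul0 : 0 ≤ u - l := by linarith
          rw [show -q - θ = -(q + θ) by ring, mul_pow, mul_pow, hsq hu0,
            ← Real.rpow_natCast (_ ^ θ) 2, ← Real.rpow_mul hul0, ← mul_assoc]
          simp only [c]
          gcongr
          rw [mul_comm θ]
          push_cast
          refine Real.rpow_le_rpow hul0 ?_ (by positivity)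
          exact_mod_cast hul
        · refine (hsNormSq_comp_le _ _).trans ?_
          rw [mul_comm]
          gcongr
          · exact (hB n).le
          · rw [← ENNReal.ofReal_mul (by positivity)]
            have h3 := h₁ (t - l) (by linarith) (by linarith)
            have h4 : ((t : ℝ) - l) ^ (-q) ≤ ((t : ℝ) - u) ^ (-q) :=
              Real.rpow_le_rpow_of_nonpos hu0 (by linarith) (by linarith)
            refine (enorm_sq_le_ofReal (h3.trans
              (mul_le_mul_of_nonneg_left h4 hC₁))).trans_eq ?_
            rw [mul_pow, hsq hu0]
      · rw [indicator_of_notMem hu, convIntegrand, indicator_of_notMem hu,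
          StepFn.uniform_toFun_of_notMem _ _ _ _ hu, sub_zero, hsNormSq_zero]
    calc _ ≤ ∫⁻ u : ℝ, hsNormSq (convIntegrand G V t u - (S n).toFun ι u) :=
          setLIntegral_le_lintegral _ _
      _ ≤ ∫⁻ u : ℝ, (Ioc (0 : ℝ) t).indicator f u := lintegral_mono_ae hpt
      _ = bnd n := by
        rw [lintegral_indicator measurableSet_Ioc, hf, lintegral_const_mul _ (by fun_prop),
          lintegral_add_left (by fun_prop), lintegral_const_mul _ (by fun_prop),
          lintegral_const_mul _ (hmeas _ _), lintegral_const_mul _ (by fun_prop),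
          lintegral_const_mul _ (hmeas _ _), lintegral_Ioc_sub_rpow ha ht0,
          lintegral_Ioc_sub_rpow hb ht0]
  refine ⟨S, tendsto_of_tendsto_of_tendsto_of_le_of_le tendsto_const_nhds ?_
    (fun _ => zero_le) hle, fun n => (hle n).trans_lt ?_⟩
  · have hc : Tendsto c atTop (𝓝 0) := by
      have h1 : Tendsto (fun n : ℕ => (t : ℝ) / (n + 1 : ℕ)) atTop (𝓝 0) :=
        (tendsto_const_div_atTop_nhds_zero_nat (t : ℝ)).comp (tendsto_add_atTop_nat 1)
      have h2 := (h1.rpow_const (p := 2 * θ) (Or.inr (by positivity))).const_mul (C₂ ^ 2)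
      rwa [Real.zero_rpow (by positivity), mul_zero] at h2
    have hc' : Tendsto (fun n => ENNReal.ofReal (c n)) atTop (𝓝 0) := by
      rw [← ENNReal.ofReal_zero]; exact ENNReal.tendsto_ofReal hc
    have hn : Tendsto (fun n : ℕ => ((n + 1 : ℕ) : ℝ≥0∞)⁻¹) atTop (𝓝 0) :=
      ENNReal.tendsto_inv_nat_nhds_zero.comp (tendsto_add_atTop_nat 1)
    have h1 := ENNReal.Tendsto.const_mul (a := hsNormSq V)
      (ENNReal.Tendsto.mul_const (b := J₁) hc' (Or.inr ENNReal.ofReal_ne_top)) (Or.inr hV.ne)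
    have h2 := ENNReal.Tendsto.mul_const (b := ENNReal.ofReal (C₁ ^ 2) * J₂) hn
      (Or.inr (ENNReal.mul_ne_top ENNReal.ofReal_ne_top ENNReal.ofReal_ne_top))
    have h3 := ENNReal.Tendsto.const_mul (a := 4) (h1.add h2) (Or.inr (by simp))
    simp only [zero_mul, mul_zero, add_zero] at h3
    exact h3
  · refine ENNReal.mul_lt_top (by simp) (ENNReal.add_lt_top.2 ⟨?_, ?_⟩)
    · exact ENNReal.mul_lt_top hV (ENNReal.mul_lt_top ENNReal.ofReal_lt_top ENNReal.ofReal_lt_top)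
    · refine ENNReal.mul_lt_top ?_
        (ENNReal.mul_lt_top ENNReal.ofReal_lt_top ENNReal.ofReal_lt_top)
      simp

end Approximation

end Kernel

/-! ### Existence and Hölder regularity of stochastic convolutions. -/

section Convolution

variable {K : Type*} [NormedAddCommGroup K] [InnerProductSpace ℝ K] [CompleteSpace K]
  [TopologicalSpace.SeparableSpace K]
  {K' : Type*} [NormedAddCommGroup K'] [InnerProductSpace ℝ K'] [CompleteSpace K']
  [MeasurableSpace K'] [BorelSpace K'] [SecondCountableTopology K']
  {Ω : Type*} [MeasurableSpace Ω] {P : Measure Ω} [IsProbabilityMeasure P]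
  {ι : K →L[ℝ] K'} {W : ℝ≥0 → Ω → K'}
  {F : Type*} [NormedAddCommGroup F] [NormedSpace ℝ F]
  {E : Type*} [NormedAddCommGroup E] [InnerProductSpace ℝ E] [CompleteSpace E]
  [TopologicalSpace.SeparableSpace E]
  {G : ℝ → F →L[ℝ] E} {r : ℝ} {V : K →L[ℝ] F}

theorem IsSingularKernel.exists_isStochasticIntegral (hG : IsSingularKernel G r) (hr : 0 ≤ r)
    (hr2 : r < 1 / 2) (hV : hsNormSq V < ∞) (hW : IsCylindricalWiener ι W P) (t : ℝ≥0) :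
    ∃ I : Ω → E, IsStochasticIntegral ι W P (convIntegrand G V t) I := by
  obtain ⟨S, hS, hSfin⟩ := hG.exists_stepFn hr hr2 hW.injective hV t
  have hfin : ∫⁻ u in Ioi (0 : ℝ), hsNormSq (convIntegrand G V t u) < ∞ := by
    obtain ⟨θ, hθ0, hθ⟩ := exists_between (show (0 : ℝ) < 1 / 2 - r by linarith)
    obtain ⟨C, hC, h⟩ := hG.exists_lintegral_sub_le hr hθ0 hθ t V
    -- The integrand at time `0` vanishes, so the increment bound from `0` to `t` is a bound on the
    -- integrand itself.
    have := h 0 t zero_le le_rfl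
    simp only [convIntegrand, NNReal.coe_zero, Ioc_self, indicator_empty, sub_zero] at this
    exact this.trans_lt (ENNReal.mul_lt_top hV ENNReal.ofReal_lt_top)
  refine LinSPDE.exists_isStochasticIntegral hW (hG.aestronglyMeasurable V t) hS fun n => ?_
  have hle : ∫⁻ u in Ioi (0 : ℝ), hsNormSq ((S n).toFun ι u)
      ≤ 4 * ((∫⁻ u in Ioi (0 : ℝ), hsNormSq (convIntegrand G V t u))
        + ∫⁻ u in Ioi (0 : ℝ), hsNormSq (convIntegrand G V t u - (S n).toFun ι u)) := by
    rw [← lintegral_add_left' (aemeasurable_hsNormSq (hG.aestronglyMeasurable V t)),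
      ← lintegral_const_mul' _ _ (by simp)]
    refine lintegral_mono fun u => ?_
    conv_lhs => rw [← sub_sub_cancel (convIntegrand G V t u) ((S n).toFun ι u)]
    exact hsNormSq_sub_le _ _
  exact hle.trans_lt (ENNReal.mul_lt_top (by simp) (ENNReal.add_lt_top.2 ⟨hfin, hSfin n⟩))

/-- The moment of order `2 n` of an increment is of order `(t - s)^{2 n θ}` with `θ > δ`, and `2 n
(θ - δ) > 1` for `n` large; the excess over `1` serves as `ε`. -/
theorem IsSingularKernel.momentCondition (hG : IsSingularKernel G r) (hr : 0 ≤ r)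
    (hV : hsNormSq V < ∞) (hW : IsCylindricalWiener ι W P) {Z : ℝ≥0 → Ω → E}
    (hZ : ∀ t, IsStochasticIntegral ι W P (convIntegrand G V t) (Z t)) {δ : ℝ} (hδ0 : 0 < δ)
    (hδ : δ < 1 / 2 - r) (N : ℕ) : MomentCondition Z P N δ := by
  obtain ⟨θ, hδθ, hθ⟩ := exists_between hδ
  obtain ⟨n, hn⟩ := exists_nat_gt (1 / (2 * (θ - δ)))
  have hθδ : 0 < 2 * (θ - δ) := by linarith
  rw [div_lt_iff₀ hθδ] at hn
  have hn0 : n ≠ 0 := by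
    rintro rfl
    norm_num at hn
  obtain ⟨C, hC, h⟩ := hG.exists_lintegral_sub_le hr (hδ0.trans hδθ) hθ (N : ℝ≥0) V
  refine ⟨2 * n, by omega, n * (2 * (θ - δ)) - 1, by linarith,
    (gaussMoment n).toReal * (4 * ((hsNormSq V).toReal * C)) ^ n, by positivity,
    fun s t hst ht => ?_⟩
  have hst' : (0 : ℝ) ≤ (t : ℝ) - s := sub_nonneg.2 (by exact_mod_cast hst)
  have hsub := (hZ t).sub (fun S => S.aestronglyMeasurable_integral hW) (hZ s)
  refine (hsub.lintegral_pow_le hW hn0).trans ?_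
  have h1 := h s t hst ht
  calc _ ≤ gaussMoment n
        * (4 * (hsNormSq V * ENNReal.ofReal (C * ((t : ℝ) - s) ^ (2 * θ)))) ^ n := by gcongr
    _ = ENNReal.ofReal ((gaussMoment n).toReal
        * (4 * ((hsNormSq V).toReal * (C * ((t : ℝ) - s) ^ (2 * θ)))) ^ n) := by
      conv_rhs =>
        rw [ENNReal.ofReal_mul (by positivity),
          ENNReal.ofReal_toReal (gaussMoment_lt_top hn0).ne, ENNReal.ofReal_pow (by positivity),
          ENNReal.ofReal_mul (by positivity), ENNReal.ofReal_mul (by positivity),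
          ENNReal.ofReal_toReal hV.ne]
      norm_num
    _ = _ := by
      congr 1
      have e : ((t : ℝ) - s) ^ (1 + (n * (2 * (θ - δ)) - 1) + ((2 * n : ℕ) : ℝ) * δ)
          = (((t : ℝ) - s) ^ (2 * θ)) ^ n := by
        rw [← Real.rpow_natCast, ← Real.rpow_mul hst']
        congr 1; push_cast; ring
      rw [e]
      ring

/-- The stochastic convolution with a singular kernel has a Hölder continuous modification. -/
theorem IsSingularKernel.exists_holder_convolution (hG : IsSingularKernel G r) (hr : 0 ≤ r)
    (hr2 : r < 1 / 2) (hV : hsNormSq V < ∞) (hW : IsCylindricalWiener ι W P) :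
    ∃ Y : ℝ≥0 → Ω → E, (∀ t, IsStochasticIntegral ι W P (convIntegrand G V t) (Y t)) ∧
      ∀ᵐ ω ∂P, ∀ δ : ℝ≥0, (δ : ℝ) < 1 / 2 - r → ∀ T : ℝ≥0,
        ∃ C : ℝ≥0, HolderOnWith C δ (fun t => Y t ω) (Icc 0 T) := by
  choose Z hZ using hG.exists_isStochasticIntegral hr hr2 hV hW
  obtain ⟨Y, hYZ, hY⟩ := exists_holder_modification (fun t => (hZ t).2.1)
    (show (0 : ℝ) < 1 / 2 - r by linarith)
    fun δ h0 h1 N => hG.momentCondition hr hV hW hZ h0 h1 N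
  refine ⟨Y, fun t => ?_, hY⟩
  obtain ⟨h1, h2, S, h3, h4⟩ := hZ t
  refine ⟨h1, h2.congr ((hYZ t).mono fun ω hω => hω.symm), S, h3, h4.congr fun n => ?_⟩
  exact lintegral_congr_ae ((hYZ t).mono fun ω hω => by simp only [hω])

end Convolution

/-! ### The smoothing kernel `e^{lam u} A^r T(u)` as a singular kernel. -/

section SmoothingKernel

variable {H : Type*} [NormedAddCommGroup H] [NormedSpace ℂ H]

/-- The kernel `e^{lam u} A^r T(u)`, as a real-linear operator. -/
def smoothingKernel (T : ℝ → H →L[ℂ] H) (lam r u : ℝ) : H →L[ℝ] H :=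
  Real.exp (lam * u) • (smoothing T r u).restrictScalars ℝ

theorem smoothingKernel_apply (T : ℝ → H →L[ℂ] H) (lam r u : ℝ) (x : H) :
    smoothingKernel T lam r u x = Real.exp (lam * u) • smoothing T r u x := rfl

theorem abs_exp_sub_exp_le {a b c : ℝ} (ha : a ≤ c) (hb : b ≤ c) :
    |Real.exp b - Real.exp a| ≤ |b - a| * Real.exp c := by
  wlog hab : a ≤ b generalizing a b
  · rw [abs_sub_comm, abs_sub_comm b]
    exact this hb ha (not_le.1 hab).le
  rw [abs_of_nonneg (sub_nonneg.2 (Real.exp_le_exp.2 hab)), abs_of_nonneg (sub_nonneg.2 hab)]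
  have h1 := Real.add_one_le_exp (a - b)
  have h2 : Real.exp a = Real.exp (a - b) * Real.exp b := by rw [← Real.exp_add]; ring_nf
  calc Real.exp b - Real.exp a ≤ (b - a) * Real.exp b := by
        rw [h2]; nlinarith [Real.exp_pos b]
    _ ≤ (b - a) * Real.exp c :=
        mul_le_mul_of_nonneg_left (Real.exp_le_exp.2 hb) (sub_nonneg.2 hab)

/-- For `q > max r 0`, `A^r T(u)` is the bounded operator `A^{-(q-r)}` times `A^q T(u)`, so the
estimates for exponents in `(0, 1)` cover all `r`, including `r ≤ 0`. The small loss allowed in the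
exponent is what makes this uniform treatment possible. -/
theorem IsStableAnalytic.isSingularKernel_smoothingKernel [CompleteSpace H] {T : ℝ → H →L[ℂ] H}
    (hT : IsStableAnalytic T) (lam : ℝ) {r : ℝ} :
    IsSingularKernel (smoothingKernel T lam r) (max r 0) := by
  have hexp {R u : ℝ} (h0 : 0 < u) (hu : u ≤ R) : lam * u ≤ |lam| * R :=
    mul_le_mul (le_abs_self _) hu h0.le (abs_nonneg _)
  have hfac {q : ℝ} (hq : max r 0 < q) (hq2 : q < 1 / 2) (u : ℝ) :
      smoothing T r u = frac T (q - r) * smoothing T q u := by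
    rw [hT.frac_mul_smoothing (sub_nonneg.2 ((le_max_left _ _).trans hq.le)) (by linarith),
      sub_sub_cancel]
  refine ⟨?_, fun q hq hq2 R => ?_, fun q θ hq hq2 hθ0 hθ1 R => ?_⟩
  · have h1 : ContinuousOn (fun u => smoothing T r u) (Ioi 0) :=
      continuousOn_const.mul hT.continuousOn_negDeriv
    have h2 := (ContinuousLinearMap.restrictScalarsIsometry ℂ H H ℝ ℝ).continuous.comp_continuousOn
      h1
    have h3 : Continuous fun u : ℝ => Real.exp (lam * u) := by fun_prop
    exact h3.continuousOn.smul h2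
  · obtain ⟨C, hC, h⟩ := hT.exists_norm_smoothing_le ((le_max_right _ _).trans_lt hq)
      (by linarith)
    refine ⟨Real.exp (|lam| * R) * (‖frac T (q - r)‖ * C), by positivity, fun u hu huR => ?_⟩
    rw [smoothingKernel, norm_smul, ContinuousLinearMap.norm_restrictScalars, hfac hq hq2,
      Real.norm_of_nonneg (Real.exp_pos _).le, mul_assoc, mul_assoc]
    refine mul_le_mul (Real.exp_le_exp.2 (hexp hu huR)) ((norm_mul_le _ _).trans ?_)
      (norm_nonneg _) (Real.exp_pos _).le
    gcongr
    exact h u hu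
  · obtain ⟨C, hC, h⟩ := hT.exists_norm_smoothing_le ((le_max_right _ _).trans_lt hq)
      (by linarith)
    obtain ⟨C', hC', h'⟩ := hT.exists_norm_smoothing_sub_le ((le_max_right _ _).trans_lt hq)
      (by linarith) hθ0 hθ1
    refine ⟨Real.exp (|lam| * R) * ‖frac T (q - r)‖ * (C' + |lam| * C * |R|), by positivity,
      fun u v hu hv hR => ?_⟩
    have hR0 : 0 < R := by linarith
    have e : smoothingKernel T lam r (v + u) - smoothingKernel T lam r u
        = (Real.exp (lam * (v + u)) • (frac T (q - r) * (smoothing T q (v + u) - smoothing T q u))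
          + (Real.exp (lam * (v + u)) - Real.exp (lam * u))
            • (frac T (q - r) * smoothing T q u)).restrictScalars ℝ := by
      rw [mul_sub, ← hfac hq hq2, ← hfac hq hq2]
      ext x
      simp only [smoothingKernel_apply, sub_apply,
        ContinuousLinearMap.coe_restrictScalars', add_apply, smul_apply]
      module
    rw [e, ContinuousLinearMap.norm_restrictScalars]
    have hE : |Real.exp (lam * (v + u)) - Real.exp (lam * u)|
        ≤ |lam| * v * Real.exp (|lam| * R) := by
      refine (abs_exp_sub_exp_le (hexp hu (by linarith)) (hexp (by linarith) hR)).trans_eq ?_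
      rw [← mul_sub, add_sub_cancel_right, abs_mul, abs_of_nonneg hv]
    -- The exponential factor contributes a Lipschitz term, absorbed into the Hölder bound by
    -- `v^{1-θ} u^θ ≤ R`.
    have hvu : v * u ^ (-q) ≤ R * (v ^ θ * u ^ (-q - θ)) := by
      rcases hv.eq_or_lt with rfl | hv
      · rw [zero_mul]; positivity
      · have e1 : v = v ^ (1 - θ) * v ^ θ := by
          rw [← Real.rpow_add hv, sub_add_cancel, Real.rpow_one]
        have e2 : u ^ (-q) = u ^ θ * u ^ (-q - θ) := by
          rw [← Real.rpow_add hu]; ring_nf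
        have e3 : v ^ (1 - θ) * u ^ θ ≤ R := by
          calc _ ≤ R ^ (1 - θ) * R ^ θ := by gcongr <;> linarith
            _ = R := by rw [← Real.rpow_add hR0, sub_add_cancel, Real.rpow_one]
        calc v * u ^ (-q) = (v ^ (1 - θ) * u ^ θ) * (v ^ θ * u ^ (-q - θ)) := by
              rw [e2]; nth_rewrite 1 [e1]; ring
          _ ≤ _ := by gcongr
    refine (norm_add_le _ _).trans ?_
    rw [norm_smul, norm_smul, Real.norm_of_nonneg (Real.exp_pos _).le, Real.norm_eq_abs]
    calc _ ≤ Real.exp (|lam| * R) * (‖frac T (q - r)‖ * (C' * (v ^ θ * u ^ (-q - θ))))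
          + |lam| * v * Real.exp (|lam| * R) * (‖frac T (q - r)‖ * (C * u ^ (-q))) := by
          refine add_le_add (mul_le_mul (Real.exp_le_exp.2 (hexp (by linarith) hR))
            ((norm_mul_le _ _).trans ?_) (norm_nonneg _) (Real.exp_pos _).le)
            (mul_le_mul hE ((norm_mul_le _ _).trans ?_) (norm_nonneg _) (by positivity))
          · gcongr; exact h' u v hu hv
          · gcongr; exact h u hu
      _ = Real.exp (|lam| * R) * ‖frac T (q - r)‖ * (C' * (v ^ θ * u ^ (-q - θ))
          + |lam| * C * (v * u ^ (-q))) := by ring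
      _ ≤ Real.exp (|lam| * R) * ‖frac T (q - r)‖ * (C' * (v ^ θ * u ^ (-q - θ))
          + |lam| * C * (R * (v ^ θ * u ^ (-q - θ)))) := by gcongr
      _ = _ := by rw [abs_of_pos hR0]; ring

end SmoothingKernel

/-! ### Identification of the spaces `H_a` and `H_{-a}` with `H`. -/

section ScaleOfSpaces

variable {H : Type*} [NormedAddCommGroup H] [NormedSpace ℂ H] {S : ℝ → H →L[ℂ] H} {lam a : ℝ}

theorem mem_posPow_domain {x : H} : x ∈ (posPow S lam a).domain ↔ ∃ u, negPow S lam a u = x := by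
  rw [posPow, LinearPMap.inverse_domain]
  constructor
  · rintro ⟨u, rfl⟩
    exact ⟨u, rfl⟩
  · rintro ⟨u, rfl⟩
    exact ⟨⟨u, trivial⟩, rfl⟩

theorem Interp.pow_eq (hinj : Function.Injective (negPow S lam a)) {z : Interp S lam a} {u : H}
    (h : negPow S lam a u = incl z) : pow z = u := by
  refine LinearPMap.inverse_apply_eq
    (f := ((negPow S lam a : H →L[ℂ] H) : H →ₗ[ℂ] H).toPMap ⊤) (x := ⟨u, trivial⟩) ?_ h
  refine LinearMap.ker_eq_bot.2 fun x y hxy => Subtype.ext (hinj hxy)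

theorem Interp.exists_eq (hinj : Function.Injective (negPow S lam a)) (u : H) :
    ∃ z : Interp S lam a, incl z = negPow S lam a u ∧ pow z = u :=
  ⟨⟨negPow S lam a u, mem_posPow_domain.2 ⟨u, rfl⟩⟩, rfl, Interp.pow_eq hinj rfl⟩

theorem Interp.negPow_pow (hinj : Function.Injective (negPow S lam a)) (z : Interp S lam a) :
    negPow S lam a (pow z) = incl z := by
  obtain ⟨u, hu⟩ := mem_posPow_domain.1 z.2
  rw [Interp.pow_eq hinj (u := u) (z := z) hu]
  exact hu

/-- The norm being completed is the one that makes `A^{-a}` isometric, so `A^{-a}` extends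
isometrically to the completion. -/
theorem Extrap.exists_linearIsometry [CompleteSpace H] :
    ∃ J : Extrap S lam a →ₗᵢ[ℂ] H, ∀ x, J (Extrap.ofH S lam a x) = negPow S lam a x := by
  let f : PreExtrap S lam a →L[ℂ] H :=
    LinearMap.mkContinuous PreExtrap.pow 1 fun x => (one_mul ‖x‖).ge
  let J : UniformSpace.Completion (PreExtrap S lam a) →L[ℂ] H :=
    f.extend (UniformSpace.Completion.toComplL (𝕜 := ℂ) (E := PreExtrap S lam a))
  have hJ (x : PreExtrap S lam a) : J x = PreExtrap.pow x :=
    ContinuousLinearMap.extend_eq f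
      (e := UniformSpace.Completion.toComplL (𝕜 := ℂ) (E := PreExtrap S lam a)) UniformSpace.Completion.denseRange_coe
      (UniformSpace.Completion.isUniformInducing_coe (PreExtrap S lam a)) x
  refine ⟨⟨J.toLinearMap, fun z => ?_⟩, fun x => hJ (PreExtrap.ofH x)⟩
  refine UniformSpace.Completion.induction_on (p := fun z => ‖J z‖ = ‖z‖) z
    (isClosed_eq (by fun_prop) (by fun_prop)) fun x => ?_
  rw [hJ, UniformSpace.Completion.norm_coe]
  rfl

/-- An isometry from a complete space has closed range, so dense range makes it surjective. -/
theorem Extrap.exists_linearIsometryEquiv [CompleteSpace H] (h : DenseRange (negPow S lam a)) :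
    ∃ J : Extrap S lam a ≃ₗᵢ[ℂ] H, ∀ x, J (Extrap.ofH S lam a x) = negPow S lam a x := by
  obtain ⟨J, hJ⟩ := Extrap.exists_linearIsometry (S := S) (lam := lam) (a := a)
  have hd : DenseRange J := h.mono (by rintro _ ⟨x, rfl⟩; exact ⟨_, hJ x⟩)
  have hs : Function.Surjective J := by
    rw [← range_eq_univ, ← hd.closure_eq]
    exact (J.isometry.isClosedEmbedding.isClosed_range.closure_eq).symm
  exact ⟨LinearIsometryEquiv.ofSurjective J hs, hJ⟩

/-- Each `T t x` with `t > 0` lies in the range, and `T t x` tends to `x`. -/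
theorem IsStableAnalytic.denseRange_frac [CompleteSpace H] {T : ℝ → H →L[ℂ] H}
    (hT : IsStableAnalytic T) (ha : 0 ≤ a) : DenseRange (frac T a) := fun x => by
  obtain ⟨v, hv, -⟩ := hT.exists_frac_eq ha x
  refine mem_closure_of_tendsto (hT.tendsto x) ?_
  filter_upwards [self_mem_nhdsWithin] with t ht
  exact ⟨v t, hv t ht⟩

end ScaleOfSpaces

/-! ### Mild solutions through a factorisation of the integrand. -/

section MildSolution

variable {K : Type*} [NormedAddCommGroup K] [InnerProductSpace ℝ K] [CompleteSpace K]
  {K' : Type*} [NormedAddCommGroup K'] [InnerProductSpace ℝ K'] [CompleteSpace K']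
  [MeasurableSpace K'] [BorelSpace K']
  {Ω : Type*} [MeasurableSpace Ω] {P : Measure Ω}
  {ι : K →L[ℝ] K'} {W : ℝ≥0 → Ω → K'}

-- The factorisation is available only for `u > 0`, so the single point `r = t` is discarded.
omit [CompleteSpace K] in
theorem comp_convIntegrand_ae_eq {F E E' : Type*} [NormedAddCommGroup F] [NormedSpace ℝ F]
    [NormedAddCommGroup E] [NormedSpace ℝ E] [NormedAddCommGroup E'] [NormedSpace ℝ E']
    {G : ℝ → F →L[ℝ] E} {V : K →L[ℝ] F} {A : E →L[ℝ] E'} {Ψ : ℝ → K →L[ℝ] E'}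
    (h : ∀ u, 0 < u → A.comp ((G u).comp V) = Ψ u) (t : ℝ≥0) :
    ∀ᵐ r ∂volume.restrict (Ioi (0 : ℝ)), A.comp (convIntegrand G V t r)
      = (Ioc (0 : ℝ) t).indicator (fun r => Ψ (t - r)) r := by
  refine ae_restrict_of_ae ?_
  filter_upwards [Measure.ae_ne volume (t : ℝ)] with r hr
  by_cases hrt : r ∈ Ioc (0 : ℝ) t
  · rw [convIntegrand, indicator_of_mem hrt, indicator_of_mem hrt,
      h _ (sub_pos.2 (lt_of_le_of_ne hrt.2 hr))]
  · rw [convIntegrand, indicator_of_notMem hrt, indicator_of_notMem hrt,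
      ContinuousLinearMap.comp_zero]

theorem exists_holderOnWith_of_contDiffOn {F : Type*} [NormedAddCommGroup F] [NormedSpace ℝ F]
    {v : ℝ → F} (hv : ContDiffOn ℝ 1 v (Ioi 0)) {δ : ℝ≥0} (hδ : δ ≤ 1) {t₀ R : ℝ≥0}
    (ht₀ : 0 < t₀) :
    ∃ C : ℝ≥0, HolderOnWith C δ (fun t : ℝ≥0 => v t) (Icc t₀ R) := by
  have hsub : Icc (t₀ : ℝ) R ⊆ Ioi 0 := fun t ht => lt_of_lt_of_le (by exact_mod_cast ht₀) ht.1
  obtain ⟨C, hC⟩ := (hv.mono hsub).exists_lipschitzOnWith one_ne_zero (convex_Icc _ _)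
    isCompact_Icc
  have h1 : LipschitzOnWith C (fun t : ℝ≥0 => v t) (Icc t₀ R) := fun s hs t ht =>
    hC (by exact_mod_cast hs) (by exact_mod_cast ht)
  have h2 (s : ℝ≥0) (hs : s ∈ Icc t₀ R) (t : ℝ≥0) (ht : t ∈ Icc t₀ R) : edist s t ≤ R := by
    rw [edist_nndist, ENNReal.coe_le_coe, NNReal.nndist_eq]
    exact max_le (tsub_le_self.trans hs.2) (tsub_le_self.trans ht.2)
  exact ⟨_, (holderOnWith_one.2 h1).of_le h2 hδ⟩

theorem holderOnWith_add {X F : Type*} [PseudoEMetricSpace X] [SeminormedAddCommGroup F]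
    {C C' δ : ℝ≥0} {f g : X → F} {s : Set X} (hf : HolderOnWith C δ f s)
    (hg : HolderOnWith C' δ g s) : HolderOnWith (C + C') δ (fun x => f x + g x) s :=
  fun x hx y hy => by
    refine (edist_add_add_le _ _ _ _).trans ?_
    rw [ENNReal.coe_add, add_mul]
    exact add_le_add (hf x hx y hy) (hg x hx y hy)

variable [IsProbabilityMeasure P] [TopologicalSpace.SeparableSpace K]
  {H : Type*} [NormedAddCommGroup H] [InnerProductSpace ℂ H] [CompleteSpace H]
  [TopologicalSpace.SeparableSpace H]
  {E : Type*} [NormedAddCommGroup E] [NormedSpace ℝ E]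
  {F : Type*} [NormedAddCommGroup F] [NormedSpace ℝ F]

/-- If the stochastic convolution factors through a singular kernel with values in `H`, followed by
an operator `A`, then the mild solution is the image under `A` of a Hölder continuous process. -/
theorem exists_holder_isMildSolution (hW : IsCylindricalWiener ι W P) {S : ℝ → H →L[ℂ] H}
    {Q : K →L[ℝ] H} {x₀ : H} {j A : H →L[ℝ] E} {B : E →L[ℝ] H} (hB : Function.Injective B)
    {G : ℝ → F →L[ℝ] H} {r : ℝ} (hG : IsSingularKernel G r) (hr : 0 ≤ r) (hr2 : r < 1 / 2)
    {V : K →L[ℝ] F} (hV : hsNormSq V < ∞)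
    (hA : ∀ u, 0 < u →
      A.comp ((G u).comp V) = j.comp (((S u).restrictScalars ℝ).comp Q))
    {v : ℝ → H} (hv : ContDiffOn ℝ 1 v (Ioi 0)) (hAv : ∀ t, 0 < t → A (v t) = j (S t x₀)) :
    ∃ Z : ℝ≥0 → Ω → H, IsMildSolution S Q x₀ ι W P j (fun t ω => A (Z t ω)) ∧
      (∀ x, IsMildSolution S Q x₀ ι W P j x → ∀ t : ℝ≥0, 0 < t → ∀ᵐ ω ∂P, x t ω = A (Z t ω)) ∧
      ∀ᵐ ω ∂P, ∀ δ : ℝ≥0, (δ : ℝ) < 1 / 2 - r → LocallyHolder δ (fun t => Z t ω) := by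
  let _ : InnerProductSpace ℝ H := InnerProductSpace.complexToReal
  have _ : TopologicalSpace.SeparableSpace K' := hW.denseRange.separableSpace ι.continuous
  have _ : SecondCountableTopology K' := UniformSpace.secondCountable_of_separable K'
  obtain ⟨Y, hY, hYh⟩ := hG.exists_holder_convolution hr hr2 hV hW
  have hI (t : ℝ≥0) := ((hY t).map A).congr (comp_convIntegrand_ae_eq hA t)
  refine ⟨fun t ω => v t + Y t ω, fun t ht => ⟨_, hI t, ?_⟩, fun x hx t ht => ?_, ?_⟩
  · filter_upwards with ω
    rw [map_add, hAv t (by exact_mod_cast ht)]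
  · obtain ⟨I, h1, h2⟩ := hx t ht
    -- Uniqueness of the integral is known for Hilbert targets only; `E` is merely normed, so both
    -- integrals are compared in `H` after applying the injective `B`.
    filter_upwards [h2, (h1.map B).ae_eq hW ((hI t).map B)] with ω hω hω2
    rw [hω, map_add, hAv t (by exact_mod_cast ht), hB hω2]
  · filter_upwards [hYh] with ω hω δ hδ t₀ R ht₀
    have hδ1 : δ ≤ 1 := by
      have : (δ : ℝ) ≤ 1 := by linarith
      exact_mod_cast this
    obtain ⟨C, hC⟩ := exists_holderOnWith_of_contDiffOn hv hδ1 ht₀ (R := R)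
    obtain ⟨C', hC'⟩ := hω δ hδ R
    exact ⟨C + C', holderOnWith_add hC (hC'.mono (Icc_subset_Icc_left zero_le))⟩

end MildSolution

/-! ### Factorisation of `S(u) Q` through the smoothing kernel. -/

section KernelFactorization

variable {H : Type*} [NormedAddCommGroup H] [NormedSpace ℂ H]

theorem eq_exp_smul_shifted (S : ℝ → H →L[ℂ] H) (lam t : ℝ) (x : H) :
    S t x = Real.exp (lam * t) • shifted S lam t x := by
  rw [shifted, smul_apply, smul_smul, ← Real.exp_add, add_neg_cancel, Real.exp_zero, one_smul]

variable [CompleteSpace H] {T : ℝ → H →L[ℂ] H} (hT : IsStableAnalytic T) {α β γ u : ℝ}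
include hT

/-- All factors commute, and the exponents add up: `-γ + (γ - α + β) - β = -α`. -/
theorem IsStableAnalytic.frac_smoothing_frac (hα : 0 ≤ α) (hβ : 0 ≤ β) (hγ : 0 ≤ γ)
    (h : γ - α + β ≤ 1) (hu : 0 < u) :
    frac T γ * (smoothing T (γ - α + β) u * frac T β) = T u * frac T α := by
  rw [← (hT.commute_frac_smoothing hβ h hu).eq, ← mul_assoc, hT.frac_mul_frac hγ hβ,
    hT.frac_mul_smoothing (by positivity) h, show γ - α + β - (γ + β) = -α by ring,
    hT.smoothing_of_nonpos (by linarith) hu, neg_neg, (hT.commute_frac_apply hα hu.le).eq]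

theorem IsStableAnalytic.smoothing_frac (hα : 0 ≤ α) (hβ : 0 ≤ β) (hγ : γ ≤ 0)
    (h : γ - α + β ≤ 1) (hu : 0 < u) :
    smoothing T (γ - α + β) u * frac T β = frac T (-γ) * (T u * frac T α) := by
  rw [← (hT.commute_frac_smoothing hβ h hu).eq, hT.frac_mul_smoothing hβ h,
    show γ - α + β - β = γ - α by ring, hT.smoothing_of_nonpos (by linarith) hu,
    show -(γ - α) = -γ + α by ring, ← hT.frac_mul_frac (by linarith) hα, mul_assoc,
    (hT.commute_frac_apply hα hu.le).eq]

end KernelFactorization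

section Data

variable {H : Type*} [NormedAddCommGroup H] [InnerProductSpace ℂ H] [CompleteSpace H]
  {K : Type*} [NormedAddCommGroup K] [InnerProductSpace ℝ K] [CompleteSpace K]
  {S : ℝ → H →L[ℂ] H} {lam a : ℝ}

omit [CompleteSpace H] [CompleteSpace K] in
-- Since `A^a` is norm-preserving from `H_a` to `H`, the operator `Q' = A^a Qa` is bounded.
theorem Interp.exists_factorization (hinj : Function.Injective (negPow S lam a))
    (Qa : K →L[ℝ] Interp S lam a) :
    ∃ Q' : K →L[ℝ] H, ∀ k, negPow S lam a (Q' k) = incl (Qa k) := by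
  let p : Interp S lam a →L[ℂ] H := LinearMap.mkContinuous Interp.pow 1 fun x => (one_mul ‖x‖).ge
  exact ⟨(p.restrictScalars ℝ).comp Qa, fun k => Interp.negPow_pow hinj (Qa k)⟩

end Data

end

end LinSPDE

/-! ### The theorem. -/

theorem mainTheorem12
    {H : Type*} [NormedAddCommGroup H] [InnerProductSpace ℂ H] [CompleteSpace H]
    [TopologicalSpace.SeparableSpace H]
    {K : Type*} [NormedAddCommGroup K] [InnerProductSpace ℝ K] [CompleteSpace K]
    [TopologicalSpace.SeparableSpace K]
    {K' : Type*} [NormedAddCommGroup K'] [InnerProductSpace ℝ K'] [CompleteSpace K']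
    [MeasurableSpace K'] [BorelSpace K']
    {Ω : Type*} [MeasurableSpace Ω] (P : Measure Ω) [IsProbabilityMeasure P]
    (ι : K →L[ℝ] K') (W : ℝ≥0 → Ω → K') (hW : LinSPDE.IsCylindricalWiener ι W P)
    (L : H →ₗ.[ℂ] H) (S : ℝ → H →L[ℂ] H) (hS : LinSPDE.IsAnalyticSemigroup S)
    (hL : LinSPDE.IsGenerator L S)
    (lam : ℝ) (hlam : LinSPDE.IsAdmissibleShift S lam)
    (α β : ℝ) (hα : 0 ≤ α) (hβ : 0 < β) (hβα : β ≤ 1 / 2 + α)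
    (Q : K →L[ℝ] H)
    (hQ : ∃ Qα : K →L[ℝ] LinSPDE.Interp S lam α, ∀ k, LinSPDE.Interp.incl (Qα k) = Q k)
    (hHS : LinSPDE.hsNormSq (LinSPDE.negPow S lam β) < ∞)
    (x₀ : H) :
    -- existence of the solution in `H` if `γ₀ > 0`
    (0 < 1 / 2 + α - β → ∃ x : ℝ≥0 → Ω → H,
      LinSPDE.IsMildSolution S Q x₀ ι W P (ContinuousLinearMap.id ℝ H) x) ∧
    -- regularity in `H_γ`, `0 ≤ γ < γ₀`
    (∀ γ : ℝ, 0 ≤ γ → γ < 1 / 2 + α - β →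
      ∀ x : ℝ≥0 → Ω → H,
        LinSPDE.IsMildSolution S Q x₀ ι W P (ContinuousLinearMap.id ℝ H) x →
        (∀ t : ℝ≥0, 0 < t → ∀ᵐ ω ∂P, x t ω ∈ (LinSPDE.posPow S lam γ).domain) ∧
        ∃ y : ℝ≥0 → Ω → LinSPDE.Interp S lam γ,
          (∀ t : ℝ≥0, 0 < t → ∀ᵐ ω ∂P, LinSPDE.Interp.incl (y t ω) = x t ω) ∧
          ∀ᵐ ω ∂P, ∀ δ : ℝ≥0, (δ : ℝ) < min (1 / 2) (1 / 2 + α - β - γ) →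
            LinSPDE.LocallyHolder δ (fun t => y t ω)) ∧
    -- existence and regularity in `H_γ`, `γ < 0`
    (∀ γ : ℝ, γ < 0 → γ < 1 / 2 + α - β →
      (∃ x : ℝ≥0 → Ω → LinSPDE.Extrap S lam (-γ),
        LinSPDE.IsMildSolution S Q x₀ ι W P
          ((LinSPDE.Extrap.ofH S lam (-γ)).restrictScalars ℝ) x) ∧
      ∀ x : ℝ≥0 → Ω → LinSPDE.Extrap S lam (-γ),
        LinSPDE.IsMildSolution S Q x₀ ι W P
          ((LinSPDE.Extrap.ofH S lam (-γ)).restrictScalars ℝ) x →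
        ∃ y : ℝ≥0 → Ω → LinSPDE.Extrap S lam (-γ),
          (∀ t : ℝ≥0, 0 < t → ∀ᵐ ω ∂P, y t ω = x t ω) ∧
          ∀ᵐ ω ∂P, ∀ δ : ℝ≥0, (δ : ℝ) < min (1 / 2) (1 / 2 + α - β - γ) →
            LinSPDE.LocallyHolder δ (fun t => y t ω)) := by
  have hT := hS.isStableAnalytic_shifted hlam
  set T := LinSPDE.shifted S lam with hTdef
  have hfrac (a : ℝ) : LinSPDE.negPow S lam a = LinSPDE.frac T a := LinSPDE.negPow_eq_frac S lam a
  have hinj {a : ℝ} (ha : 0 ≤ a) : Function.Injective (LinSPDE.negPow S lam a) := by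
    rw [hfrac]; exact hT.frac_injective ha
  have hST (t : ℝ) (x : H) : S t x = Real.exp (lam * t) • T t x :=
    LinSPDE.eq_exp_smul_shifted S lam t x
  have hexp : ContDiff ℝ 1 fun t : ℝ => Real.exp (lam * t) := by fun_prop
  obtain ⟨Qα, hQα⟩ := hQ
  obtain ⟨Q', hQ'⟩ := LinSPDE.Interp.exists_factorization (hinj hα) Qα
  have hQ'' (k : K) : LinSPDE.frac T α (Q' k) = Q k := by rw [← hfrac, hQ', hQα]
  -- All the Hilbert–Schmidt regularity is put into `V = A^{-β} Q'`; the kernel pays for it with the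
  -- additional power `β`.
  set V : K →L[ℝ] H := ((LinSPDE.negPow S lam β).restrictScalars ℝ).comp Q' with hVdef
  have hVk (k : K) : V k = LinSPDE.frac T β (Q' k) := by rw [← hfrac]; rfl
  have hV : LinSPDE.hsNormSq V < ∞ :=
    (LinSPDE.hsNormSq_restrictScalars_comp_le _ _).trans_lt
      (ENNReal.mul_lt_top (ENNReal.mul_lt_top (by simp) (by simp)) hHS)
  -- With `r = γ - α + β` one has `γ₀ - γ = 1/2 - r`, so the two forms of the Hölder range coincide.
  have hδ {γ : ℝ} {δ : ℝ≥0} (h : (δ : ℝ) < min (1 / 2) (1 / 2 + α - β - γ)) :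
      (δ : ℝ) < 1 / 2 - max (γ - α + β) 0 := by
    have h1 := h.trans_le (min_le_left _ _)
    have h2 := h.trans_le (min_le_right _ _)
    rcases max_cases (γ - α + β) 0 with h3 | h3 <;> linarith [h3.1]
  have hnonneg {γ : ℝ} (hγ : 0 ≤ γ) (hγ0 : γ < 1 / 2 + α - β) :
      ∃ Z : ℝ≥0 → Ω → H, LinSPDE.IsMildSolution S Q x₀ ι W P (ContinuousLinearMap.id ℝ H)
          (fun t ω => LinSPDE.negPow S lam γ (Z t ω)) ∧
        (∀ x, LinSPDE.IsMildSolution S Q x₀ ι W P (ContinuousLinearMap.id ℝ H) x →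
          ∀ t : ℝ≥0, 0 < t → ∀ᵐ ω ∂P, x t ω = LinSPDE.negPow S lam γ (Z t ω)) ∧
        ∀ᵐ ω ∂P, ∀ δ : ℝ≥0, (δ : ℝ) < 1 / 2 - max (γ - α + β) 0 →
          LinSPDE.LocallyHolder δ (fun t => Z t ω) := by
    obtain ⟨v, hv, hvd⟩ := hT.exists_frac_eq hγ x₀
    refine LinSPDE.exists_holder_isMildSolution hW
      (A := (LinSPDE.negPow S lam γ).restrictScalars ℝ) (B := ContinuousLinearMap.id ℝ H)
      Function.injective_id (hT.isSingularKernel_smoothingKernel lam) (le_max_right _ _)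
      (max_lt (by linarith) (by norm_num)) hV (fun u hu => ?_)
      (v := fun t => Real.exp (lam * t) • v t) (hexp.contDiffOn.smul hvd) (fun t ht => ?_)
    · ext k
      have h1 := congrArg (fun B : H →L[ℂ] H => B (Q' k))
        (hT.frac_smoothing_frac hα hβ.le hγ (by linarith) hu)
      simp only [mul_apply_eq_comp, hQ''] at h1
      change LinSPDE.negPow S lam γ (LinSPDE.smoothingKernel T lam _ u (V k)) = S u (Q k)
      rw [LinSPDE.smoothingKernel_apply, hfrac, hVk, hST, ← h1]
      exact map_real_smul (LinSPDE.frac T γ) (LinSPDE.frac T γ).continuous _ _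
    · change LinSPDE.negPow S lam γ (Real.exp (lam * t) • v t) = S t x₀
      rw [hfrac, hST, ← hv t ht]
      exact map_real_smul (LinSPDE.frac T γ) (LinSPDE.frac T γ).continuous _ _
  refine ⟨fun h0 => ?_, fun γ hγ hγ0 x hx => ?_, fun γ hγ hγ0 => ?_⟩
  · obtain ⟨Z, hZ, -⟩ := hnonneg le_rfl h0
    exact ⟨_, hZ⟩
  · obtain ⟨Z, -, hZ, hZh⟩ := hnonneg hγ hγ0
    -- The modification is `A^{-γ} Z`, defined for every `ω`; its increments in `H_γ` have exactly
    -- the norm of those of `Z` in `H`.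
    choose y hy hyZ using fun t ω => LinSPDE.Interp.exists_eq (hinj hγ) (Z t ω)
    refine ⟨fun t ht => ?_, y, fun t ht => ?_, ?_⟩
    · filter_upwards [hZ x hx t ht] with ω hω
      exact LinSPDE.mem_posPow_domain.2 ⟨_, hω.symm⟩
    · filter_upwards [hZ x hx t ht] with ω hω
      rw [hy, hω]
    · filter_upwards [hZh] with ω hω δ hδ' t₀ R ht₀
      obtain ⟨C, hC⟩ := hω δ (hδ hδ') t₀ R ht₀
      refine ⟨C, fun s hs t ht => ?_⟩
      have e : edist (y s ω) (y t ω) = edist (Z s ω) (Z t ω) := by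
        rw [edist_eq_enorm_sub, edist_eq_enorm_sub, ← ofReal_norm, ← ofReal_norm,
          LinSPDE.Interp.norm_def, map_sub, hyZ, hyZ]
      rw [e]
      exact hC s hs t ht
  · have hγ' : 0 ≤ -γ := by linarith
    obtain ⟨J, hJ⟩ := LinSPDE.Extrap.exists_linearIsometryEquiv (S := S) (lam := lam) (a := -γ)
      (by rw [hfrac]; exact hT.denseRange_frac hγ')
    have hJ' (x : H) : J.symm (LinSPDE.frac T (-γ) x) = LinSPDE.Extrap.ofH S lam (-γ) x := by
      rw [← hfrac, ← hJ, J.symm_apply_apply]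
    have hsm (c : ℝ) (x : H) : c • LinSPDE.frac T (-γ) x = LinSPDE.frac T (-γ) (c • x) :=
      (map_real_smul (LinSPDE.frac T (-γ)) (LinSPDE.frac T (-γ)).continuous _ _).symm
    -- For `γ < 0` the map playing the role of `A^{-γ}` is `J.symm`, an isometry of `H` onto `H_γ`,
    -- so Hölder continuity transfers directly.
    obtain ⟨Z, hZ0, hZ, hZh⟩ := LinSPDE.exists_holder_isMildSolution (x₀ := x₀) hW
      (j := (LinSPDE.Extrap.ofH S lam (-γ)).restrictScalars ℝ)
      (A := (J.symm.toContinuousLinearEquiv : H →L[ℂ] LinSPDE.Extrap S lam (-γ)).restrictScalars ℝ)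
      (B := (J.toContinuousLinearEquiv : LinSPDE.Extrap S lam (-γ) →L[ℂ] H).restrictScalars ℝ)
      J.injective (hT.isSingularKernel_smoothingKernel lam (r := γ - α + β)) (le_max_right _ _)
      (max_lt (by linarith) (by norm_num)) hV (S := S) (Q := Q) (fun u hu => by
        ext k
        have h1 := congrArg (fun B : H →L[ℂ] H => B (Q' k))
          (hT.smoothing_frac hα hβ.le hγ.le (by linarith) hu)
        simp only [mul_apply_eq_comp, hQ''] at h1
        change J.symm (LinSPDE.smoothingKernel T lam _ u (V k))
          = LinSPDE.Extrap.ofH S lam (-γ) (S u (Q k))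
        rw [LinSPDE.smoothingKernel_apply, hVk, h1, hsm, hJ', hST])
      (v := fun t => Real.exp (lam * t) • LinSPDE.frac T (-γ) (T t x₀))
      (hexp.contDiffOn.smul
        (((LinSPDE.frac T (-γ)).restrictScalars ℝ).contDiff.comp_contDiffOn
          (((ContinuousLinearMap.apply ℂ H x₀).restrictScalars ℝ).contDiff.comp_contDiffOn
            hT.contDiffOn)))
      (fun t ht => by
        change J.symm (Real.exp (lam * t) • LinSPDE.frac T (-γ) (T t x₀))
          = LinSPDE.Extrap.ofH S lam (-γ) (S t x₀)
        rw [hsm, hJ', hST])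
    refine ⟨⟨_, hZ0⟩, fun x hx => ⟨fun t ω => J.symm (Z t ω), fun t ht => ?_, ?_⟩⟩
    · filter_upwards [hZ x hx t ht] with ω hω
      exact hω.symm
    · filter_upwards [hZh] with ω hω δ hδ' t₀ R ht₀
      obtain ⟨C, hC⟩ := hω δ (hδ hδ') t₀ R ht₀
      refine ⟨C, fun s hs t ht => ?_⟩
      simp only [J.symm.isometry.edist_eq]
      exact hC s hs t ht
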